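/- Let $k$ be a commutative ring, $A$ a $k$-algebra and $H$ a Hopf algebra over $k$. Let $(h,a)\mapsto a^h$ be a weak action of $H$ on $A$, that is, a $k$-bilinear map $H\times A\to A$ with $(ab)^h=a^{h^{(1)}}b^{h^{(2)}}$, $1^h=\epsilon(h)1$ and $a^1=a$. Let $f\colon H\otimes H\to A$ be a $k$-linear map such that $E=A\#_fH$, that is, $A\otimes H$ with the product $(a\otimes h)(b\otimes l)=a\,b^{h^{(1)}}f(h^{(2)},l^{(1)})\otimes h^{(3)}l^{(2)}$, is associative with identity $1\otimes 1$ (a crossed product). Let $M$ be an $E$-bimodule that is symmetric over $k$. All tensor products are over $k$. For a $k$-algebra $B$ put $\overline B=B/k$, and let $\mathrm H_*(B,-)$, $\mathrm H^*(B,-)$ be the homology of the normalized Hochschild chain and cochain complexes of $B$ over $k$. Write $a\#h=a\otimes h$, identify $a\in A$ with $a\#1\in E$, and for $\mathbf h=h_1\otimes\cdots\otimes h_s$ put $a^{\mathbf h}=(\cdots(a^{h_s})^{h_{s-1}}\cdots)^{h_1}$ and $\mathbf h^{(1)}\otimes\mathbf h^{(2)}=(h_1^{(1)}\otimes\cdots\otimes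 h_s^{(1)})\otimes(h_1^{(2)}\otimes\cdots\otimes h_s^{(2)})$. For $r,s\ge0$ let $X_{rs}=E\otimes\overline H^{\otimes s}\otimes\overline A^{\otimes r}\otimes E$, an $E$-bimodule in the obvious way, and let $\sigma_{r+1,s}\colon X_{rs}\to X_{r+1,s}$ be $$\sigma_{r+1,s}(e\otimes\mathbf h\otimes a_1\otimes\cdots\otimes a_r\otimes(a_{r+1}\#l))=(-1)^{r+1}e\otimes\mathbf h\otimes a_1\otimes\cdots\otimes a_{r+1}\otimes(1\#l).$$ Let $d^l_{rs}\colon X_{rs}\to X_{r+l-1,s-l}$ ($0\le l\le s$, $r+l>0$) be the $E$-bimodule maps given on $1\otimes\mathbf h\otimes\mathbf a\otimes 1$ with $\mathbf h=h_1\otimes\cdots\otimes h_s$, $\mathbf a=a_1\otimes\cdots\otimes a_r$ as follows. * $d^0_{rs}$ sends it to $a_1^{\mathbf h^{(1)}}\otimes\mathbf h^{(2)}\otimes a_2\otimes\cdots\otimes a_r\otimes1+\sum_{i=1}^{r-1}(-1)^i\,1\otimes\mathbf h\otimes a_1\otimes\cdots\otimes a_ia_{i+1}\otimes\cdots\otimes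 a_r\otimes1+(-1)^r\,1\otimes\mathbf h\otimes a_1\otimes\cdots\otimes a_{r-1}\otimes a_r$. * $d^1_{0s}$ sends it to $(1\#h_1)\otimes h_2\otimes\cdots\otimes h_s\otimes1+\sum_{i=1}^{s-1}(-1)^i f(h_i^{(1)},h_{i+1}^{(1)})^{h_1^{(1)}\otimes\cdots\otimes h_{i-1}^{(1)}}\otimes h_1^{(2)}\otimes\cdots\otimes h_{i-1}^{(2)}\otimes h_i^{(2)}h_{i+1}^{(2)}\otimes h_{i+2}\otimes\cdots\otimes h_s\otimes1+(-1)^s\,1\otimes h_1\otimes\cdots\otimes h_{s-1}\otimes(1\#h_s)$. * In the remaining cases $d^l_{rs}=-\sum_{0\le j<l,\ r+j>0}\sigma_{r+l-1,s-l}\,d^{l-j}_{r+j-1,s-j}\,d^j_{rs}$ on such elements. Let $\widehat X_n=\bigoplus_{r+s=n}M\otimes\overline H^{\otimes s}\otimes\overline A^{\otimes r}$, with the map $\widehat d\colon\widehat X_{n+1}\to\widehat X_n$ induced by $\sum_{r,s,l}d^l_{rs}$ through $M\otimes_{E^e}X_{rs}\cong M\otimes\overline H^{\otimes s}\otimes\overline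 A^{\otimes r}$, and let $\widehat X^n=\bigoplus_{r+s=n}\mathrm{Hom}_k(\overline H^{\otimes s}\otimes\overline A^{\otimes r},M)$, with the map $\widehat d\colon\widehat X^n\to\widehat X^{n+1}$ induced through $\mathrm{Hom}_{E^e}(X_{rs},M)\cong\mathrm{Hom}_k(\overline H^{\otimes s}\otimes\overline A^{\otimes r},M)$. **Homology.** One has $\widehat d\,\widehat d=0$ on $\widehat X_*$. The spectral sequence of the complex $\widehat X_*=\widehat X_*(E,M)$ filtered by $F^i\widehat X_n=\bigoplus_{s\le i}M\otimes\overline H^{\otimes s}\otimes\overline A^{\otimes(n-s)}$ satisfies $$E^1_{rs}\cong\mathrm H_r(A,M\otimes\overline H^{\otimes s})\ \Rightarrow\ \mathrm H_{r+s}(E,M).$$ Here $s$ is the filtration degree, $d^p\colon E^p_{rs}\to E^p_{r+p-1,s-p}$, and $M\otimes\overline H^{\otimes s}$ is an $A$-bimodule through $a_1(m\otimes\mathbf h)a_2=a_1\,m\,a_2^{\mathbf h^{(1)}}\otimes\mathbf h^{(2)}$. The isomorphism sends the element of $E^1_{rs}$ represented by $x\in F^s\widehat X_{r+s}$ with $\widehat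 dx\in F^{s-1}$ to the class of its component in $M\otimes\overline H^{\otimes s}\otimes\overline A^{\otimes r}$. Convergence means: there are isomorphisms $\mathrm H_n(\widehat X_*)\cong\mathrm H_n(E,M)$, and for the filtration $\Phi_\bullet$ of $\mathrm H_n(E,M)$ that corresponds to the one induced by $F$ on $\mathrm H_n(\widehat X_*)$, which is finite and exhaustive, for each $(r,s)$ the differentials into and out of $E^p_{rs}$ vanish for all large $p$, and the stable value is $E^\infty_{rs}\cong\Phi_s\mathrm H_{r+s}(E,M)/\Phi_{s-1}\mathrm H_{r+s}(E,M)$. **Cohomology.** One has $\widehat d\,\widehat d=0$ on $\widehat X^*$. The spectral sequence of the complex $\widehat X^*=\widehat X^*(E,M)$ filtered by $F^i\widehat X^n=\bigoplus_{s\ge i}\mathrm{Hom}_k(\overline H^{\otimes s}\otimes\overline A^{\otimes(n-s)},M)$ converges in the same sense, $$E_1^{rs}\cong\mathrm H^r(A,\mathrm{Hom}_k(\overline H^{\otimes s},M))\ \Rightarrow\ \mathrm H^{r+s}(E,M),$$ with $d_p\colon E_p^{rs}\to E_p^{r-p+1,s+p}$, the $E_1$-isomorphism again given by the $(r,s)$-component,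 and $E_\infty^{rs}\cong\Phi^s\mathrm H^{r+s}(E,M)/\Phi^{s+1}\mathrm H^{r+s}(E,M)$. Here $\mathrm{Hom}_k(\overline H^{\otimes s},M)$ is an $A$-bimodule through $(a_1\varphi a_2)(\mathbf h)=a_1^{\mathbf h^{(1)}}\varphi(\mathbf h^{(2)})a_2$. -/

import Mathlib

open CategoryTheory
open scoped TensorProduct

universe u

set_option linter.unusedSectionVars false

noncomputable section

namespace HopfCrossed

section Bar
variable (k B : Type u) [CommRing k] [Ring B] [Algebra k B]

/-- The `k`-module `B̄ = B / k·1`. -/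
abbrev Bar : Type u := B ⧸ LinearMap.range (Algebra.linearMap k B)

/-- The tensor power `B̄ ⊗ ⋯ ⊗ B̄` (`n` factors). -/
def BarPow (n : ℕ) : Type u := ⨂[k]^n (Bar k B)

instance (n : ℕ) : AddCommGroup (BarPow k B n) := inferInstanceAs (AddCommGroup (⨂[k]^n (Bar k B)))

instance (n : ℕ) : Module k (BarPow k B n) := inferInstanceAs (Module k (⨂[k]^n (Bar k B)))

variable {B}

/-- The class of `b` in `B̄`. -/
def Bar.mk : B →ₗ[k] Bar k B := Submodule.mkQ _

variable {k}

/-- A linear map on `B` that kills `1` induces a map on `B̄`. -/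
def Bar.lift {W : Type u} [AddCommGroup W] [Module k W] (g : B →ₗ[k] W) (hg : g 1 = 0) :
    Bar k B →ₗ[k] W :=
  Submodule.liftQ _ g (by
    rintro _ ⟨c, rfl⟩
    rw [LinearMap.mem_ker, Algebra.linearMap_apply, Algebra.algebraMap_eq_smul_one, map_smul, hg,
      smul_zero])

@[simp] theorem Bar.lift_mk {W : Type u} [AddCommGroup W] [Module k W] (g : B →ₗ[k] W)
    (hg : g 1 = 0) (b : B) : Bar.lift g hg (Bar.mk k b) = g b := rfl

@[simp] theorem Bar.mk_one : Bar.mk k (1 : B) = 0 :=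
  (Submodule.Quotient.mk_eq_zero _).2 ⟨1, by simp⟩

theorem Bar.mk_surjective : Function.Surjective (Bar.mk k (B := B)) :=
  Submodule.mkQ_surjective _

variable (k B)

/-- The tensor `v₁ ⊗ ⋯ ⊗ vₙ`. -/
def BarPow.tprod {n : ℕ} (v : Fin n → Bar k B) : BarPow k B n := PiTensorProduct.tprod k v

/-- `BarPow k B n` is Mathlib's tensor power. -/
def BarPow.equiv (n : ℕ) : BarPow k B n ≃ₗ[k] ⨂[k]^n (Bar k B) :=
  (LinearEquiv.refl k (BarPow k B n) : BarPow k B n ≃ₗ[k] BarPow k B n)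

/-- `v₁ ⊗ (v₂ ⊗ ⋯ ⊗ vₙ₊₁) ↦ v₁ ⊗ v₂ ⊗ ⋯ ⊗ vₙ₊₁`. -/
def BarPow.cons (n : ℕ) : Bar k B ⊗[k] BarPow k B n ≃ₗ[k] BarPow k B (n + 1) :=
  (TensorProduct.congr (PiTensorProduct.subsingletonEquiv (R := k) (s := fun _ : Fin 1 => Bar k B)
      (0 : Fin 1)).symm (BarPow.equiv k B n)) ≪≫ₗ
    TensorPower.mulEquiv (R := k) (M := Bar k B) (n := 1) (m := n) ≪≫ₗ
    TensorPower.cast k (Bar k B) (Nat.add_comm 1 n) ≪≫ₗ (BarPow.equiv k B (n + 1)).symm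

/-- `(v₁ ⊗ ⋯ ⊗ vₙ) ⊗ vₙ₊₁ ↦ v₁ ⊗ ⋯ ⊗ vₙ ⊗ vₙ₊₁`. -/
def BarPow.snoc (n : ℕ) : BarPow k B n ⊗[k] Bar k B ≃ₗ[k] BarPow k B (n + 1) :=
  (TensorProduct.congr (BarPow.equiv k B n) (PiTensorProduct.subsingletonEquiv
      (R := k) (s := fun _ : Fin 1 => Bar k B) (0 : Fin 1)).symm) ≪≫ₗ
    TensorPower.mulEquiv (R := k) (M := Bar k B) (n := n) (m := 1) ≪≫ₗ
    (BarPow.equiv k B (n + 1)).symm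

theorem BarPow.cons_tprod (n : ℕ) (v : Bar k B) (x : Fin n → Bar k B) :
    BarPow.cons k B n (v ⊗ₜ BarPow.tprod k B x) = BarPow.tprod k B (Fin.cons v x) := by
  have h := TensorPower.tprod_mul_tprod k (M := Bar k B) (fun _ : Fin 1 => v) x
  rw [TensorPower.gMul_def] at h
  have h2 := congrArg (TensorPower.cast k (Bar k B) (Nat.add_comm 1 n)) h
  rw [TensorPower.cast_tprod] at h2
  have h3 : (PiTensorProduct.subsingletonEquiv (R := k) (s := fun _ : Fin 1 => Bar k B)
      (0 : Fin 1)).symm v = PiTensorProduct.tprod k (fun _ : Fin 1 => v) :=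
    PiTensorProduct.subsingletonEquiv_symm_apply' _ _
  rw [BarPow.cons, LinearEquiv.trans_apply, LinearEquiv.trans_apply, LinearEquiv.trans_apply,
    TensorProduct.congr_tmul, h3]
  refine Eq.trans ?_ (h2.trans ?_)
  · rfl
  · refine congrArg (PiTensorProduct.tprod k) (funext fun i => ?_)
    refine Fin.cases ?_ (fun i => ?_) i
    · simp [Fin.append, Fin.addCases]
    · simp [Fin.append, Fin.addCases, Fin.subNat]

theorem BarPow.snoc_tprod (n : ℕ) (v : Bar k B) (x : Fin n → Bar k B) :
    BarPow.snoc k B n (BarPow.tprod k B x ⊗ₜ v) = BarPow.tprod k B (Fin.snoc x v) := by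
  have h := TensorPower.tprod_mul_tprod k (M := Bar k B) x (fun _ : Fin 1 => v)
  have h3 : (PiTensorProduct.subsingletonEquiv (R := k) (s := fun _ : Fin 1 => Bar k B)
      (0 : Fin 1)).symm v = PiTensorProduct.tprod k (fun _ : Fin 1 => v) :=
    PiTensorProduct.subsingletonEquiv_symm_apply' _ _
  rw [TensorPower.gMul_def, Fin.append_right_eq_snoc] at h
  rw [BarPow.snoc, LinearEquiv.trans_apply, LinearEquiv.trans_apply,
    TensorProduct.congr_tmul, h3]
  exact h

end Bar

section Free
variable (k : Type u) [CommRing k] (B : Type u) [Ring B] [Algebra k B]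

/-- The free `B`-bimodule `B ⊗ V ⊗ B` on a `k`-module `V`. -/
abbrev Bim (V : Type u) [AddCommMonoid V] [Module k V] : Type u := B ⊗[k] (V ⊗[k] B)

variable {k B} {V W : Type u} [AddCommMonoid V] [Module k V] [AddCommMonoid W] [Module k W]

theorem Bim.induction {p : Bim k B V → Prop} (x : Bim k B V) (zero : p 0)
    (tmul : ∀ b v c, p (b ⊗ₜ (v ⊗ₜ c))) (add : ∀ x y, p x → p y → p (x + y)) : p x := by
  refine TensorProduct.induction_on x zero (fun b y => ?_) add
  refine TensorProduct.induction_on y ?_ (fun v c => tmul b v c) (fun y z hy hz => ?_)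
  · rw [TensorProduct.tmul_zero]; exact zero
  · rw [TensorProduct.tmul_add]; exact add _ _ hy hz

/-- The bimodule structure of `B ⊗ W ⊗ B`: `sandwich b c x = b x c`. -/
def sandwich : B →ₗ[k] B →ₗ[k] Bim k B W →ₗ[k] Bim k B W :=
  LinearMap.mk₂ k
    (fun b c => TensorProduct.map (LinearMap.mulLeft k b)
      (TensorProduct.map LinearMap.id (LinearMap.mulRight k c)))
    (fun b b' c => by ext; simp [add_mul, TensorProduct.add_tmul])
    (fun r b c => by ext; simp [TensorProduct.smul_tmul'])
    (fun b c c' => by ext; simp [mul_add, TensorProduct.tmul_add])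
    (fun r b c => by ext; simp)

@[simp] theorem sandwich_tmul (b c b' c' : B) (w : W) :
    sandwich (k := k) b c (b' ⊗ₜ (w ⊗ₜ c')) = (b * b') ⊗ₜ (w ⊗ₜ (c' * c)) := rfl

/-- The `B`-bimodule map `B ⊗ V ⊗ B → B ⊗ W ⊗ B` with `1 ⊗ v ⊗ 1 ↦ g v`, that is,
`b ⊗ v ⊗ c ↦ b (g v) c`. -/
def extend (g : V →ₗ[k] Bim k B W) : Bim k B V →ₗ[k] Bim k B W :=
  TensorProduct.lift
    { toFun := fun b => TensorProduct.lift (LinearMap.mk₂ k (fun v c => sandwich b c (g v))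
        (fun _ _ _ => by simp) (fun _ _ _ => by simp) (fun _ _ _ => by simp)
        (fun _ _ _ => by simp))
      map_add' := fun b b' => by ext; simp
      map_smul' := fun r b => by ext; simp }

@[simp] theorem extend_tmul (g : V →ₗ[k] Bim k B W) (b c : B) (v : V) :
    extend g (b ⊗ₜ (v ⊗ₜ c)) = sandwich b c (g v) := by simp [extend]

variable (N : Type u) [AddCommGroup N] [Module k N] [Module B N] [Module Bᵐᵒᵖ N]
  [IsScalarTower k B N] [IsScalarTower k Bᵐᵒᵖ N] [SMulCommClass B Bᵐᵒᵖ N]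

/-- `m ⊗ (b ⊗ w ⊗ c) ↦ c m b ⊗ w`, the identification `N ⊗_{Bᵉ} (B ⊗ W ⊗ B) = N ⊗ W`. -/
def contract : N →ₗ[k] Bim k B W →ₗ[k] N ⊗[k] W where
  toFun m := TensorProduct.lift
    { toFun := fun b => TensorProduct.lift (LinearMap.mk₂ k
        (fun w c => (c • MulOpposite.op b • m) ⊗ₜ[k] w)
        (fun _ _ _ => by rw [TensorProduct.tmul_add])
        (fun _ _ _ => by rw [TensorProduct.tmul_smul])
        (fun _ _ _ => by rw [add_smul, TensorProduct.add_tmul])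
        (fun _ _ _ => by rw [smul_assoc, TensorProduct.smul_tmul']))
      map_add' := fun b b' => by ext; simp [add_smul, TensorProduct.add_tmul]
      map_smul' := fun r b => by
        ext w c
        simp [TensorProduct.smul_tmul', smul_comm c r] }
  map_add' m m' := by ext; simp [TensorProduct.add_tmul]
  map_smul' r m := by
    ext b w c
    simp [TensorProduct.smul_tmul', smul_comm _ r]

@[simp] theorem contract_tmul (m : N) (b c : B) (w : W) :
    contract N m (b ⊗ₜ[k] (w ⊗ₜ[k] c)) = (c • MulOpposite.op b • m) ⊗ₜ[k] w := by
  simp [contract]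

/-- `b ⊗ w ⊗ c ↦ b φ(w) c`, the identification `Hom_k(W, N) = Hom_{Bᵉ}(B ⊗ W ⊗ B, N)`. -/
def evaluate : (W →ₗ[k] N) →ₗ[k] Bim k B W →ₗ[k] N where
  toFun φ := TensorProduct.lift
    { toFun := fun b => TensorProduct.lift (LinearMap.mk₂ k
        (fun w c => b • MulOpposite.op c • φ w)
        (fun _ _ _ => by simp)
        (fun r w c => by rw [map_smul, smul_comm _ r, smul_comm _ r])
        (fun _ _ _ => by simp [add_smul])
        (fun r w c => by rw [MulOpposite.op_smul, smul_assoc, smul_comm _ r]))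
      map_add' := fun b b' => by ext; simp [add_smul]
      map_smul' := fun r b => by ext; simp }
  map_add' m m' := by ext; simp
  map_smul' r m := by
    ext b w c
    simp [smul_comm _ r]

@[simp] theorem evaluate_tmul (φ : W →ₗ[k] N) (b c : B) (w : W) :
    evaluate N φ (b ⊗ₜ[k] (w ⊗ₜ[k] c)) = b • MulOpposite.op c • φ w := by
  simp [evaluate]

/-- The map `N ⊗ V → N ⊗ W` obtained by applying `N ⊗_{Bᵉ} -` to `extend g`. -/
def chainMap (g : V →ₗ[k] Bim k B W) : N ⊗[k] V →ₗ[k] N ⊗[k] W :=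
  TensorProduct.lift ((contract N).compl₂ g)

@[simp] theorem chainMap_tmul (g : V →ₗ[k] Bim k B W) (m : N) (v : V) :
    chainMap N g (m ⊗ₜ v) = contract N m (g v) := by simp [chainMap]

/-- The map `Hom_k(W, N) → Hom_k(V, N)` obtained by applying `Hom_{Bᵉ}(-, N)` to `extend g`. -/
def cochainMap (g : V →ₗ[k] Bim k B W) : (W →ₗ[k] N) →ₗ[k] (V →ₗ[k] N) :=
  (LinearMap.lcomp k N g) ∘ₗ evaluate N

@[simp] theorem cochainMap_apply (g : V →ₗ[k] Bim k B W) (φ : W →ₗ[k] N) (v : V) :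
    cochainMap N g φ v = evaluate N φ (g v) := rfl

variable {U : Type u} [AddCommMonoid U] [Module k U]

theorem chainMap_comp (f : V →ₗ[k] Bim k B W) (g : U →ₗ[k] Bim k B V) :
    chainMap N f ∘ₗ chainMap N g = chainMap N (extend f ∘ₗ g) := by
  have key : ∀ (m : N) (x : Bim k B V),
      chainMap N f (contract N m x) = contract N m (extend f x) := by
    intro m x
    induction x using Bim.induction with
    | zero => simp only [map_zero]
    | add x y hx hy => simp only [map_add, hx, hy]
    | tmul b v c =>
      simp only [contract_tmul, chainMap_tmul, extend_tmul]
      generalize f v = z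
      induction z using Bim.induction with
      | zero => simp only [map_zero]
      | add x y hx hy => simp only [map_add, hx, hy]
      | tmul b' v c' => simp [mul_smul, smul_comm]
  refine TensorProduct.ext' fun m u => ?_
  simp [key]

theorem cochainMap_comp (f : V →ₗ[k] Bim k B W) (g : U →ₗ[k] Bim k B V) :
    cochainMap N g ∘ₗ cochainMap N f = cochainMap N (extend f ∘ₗ g) := by
  have key : ∀ (φ : W →ₗ[k] N) (x : Bim k B V),
      evaluate N (cochainMap N f φ) x = evaluate N φ (extend f x) := by
    intro φ x
    induction x using Bim.induction with
    | zero => simp only [map_zero]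
    | add x y hx hy => simp only [map_add, hx, hy]
    | tmul b v c =>
      simp only [evaluate_tmul, cochainMap_apply, extend_tmul]
      generalize f v = z
      induction z using Bim.induction with
      | zero => simp only [map_zero, smul_zero]
      | add x y hx hy => simp only [map_add, smul_add, hx, hy]
      | tmul b' v c' => simp [mul_smul, smul_comm]
  ext φ u
  simp [key]

end Free

section Merge
variable {k : Type u} [CommRing k] {B : Type u} [Ring B] [Algebra k B]

/-- A map `(b, w) ↦ G b w` with `G 1 = 0` induces `b ⊗ w ↦ G b w` on `B̄ ⊗ W`. -/
def Bar.lift₂ {W X : Type u} [AddCommMonoid W] [Module k W] [AddCommGroup X] [Module k X]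
    (G : B →ₗ[k] W →ₗ[k] X) (hG : G 1 = 0) : Bar k B ⊗[k] W →ₗ[k] X :=
  let G' := Bar.lift G hG
  TensorProduct.lift G'

@[simp] theorem Bar.lift₂_tmul {W X : Type u} [AddCommMonoid W] [Module k W] [AddCommGroup X]
    [Module k X] (G : B →ₗ[k] W →ₗ[k] X) (hG : G 1 = 0) (b : B) (w : W) :
    Bar.lift₂ G hG (Bar.mk k b ⊗ₜ w) = G b w := rfl

/-- A map `(b, u, w) ↦ G b u w` with `G 1 = 0` induces `u ↦ (b ⊗ w ↦ G b u w)` on `B̄ ⊗ W`. -/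
def Bar.lift₃ {U W X : Type u} [AddCommMonoid U] [Module k U] [AddCommMonoid W] [Module k W]
    [AddCommGroup X] [Module k X] (G : B →ₗ[k] U →ₗ[k] W →ₗ[k] X) (hG : G 1 = 0) :
    U →ₗ[k] (Bar k B ⊗[k] W →ₗ[k] X) :=
  (TensorProduct.lift.equiv (RingHom.id k) (Bar k B) W X).toLinearMap ∘ₗ (Bar.lift G hG).flip

@[simp] theorem Bar.lift₃_tmul {U W X : Type u} [AddCommMonoid U] [Module k U] [AddCommMonoid W]
    [Module k W] [AddCommGroup X] [Module k X] (G : B →ₗ[k] U →ₗ[k] W →ₗ[k] X) (hG : G 1 = 0)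
    (u : U) (b : B) (w : W) : Bar.lift₃ G hG u (Bar.mk k b ⊗ₜ w) = G b u w := rfl

theorem Bar.tensor_ext {W X : Type u} [AddCommMonoid W] [Module k W]
    [AddCommGroup X] [Module k X] {f g : Bar k B ⊗[k] W →ₗ[k] X}
    (h : ∀ b w, f (Bar.mk k b ⊗ₜ w) = g (Bar.mk k b ⊗ₜ w)) : f = g := by
  refine TensorProduct.ext' fun x w => ?_
  obtain ⟨b, rfl⟩ := Bar.mk_surjective x
  exact h b w

variable (k B)

/-- The `k`-module `B̄ⁿ ⊗ B`. -/
abbrev BarMod (n : ℕ) : Type u := BarPow k B n ⊗[k] B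

/-- `B̄ ⊗ (B̄ⁿ ⊗ B) = B̄ⁿ⁺¹ ⊗ B`. -/
def BarMod.cons (n : ℕ) : Bar k B ⊗[k] BarMod k B n ≃ₗ[k] BarMod k B (n + 1) :=
  (TensorProduct.assoc k (Bar k B) (BarPow k B n) B).symm ≪≫ₗ
    TensorProduct.congr (BarPow.cons k B n) (LinearEquiv.refl k B)

variable {k B} in
theorem BarMod.induction {n : ℕ} {p : BarMod k B (n + 1) → Prop} (x : BarMod k B (n + 1))
    (zero : p 0) (cons : ∀ b w, p (BarMod.cons k B n (Bar.mk k b ⊗ₜ w)))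
    (add : ∀ x y, p x → p y → p (x + y)) : p x := by
  obtain ⟨x, rfl⟩ := (BarMod.cons k B n).surjective x
  refine TensorProduct.induction_on x (by rwa [map_zero]) (fun b w => ?_)
    (fun x y hx hy => by rw [map_add]; exact add _ _ hx hy)
  obtain ⟨b, rfl⟩ := Bar.mk_surjective b
  exact cons b w

variable {k B} in
/-- One step of the recursion for `barMerge`. -/
def barMergeStep {n : ℕ} (L : B →ₗ[k] BarMod k B n →ₗ[k] BarMod k B n) :
    B →ₗ[k] B →ₗ[k] BarMod k B n →ₗ[k] Bar k B ⊗[k] BarMod k B n :=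
  LinearMap.mk₂ k (fun b₁ b₀ =>
      TensorProduct.mk k _ _ (Bar.mk k (b₀ * b₁)) - TensorProduct.mk k _ _ (Bar.mk k b₀) ∘ₗ L b₁)
    (fun _ _ _ => by
      refine LinearMap.ext fun w => ?_
      simp [mul_add, TensorProduct.tmul_add]; abel)
    (fun _ _ _ => by
      refine LinearMap.ext fun w => ?_
      simp [smul_sub, TensorProduct.smul_tmul'])
    (fun _ _ _ => by
      refine LinearMap.ext fun w => ?_
      simp [add_mul]; abel)
    (fun _ _ _ => by
      refine LinearMap.ext fun w => ?_
      simp [smul_sub, TensorProduct.smul_tmul'])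

variable {k B} in
@[simp] theorem barMergeStep_apply {n : ℕ} (L : B →ₗ[k] BarMod k B n →ₗ[k] BarMod k B n) (b₁ b₀ : B)
    (w : BarMod k B n) : barMergeStep L b₁ b₀ w =
      Bar.mk k (b₀ * b₁) ⊗ₜ w - Bar.mk k b₀ ⊗ₜ L b₁ w := rfl

/-- The map underlying `barMerge`, with the fact that makes the recursion well defined. -/
def barMergeAux : (n : ℕ) → { L : B →ₗ[k] BarMod k B n →ₗ[k] BarMod k B n // L 1 = LinearMap.id }
  | 0 => ⟨LinearMap.lTensorHom (BarPow k B 0) ∘ₗ LinearMap.mul k B, by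
      refine TensorProduct.ext' fun x y => ?_
      simp⟩
  | n + 1 =>
    ⟨{  toFun := fun b₀ => (BarMod.cons k B n).toLinearMap ∘ₗ
          (Bar.lift₃ (X := Bar k B ⊗[k] BarMod k B n) (barMergeStep (barMergeAux n).1) (by
            refine LinearMap.ext fun b => LinearMap.ext fun w => ?_
            simp [(barMergeAux n).2]) b₀) ∘ₗ ((BarMod.cons k B n).symm.toLinearMap :
            BarMod k B (n + 1) →ₗ[k] Bar k B ⊗[k] BarMod k B n)
        map_add' := fun b b' => by simp only [map_add, LinearMap.add_comp, LinearMap.comp_add]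
        map_smul' := fun r b => by
          simp only [map_smul, LinearMap.smul_comp, LinearMap.comp_smul, RingHom.id_apply] }, by
      refine LinearMap.ext fun x => ?_
      induction x using BarMod.induction with
      | zero => simp only [map_zero]
      | cons b w => simp
      | add x y hx hy => simp only [map_add, hx, hy]⟩

/-- For `b₀ ∈ B`, the map `B̄ⁿ ⊗ B → B̄ⁿ ⊗ B`,
`b₁ ⊗ ⋯ ⊗ bₙ ⊗ c ↦ b₀b₁ ⊗ b₂ ⊗ ⋯ ⊗ c - b₀ ⊗ b₁b₂ ⊗ b₃ ⊗ ⋯ ⊗ c + ⋯ + (-1)ⁿ b₀ ⊗ ⋯ ⊗ bₙ₋₁ ⊗ bₙc`.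
It satisfies `b₀ ⋆ c = b₀c` for `n = 0` and `b₀ ⋆ (b₁ ⊗ w) = b₀b₁ ⊗ w - b₀ ⊗ (b₁ ⋆ w)`, and is
defined by this recursion (the single summands do not descend to `B̄`, their sum does). -/
def barMerge (n : ℕ) : B →ₗ[k] BarMod k B n →ₗ[k] BarMod k B n := (barMergeAux k B n).1

@[simp] theorem barMerge_one (n : ℕ) (w : BarMod k B n) : barMerge k B n 1 w = w := by
  simp [barMerge, (barMergeAux k B n).2]

theorem barMerge_zero (b c : B) (x : BarPow k B 0) :
    barMerge k B 0 b (x ⊗ₜ c) = x ⊗ₜ (b * c) := by simp [barMerge, barMergeAux]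

theorem barMerge_succ (n : ℕ) (b₀ b₁ : B) (w : BarMod k B n) :
    barMerge k B (n + 1) b₀ (BarMod.cons k B n (Bar.mk k b₁ ⊗ₜ w)) =
      BarMod.cons k B n (Bar.mk k (b₀ * b₁) ⊗ₜ w - Bar.mk k b₀ ⊗ₜ barMerge k B n b₁ w) := by
  simp [barMerge, barMergeAux]

theorem barMerge_mul (n : ℕ) (a b : B) (w : BarMod k B n) :
    barMerge k B n (a * b) w = barMerge k B n a (barMerge k B n b w) := by
  induction n generalizing a b with
  | zero =>
    induction w using TensorProduct.induction_on with
    | zero => simp only [map_zero]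
    | tmul x c => simp only [barMerge_zero, mul_assoc]
    | add x y hx hy => simp only [map_add, hx, hy]
  | succ n ih =>
    induction w using BarMod.induction with
    | zero => simp only [map_zero]
    | cons c w => simp only [barMerge_succ, map_sub, mul_assoc, ih,
        sub_sub_sub_cancel_right]
    | add x y hx hy => simp only [map_add, hx, hy]

/-- Right multiplication by `c` on the last factor of `B̄ⁿ ⊗ B`. -/
def BarMod.mulRight (n : ℕ) (c : B) : BarMod k B n →ₗ[k] BarMod k B n :=
  LinearMap.lTensor _ (LinearMap.mulRight k c)

theorem BarMod.mulRight_cons (n : ℕ) (b c : B) (w : BarMod k B n) :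
    BarMod.mulRight k B (n + 1) c (BarMod.cons k B n (Bar.mk k b ⊗ₜ w)) =
      BarMod.cons k B n (Bar.mk k b ⊗ₜ BarMod.mulRight k B n c w) := by
  induction w using TensorProduct.induction_on with
  | zero => simp
  | tmul x c => simp [BarMod.cons, BarMod.mulRight]
  | add x y hx hy => simp only [map_add, TensorProduct.tmul_add, hx, hy]

theorem barMerge_mulRight (n : ℕ) (b c : B) (w : BarMod k B n) :
    barMerge k B n b (BarMod.mulRight k B n c w) = BarMod.mulRight k B n c (barMerge k B n b w) := by
  induction n generalizing b with
  | zero =>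
    induction w using TensorProduct.induction_on with
    | zero => simp only [map_zero]
    | tmul x c => simp [barMerge_zero, BarMod.mulRight, mul_assoc]
    | add x y hx hy => simp only [map_add, hx, hy]
  | succ n ih =>
    induction w using BarMod.induction with
    | zero => simp only [map_zero]
    | cons d w => simp only [barMerge_succ, map_sub, BarMod.mulRight_cons, ih]
    | add x y hx hy => simp only [map_add, hx, hy]

variable {k B}

/-- `t ↦ t ⊗ 1`, from `B̄ⁿ` to `B̄ⁿ ⊗ B`. -/
def BarMod.inl (n : ℕ) : BarPow k B n →ₗ[k] BarMod k B n := (TensorProduct.mk k _ _).flip 1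

variable (k B)

/-- `(b, t) ↦ b ⊗ (t ⊗ 1) - 1 ⊗ (b ⋆ (t ⊗ 1))`. -/
def barDStep (n : ℕ) : B →ₗ[k] BarPow k B n →ₗ[k] Bim k B (BarPow k B n) :=
  LinearMap.mk₂ k (fun b t => b ⊗ₜ BarMod.inl n t - 1 ⊗ₜ barMerge k B n b (BarMod.inl n t))
    (fun _ _ _ => by
      simp only [map_add, LinearMap.add_apply, TensorProduct.add_tmul, TensorProduct.tmul_add]
      abel)
    (fun _ _ _ => by
      simp only [map_smul, LinearMap.smul_apply, ← TensorProduct.smul_tmul', smul_sub,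
        TensorProduct.tmul_smul])
    (fun _ _ _ => by simp only [map_add, TensorProduct.tmul_add]; abel)
    (fun _ _ _ => by simp only [map_smul, smul_sub, TensorProduct.tmul_smul])

theorem barDStep_one (n : ℕ) : barDStep k B n 1 = 0 :=
  LinearMap.ext fun t => by simp [barDStep]

/-- The differential of the normalized bar resolution `B ⊗ B̄* ⊗ B`, on generators: the map
`B̄ⁿ⁺¹ → B ⊗ B̄ⁿ ⊗ B`, `b₁ ⊗ ⋯ ⊗ bₙ₊₁ ↦ b₁ ⊗ (b₂ ⊗ ⋯ ⊗ bₙ₊₁) ⊗ 1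
+ ∑ᵢ (-1)ⁱ 1 ⊗ (b₁ ⊗ ⋯ ⊗ bᵢbᵢ₊₁ ⊗ ⋯ ⊗ bₙ₊₁) ⊗ 1 + (-1)ⁿ⁺¹ 1 ⊗ (b₁ ⊗ ⋯ ⊗ bₙ) ⊗ bₙ₊₁`. -/
def barD (n : ℕ) : BarPow k B (n + 1) →ₗ[k] Bim k B (BarPow k B n) :=
  Bar.lift₂ (barDStep k B n) (barDStep_one k B n) ∘ₗ
    (BarPow.cons k B n).symm.toLinearMap

theorem barD_cons (n : ℕ) (b : B) (t : BarPow k B n) :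
    barD k B n (BarPow.cons k B n (Bar.mk k b ⊗ₜ t)) =
      b ⊗ₜ BarMod.inl n t - 1 ⊗ₜ barMerge k B n b (BarMod.inl n t) := by
  simp [barD, barDStep]

theorem extend_barD (n : ℕ) (b c : B) (w : BarMod k B n) :
    extend (barD k B n) (c ⊗ₜ[k] BarMod.cons k B n (Bar.mk k b ⊗ₜ w)) =
      (c * b) ⊗ₜ w - c ⊗ₜ barMerge k B n b w := by
  induction w using TensorProduct.induction_on with
  | zero => simp
  | add x y hx hy =>
    simp only [map_add, TensorProduct.tmul_add, hx, hy]; abel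
  | tmul t e =>
    have key : ∀ x : BarMod k B n, sandwich c e (1 ⊗ₜ x) = c ⊗ₜ BarMod.mulRight k B n e x := by
      intro x
      simp [sandwich, BarMod.mulRight, LinearMap.lTensor]
    have h : BarMod.mulRight k B n e (BarMod.inl n t) = t ⊗ₜ e := by
      simp [BarMod.inl, BarMod.mulRight]
    have h2 : BarMod.cons k B n (Bar.mk k b ⊗ₜ (t ⊗ₜ e)) =
        BarPow.cons k B n (Bar.mk k b ⊗ₜ t) ⊗ₜ e := by simp [BarMod.cons]
    rw [h2, extend_tmul, barD_cons, map_sub, key, ← barMerge_mulRight, h]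
    simp [BarMod.inl]

theorem extend_barD_barD (n : ℕ) : extend (barD k B n) ∘ₗ barD k B (n + 1) = 0 := by
  refine LinearMap.ext fun x => ?_
  obtain ⟨x, rfl⟩ := (BarPow.cons k B (n + 1)).surjective x
  induction x using TensorProduct.induction_on with
  | zero => simp only [map_zero]
  | add x y hx hy => simp only [map_add, hx, hy]
  | tmul b t =>
    obtain ⟨b, rfl⟩ := Bar.mk_surjective b
    rw [LinearMap.comp_apply, barD_cons]
    generalize BarMod.inl (n + 1) t = w
    induction w using BarMod.induction with
    | zero => simp
    | add x y hx hy => 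
      simp only [map_add, TensorProduct.tmul_add, add_sub_add_comm, hx, hy, LinearMap.zero_apply,
        add_zero]
    | cons d w =>
      simp [barMerge_succ, TensorProduct.tmul_sub, extend_barD, barMerge_mul]

end Merge

section Hochschild
variable (k : Type u) [CommRing k] (B : Type u) [Ring B] [Algebra k B]
  (N : Type u) [AddCommGroup N] [Module k N] [Module B N] [Module Bᵐᵒᵖ N]
  [IsScalarTower k B N] [IsScalarTower k Bᵐᵒᵖ N] [SMulCommClass B Bᵐᵒᵖ N]

/-- The normalized Hochschild chain complex `(N ⊗ B̄*, b)` of `B` with coefficients in `N`. -/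
def hochschildChain : ChainComplex (ModuleCat.{u} k) ℕ :=
  ChainComplex.of (fun n => ModuleCat.of k (N ⊗[k] BarPow k B n))
    (fun n => ModuleCat.ofHom (chainMap N (barD k B n)))
    (fun n => by
      rw [← ModuleCat.ofHom_comp, chainMap_comp, extend_barD_barD]
      ext; simp [chainMap])

/-- The normalized Hochschild cochain complex `(Hom_k(B̄*, N), b)` of `B` with coefficients
in `N`. -/
def hochschildCochain : CochainComplex (ModuleCat.{u} k) ℕ :=
  CochainComplex.of (fun n => ModuleCat.of k (BarPow k B n →ₗ[k] N))
    (fun n => ModuleCat.ofHom (cochainMap N (barD k B n)))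
    (fun n => by
      rw [← ModuleCat.ofHom_comp, cochainMap_comp, extend_barD_barD]
      ext; simp [cochainMap])

/-- The Hochschild homology `Hₙ(B, N)` of the `k`-algebra `B`. -/
abbrev HH (n : ℕ) : ModuleCat.{u} k := (hochschildChain k B N).homology n

/-- The Hochschild cohomology `Hⁿ(B, N)` of the `k`-algebra `B`. -/
abbrev HHco (n : ℕ) : ModuleCat.{u} k := (hochschildCochain k B N).homology n
end Hochschild

section Crossed
variable (k A H : Type u) [CommRing k] [Ring A] [Algebra k A] [Ring H] [Bialgebra k H]

/-- A weak action `(h, a) ↦ aʰ` of the bialgebra `H` on the algebra `A`, together with a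
`k`-linear map `f : H ⊗ H → A`. -/
structure WeakActionWithMap where
  /-- `act h a = aʰ` -/
  act : H →ₗ[k] A →ₗ[k] A
  /-- `(ab)ʰ = a^{h⁽¹⁾} b^{h⁽²⁾}` -/
  act_mul : ∀ h a b, act h (a * b) = LinearMap.mul' k A
    (TensorProduct.map (act.flip a) (act.flip b) (Coalgebra.comul (R := k) h))
  /-- `1ʰ = ε(h) 1` -/
  act_one : ∀ h, act h 1 = algebraMap k A (Coalgebra.counit h)
  /-- `a¹ = a` -/
  one_act : ∀ a, act 1 a = a
  /-- the map `f` -/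
  f : H ⊗[k] H →ₗ[k] A

namespace WeakActionWithMap
variable {k A H} (D : WeakActionWithMap k A H)

/-- `(a, h) ↦ a^{h⁽¹⁾} ⊗ h⁽²⁾`. -/
def twist : A →ₗ[k] H →ₗ[k] A ⊗[k] H :=
  (LinearMap.lcomp k (A ⊗[k] H) (Coalgebra.comul (R := k) (A := H))) ∘ₗ
    (LinearMap.rTensorHom H) ∘ₗ D.act.flip

theorem twist_apply (a : A) (h : H) :
    D.twist a h = TensorProduct.map (D.act.flip a) LinearMap.id (Coalgebra.comul (R := k) h) := rfl

/-- `h ⊗ l ↦ f(h⁽¹⁾, l⁽¹⁾) ⊗ h⁽²⁾l⁽²⁾`. -/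
def chi : H ⊗[k] H →ₗ[k] A ⊗[k] H :=
  TensorProduct.map D.f (LinearMap.mul' k H) ∘ₗ Coalgebra.comul

/-- `(a, b ⊗ x) ↦ ab ⊗ x`. -/
def lmul (X : Type u) [AddCommMonoid X] [Module k X] : A →ₗ[k] A ⊗[k] X →ₗ[k] A ⊗[k] X :=
  LinearMap.rTensorHom X ∘ₗ LinearMap.mul k A

@[simp] theorem lmul_tmul {X : Type u} [AddCommMonoid X] [Module k X] (a b : A) (x : X) :
    lmul (k := k) X a (b ⊗ₜ x) = (a * b) ⊗ₜ x := rfl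

theorem lmul_mul {X : Type u} [AddCommMonoid X] [Module k X] (a b : A) (x : A ⊗[k] X) :
    lmul (k := k) X (a * b) x = lmul X a (lmul X b x) := by
  induction x using TensorProduct.induction_on with
  | zero => simp only [map_zero]
  | tmul c x => simp [mul_assoc]
  | add x y hx hy => simp only [map_add, hx, hy]

@[simp] theorem lmul_one {X : Type u} [AddCommMonoid X] [Module k X] (x : A ⊗[k] X) :
    lmul (k := k) X 1 x = x := by
  induction x using TensorProduct.induction_on with
  | zero => simp only [map_zero]
  | tmul c x => simp
  | add x y hx hy => simp only [map_add, hx, hy]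

/-- `(x ⊗ h, l) ↦ x f(h⁽¹⁾, l⁽¹⁾) ⊗ h⁽²⁾l⁽²⁾`. -/
def mulChi : A ⊗[k] H →ₗ[k] H →ₗ[k] A ⊗[k] H :=
  TensorProduct.lift (LinearMap.mk₂ k
    (fun x h => lmul H x ∘ₗ D.chi ∘ₗ TensorProduct.mk k H H h)
    (fun _ _ _ => by ext; simp) (fun _ _ _ => by ext; simp)
    (fun _ _ _ => by ext; simp) (fun _ _ _ => by ext; simp))

@[simp] theorem mulChi_tmul (x : A) (h l : H) :
    D.mulChi (x ⊗ₜ h) l = lmul H x (D.chi (h ⊗ₜ l)) := by simp [mulChi]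

/-- The multiplication of `A #_f H`,
`(a ⊗ h)(b ⊗ l) = a b^{h⁽¹⁾} f(h⁽²⁾, l⁽¹⁾) ⊗ h⁽³⁾l⁽²⁾`. -/
def mul : A ⊗[k] H →ₗ[k] A ⊗[k] H →ₗ[k] A ⊗[k] H :=
  TensorProduct.lift (LinearMap.mk₂ k
    (fun a h => TensorProduct.lift (LinearMap.mk₂ k
      (fun b l => lmul H a (D.mulChi (D.twist b h) l))
      (fun _ _ _ => by simp) (fun _ _ _ => by simp)
      (fun _ _ _ => by simp) (fun _ _ _ => by simp)))
    (fun _ _ _ => by ext; simp) (fun _ _ _ => by ext; simp)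
    (fun _ _ _ => by ext; simp) (fun _ _ _ => by ext; simp))

theorem mul_tmul (a b : A) (h l : H) :
    D.mul (a ⊗ₜ h) (b ⊗ₜ l) = lmul H a (D.mulChi (D.twist b h) l) := by simp [mul]

theorem twist_of_one (h : H) : D.twist 1 h = 1 ⊗ₜ h := by
  have : D.act.flip 1 = (Algebra.linearMap k A) ∘ₗ Coalgebra.counit := by
    ext h; simp [D.act_one]
  rw [twist_apply, this]
  have h2 := congrArg (TensorProduct.map (Algebra.linearMap k A) (LinearMap.id (M := H)))
    (Coalgebra.rTensor_counit_comul (R := k) h)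
  rw [LinearMap.rTensor, ← LinearMap.comp_apply, ← TensorProduct.map_comp] at h2
  simpa using h2

theorem twist_one (a : A) : D.twist a 1 = a ⊗ₜ 1 := by
  rw [twist_apply, Bialgebra.comul_one, Algebra.TensorProduct.one_def]
  simp [D.one_act]

theorem twist_mul (a b : A) (h : H) :
    D.twist (a * b) h = TensorProduct.lift
      (LinearMap.mk₂ k (fun x y => lmul H x (D.twist b y)) (fun _ _ _ => by simp)
        (fun _ _ _ => by simp) (fun _ _ _ => by simp) (fun _ _ _ => by simp)) (D.twist a h) := by
  let Ψ : H ⊗[k] (H ⊗[k] H) →ₗ[k] A ⊗[k] H :=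
    (TensorProduct.map (LinearMap.mul' k A ∘ₗ TensorProduct.map (D.act.flip a) (D.act.flip b))
      LinearMap.id) ∘ₗ (TensorProduct.assoc k H H H).symm.toLinearMap
  have h1 : ∀ t : H ⊗[k] H, TensorProduct.map (D.act.flip (a * b)) LinearMap.id t =
      Ψ (TensorProduct.assoc k H H H ((Coalgebra.comul (R := k) (A := H)).rTensor H t)) := by
    intro t
    induction t using TensorProduct.induction_on with
    | zero => simp only [map_zero]
    | tmul x y => simp [Ψ, D.act_mul]
    | add x y hx hy => simp only [map_add, hx, hy]
  have h2 : ∀ t : H ⊗[k] H, TensorProduct.lift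
      (LinearMap.mk₂ k (fun x y => lmul H x (D.twist b y)) (fun _ _ _ => by simp)
        (fun _ _ _ => by simp) (fun _ _ _ => by simp) (fun _ _ _ => by simp))
          (TensorProduct.map (D.act.flip a) LinearMap.id t) =
      Ψ ((Coalgebra.comul (R := k) (A := H)).lTensor H t) := by
    intro t
    induction t using TensorProduct.induction_on with
    | zero => simp only [map_zero]
    | tmul x y =>
      simp only [TensorProduct.map_tmul, TensorProduct.lift.tmul, LinearMap.mk₂_apply,
        LinearMap.lTensor_tmul, LinearMap.id_apply, twist_apply]
      generalize Coalgebra.comul (R := k) y = z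
      induction z using TensorProduct.induction_on with
      | zero => simp
      | tmul z w => simp [Ψ]
      | add z w hz hw => simp only [map_add, TensorProduct.tmul_add, hz, hw]
    | add x y hx hy => simp only [map_add, hx, hy]
  rw [twist_apply, h1, Coalgebra.coassoc_apply, twist_apply, h2]

end WeakActionWithMap

/-- A crossed product `A #_f H`: a weak action and a map `f` such that the multiplication of
`A ⊗ H` is associative with unit `1 ⊗ 1`. -/
structure CrossedProduct extends WeakActionWithMap k A H where
  mul_assoc' : ∀ x y z : A ⊗[k] H, toWeakActionWithMap.mul (toWeakActionWithMap.mul x y) z =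
    toWeakActionWithMap.mul x (toWeakActionWithMap.mul y z)
  one_mul' : ∀ x : A ⊗[k] H, toWeakActionWithMap.mul (1 ⊗ₜ 1) x = x
  mul_one' : ∀ x : A ⊗[k] H, toWeakActionWithMap.mul x (1 ⊗ₜ 1) = x

namespace CrossedProduct
open WeakActionWithMap
variable {k A H} (D : CrossedProduct k A H)

/-- The algebra `E = A #_f H`, with underlying module `A ⊗ H`. -/
def Alg (_ : CrossedProduct k A H) : Type u := A ⊗[k] H

instance : AddCommGroup D.Alg := inferInstanceAs (AddCommGroup (A ⊗[k] H))

instance : Module k D.Alg := inferInstanceAs (Module k (A ⊗[k] H))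

/-- The identity, seen as a map from `A ⊗ H` to `A #_f H`. -/
def toAlg : A ⊗[k] H ≃ₗ[k] D.Alg := (LinearEquiv.refl k D.Alg : D.Alg ≃ₗ[k] D.Alg)

instance : Ring D.Alg :=
  { (inferInstance : AddCommGroup D.Alg) with
    mul := fun x y => D.toAlg (D.mul (D.toAlg.symm x) (D.toAlg.symm y))
    one := D.toAlg (1 ⊗ₜ 1)
    mul_assoc := D.mul_assoc'
    one_mul := D.one_mul'
    mul_one := D.mul_one'
    left_distrib := fun x y z => (D.mul x).map_add y z
    right_distrib := fun x y z => LinearMap.congr_fun (D.mul.map_add x y) z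
    zero_mul := fun x => LinearMap.congr_fun (D.mul.map_zero) x
    mul_zero := fun x => (D.mul x).map_zero }

instance : Algebra k D.Alg :=
  Algebra.ofModule (fun r x y => LinearMap.congr_fun (D.mul.map_smul r x) y)
    (fun r x y => (D.mul x).map_smul r y)

theorem toAlg_mul (x y : A ⊗[k] H) : D.toAlg (D.mul x y) = D.toAlg x * D.toAlg y := rfl

theorem toAlg_one : D.toAlg (1 ⊗ₜ 1) = 1 := rfl

theorem chi_one (h : H) : D.chi (h ⊗ₜ 1) = 1 ⊗ₜ h := by
  have := D.mul_one' (1 ⊗ₜ h)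
  rwa [mul_tmul, twist_of_one, mulChi_tmul, lmul_one, lmul_one] at this

theorem chi_one_left (h : H) : D.chi (1 ⊗ₜ h) = 1 ⊗ₜ h := by
  have := D.one_mul' (1 ⊗ₜ h)
  rwa [mul_tmul, twist_of_one, mulChi_tmul, lmul_one, lmul_one] at this

/-- The inclusion `A → E`, `a ↦ a # 1`. -/
def inA : A →ₐ[k] D.Alg :=
  AlgHom.ofLinearMap (D.toAlg.toLinearMap ∘ₗ (TensorProduct.mk k A H).flip 1) rfl (fun a b => by
    have h : D.mul (a ⊗ₜ 1) (b ⊗ₜ 1) = (a * b) ⊗ₜ 1 := by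
      rw [mul_tmul, twist_one, mulChi_tmul, chi_one, lmul_tmul, lmul_tmul, mul_one]
    exact congrArg D.toAlg h.symm)

/-- The map `H → E`, `h ↦ 1 # h`. -/
def inH : H →ₗ[k] D.Alg := D.toAlg.toLinearMap ∘ₗ TensorProduct.mk k A H 1


/-- `(h, a) ↦ a^{h⁽¹⁾} ⊗ h̄⁽²⁾`, on `H × A`. -/
def twistBarStep : H →ₗ[k] A →ₗ[k] A ⊗[k] Bar k H :=
  LinearMap.mk₂ k (fun h a => TensorProduct.map LinearMap.id (Bar.mk k) (D.twist a h))
    (fun _ _ _ => by simp) (fun _ _ _ => by simp) (fun _ _ _ => by simp) (fun _ _ _ => by simp)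

theorem twistBarStep_one : D.twistBarStep 1 = 0 :=
  LinearMap.ext fun a => by simp [twistBarStep, twist_one]

/-- `(h̄, a) ↦ a^{h⁽¹⁾} ⊗ h̄⁽²⁾`, on `H̄ × A`. -/
def twistBar : Bar k H →ₗ[k] A →ₗ[k] A ⊗[k] Bar k H :=
  Bar.lift (k := k) (B := H) (W := A →ₗ[k] A ⊗[k] Bar k H) D.twistBarStep D.twistBarStep_one

theorem twistBar_mk (h : H) (a : A) :
    D.twistBar (Bar.mk k h) a = TensorProduct.map LinearMap.id (Bar.mk k) (D.twist a h) := rfl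

/-- `(a, h₁ ⊗ ⋯ ⊗ hₛ) ↦ (⋯(a^{hₛ⁽¹⁾})⋯)^{h₁⁽¹⁾} ⊗ (h₁⁽²⁾ ⊗ ⋯ ⊗ hₛ⁽²⁾)`, on `A × H̄ˢ`. -/
def twistPow : (s : ℕ) → A →ₗ[k] BarPow k H s →ₗ[k] A ⊗[k] BarPow k H s
  | 0 => TensorProduct.mk k A (BarPow k H 0)
  | s + 1 =>
    { toFun := fun a =>
        LinearMap.lTensor A (BarPow.cons k H s).toLinearMap ∘ₗ
        (TensorProduct.assoc k A (Bar k H) (BarPow k H s)).toLinearMap ∘ₗ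
        LinearMap.rTensor (BarPow k H s) (TensorProduct.lift D.twistBar) ∘ₗ
        (TensorProduct.assoc k (Bar k H) A (BarPow k H s)).symm.toLinearMap ∘ₗ
        LinearMap.lTensor (Bar k H) (twistPow s a) ∘ₗ
        (BarPow.cons k H s).symm.toLinearMap
      map_add' := fun a b => by
        simp only [map_add, LinearMap.lTensor_add, LinearMap.add_comp, LinearMap.comp_add]
      map_smul' := fun r a => by
        simp only [map_smul, LinearMap.lTensor_smul, LinearMap.smul_comp, LinearMap.comp_smul,
          RingHom.id_apply] }

/-- `(a' ⊗ x, h) ↦ a'' ⊗ h' ⊗ x` where `twistBar h a' = a'' ⊗ h'`. -/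
def twistCons (s : ℕ) : Bar k H →ₗ[k] A ⊗[k] BarPow k H s →ₗ[k] A ⊗[k] BarPow k H (s + 1) where
  toFun h := LinearMap.lTensor A (BarPow.cons k H s).toLinearMap ∘ₗ
    (TensorProduct.assoc k A (Bar k H) (BarPow k H s)).toLinearMap ∘ₗ
      LinearMap.rTensor (BarPow k H s) (D.twistBar h)
  map_add' _ _ := by
    simp only [map_add, LinearMap.rTensor_add, LinearMap.comp_add]
  map_smul' _ _ := by
    simp only [map_smul, LinearMap.rTensor_smul, LinearMap.comp_smul, RingHom.id_apply]

theorem twistCons_tmul (s : ℕ) (h : Bar k H) (c : A) (y : BarPow k H s) :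
    D.twistCons s h (c ⊗ₜ y) = LinearMap.lTensor A ((BarPow.cons k H s).toLinearMap ∘ₗ
      (TensorProduct.mk k (Bar k H) (BarPow k H s)).flip y) (D.twistBar h c) := by
  simp only [twistCons, LinearMap.coe_mk, AddHom.coe_mk, LinearMap.comp_apply,
    LinearMap.rTensor_tmul]
  generalize D.twistBar h c = w
  induction w using TensorProduct.induction_on with
  | zero => simp
  | tmul x y => simp
  | add y z hy hz => simp only [map_add, TensorProduct.add_tmul, hy, hz]

theorem twistPow_zero (a : A) (x : BarPow k H 0) : D.twistPow 0 a x = a ⊗ₜ x := rfl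

theorem twistPow_succ (s : ℕ) (a : A) (h : Bar k H) (x : BarPow k H s) :
    D.twistPow (s + 1) a (BarPow.cons k H s (h ⊗ₜ x)) = D.twistCons s h (D.twistPow s a x) := by
  simp only [twistPow, LinearMap.coe_mk, AddHom.coe_mk, LinearMap.comp_apply,
    LinearEquiv.coe_coe, LinearEquiv.symm_apply_apply, LinearMap.lTensor_tmul]
  generalize D.twistPow s a x = z
  induction z using TensorProduct.induction_on with
  | zero => simp
  | tmul b y => simp [twistCons]
  | add y z hy hz => simp only [TensorProduct.tmul_add, map_add, hy, hz]

theorem twistPow_one (s : ℕ) (x : BarPow k H s) : D.twistPow s 1 x = 1 ⊗ₜ x := by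
  induction s with
  | zero => rfl
  | succ s ih =>
    obtain ⟨x, rfl⟩ := (BarPow.cons k H s).surjective x
    induction x using TensorProduct.induction_on with
    | zero => simp
    | tmul h y =>
      obtain ⟨h, rfl⟩ := Bar.mk_surjective h
      rw [twistPow_succ, ih]
      simp [twistCons, twistBar_mk, twist_of_one]
    | add y z hy hz => simp only [TensorProduct.tmul_add, map_add, hy, hz]

/-- `a' ⊗ x ↦ a' · twistPow a x`: right multiplication by `a` on `A ⊗ H̄ˢ`. -/
def twistMul (s : ℕ) (a : A) : A ⊗[k] BarPow k H s →ₗ[k] A ⊗[k] BarPow k H s :=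
  TensorProduct.lift ((LinearMap.lcomp k _ (D.twistPow s a)) ∘ₗ lmul (BarPow k H s))

@[simp] theorem twistMul_tmul (s : ℕ) (a b : A) (x : BarPow k H s) :
    D.twistMul s a (b ⊗ₜ x) = lmul _ b (D.twistPow s a x) := rfl

theorem twistBar_mul (h : Bar k H) (a b : A) :
    D.twistBar h (a * b) = TensorProduct.lift
      ((D.twistBar.flip b).lcomp k _ ∘ₗ lmul (Bar k H)) (D.twistBar h a) := by
  obtain ⟨h, rfl⟩ := Bar.mk_surjective h
  rw [twistBar_mk, twist_mul, twistBar_mk]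
  generalize D.twist a h = z
  induction z using TensorProduct.induction_on with
  | zero => simp
  | tmul c l =>
    simp only [TensorProduct.lift.tmul, LinearMap.mk₂_apply, TensorProduct.map_tmul,
      LinearMap.id_apply, LinearMap.comp_apply, LinearMap.lcomp_apply, LinearMap.flip_apply,
      twistBar_mk]
    generalize D.twist b l = w
    induction w using TensorProduct.induction_on with
    | zero => simp
    | tmul x y => simp
    | add y z hy hz => simp only [map_add, hy, hz]
  | add y z hy hz => simp only [map_add, hy, hz]

/-- `(c ⊗ h, v) ↦ c · twistCons h v`. -/
def twistLift (s : ℕ) : A ⊗[k] Bar k H →ₗ[k] A ⊗[k] BarPow k H s →ₗ[k]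
    A ⊗[k] BarPow k H (s + 1) :=
  TensorProduct.lift (LinearMap.mk₂ k (fun c h => lmul (BarPow k H (s + 1)) c ∘ₗ D.twistCons s h)
    (fun _ _ _ => by simp [LinearMap.add_comp]) (fun _ _ _ => by simp [LinearMap.smul_comp])
    (fun _ _ _ => by simp [LinearMap.comp_add]) (fun _ _ _ => by simp [LinearMap.comp_smul]))

@[simp] theorem twistLift_tmul (s : ℕ) (c : A) (h : Bar k H) (v : A ⊗[k] BarPow k H s) :
    D.twistLift s (c ⊗ₜ h) v = lmul (BarPow k H (s + 1)) c (D.twistCons s h v) := by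
  simp [twistLift]

theorem twistCons_lmul (s : ℕ) (h : Bar k H) (c : A) (v : A ⊗[k] BarPow k H s) :
    D.twistCons s h (lmul _ c v) = D.twistLift s (D.twistBar h c) v := by
  induction v using TensorProduct.induction_on with
  | zero => simp only [map_zero]
  | add v w hv hw => simp only [map_add, hv, hw]
  | tmul d v =>
    rw [lmul_tmul, twistCons_tmul, twistBar_mul]
    generalize D.twistBar h c = w
    induction w using TensorProduct.induction_on with
    | zero => simp only [map_zero, LinearMap.zero_apply]
    | add y z hy hz => simp only [map_add, LinearMap.add_apply, hy, hz]
    | tmul x z =>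
      rw [twistLift_tmul, twistCons_tmul]
      simp only [TensorProduct.lift.tmul, LinearMap.comp_apply, LinearMap.lcomp_apply,
        LinearMap.flip_apply]
      generalize D.twistBar z d = w
      induction w using TensorProduct.induction_on with
      | zero => simp only [map_zero]
      | tmul x z => simp
      | add y z hy hz => simp only [map_add, hy, hz]

theorem twistPow_mul (s : ℕ) (a b : A) (x : BarPow k H s) :
    D.twistPow s (a * b) x = D.twistMul s b (D.twistPow s a x) := by
  induction s with
  | zero => rfl
  | succ s ih =>
    obtain ⟨x, rfl⟩ := (BarPow.cons k H s).surjective x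
    induction x using TensorProduct.induction_on with
    | zero => simp only [map_zero]
    | add y z hy hz => simp only [map_add, hy, hz]
    | tmul h y =>
      rw [twistPow_succ, twistPow_succ, ih]
      generalize D.twistPow s a y = z
      induction z using TensorProduct.induction_on with
      | zero => simp only [map_zero]
      | add y z hy hz => simp only [map_add, hy, hz]
      | tmul c y =>
        rw [twistMul_tmul, twistCons_lmul, twistCons_tmul]
        generalize D.twistBar h c = w
        induction w using TensorProduct.induction_on with
        | zero => simp only [map_zero, LinearMap.zero_apply]
        | tmul x z => simp [twistPow_succ]
        | add y z hy hz => simp only [map_add, LinearMap.add_apply, hy, hz]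

section Twisted
variable (M : Type u) [AddCommGroup M] [Module k M] [Module D.Alg M] [Module D.Algᵐᵒᵖ M]
  [IsScalarTower k D.Alg M] [IsScalarTower k D.Algᵐᵒᵖ M] [SMulCommClass D.Alg D.Algᵐᵒᵖ M]

/-- `A × M → M`, `(a, m) ↦ (a # 1) m`. -/
def actL : A →ₗ[k] M →ₗ[k] M where
  toFun a :=
    { toFun := fun m => D.inA a • m
      map_add' := fun m m' => smul_add _ m m'
      map_smul' := fun r m => smul_comm _ r m }
  map_add' a b := LinearMap.ext fun m => by simp [add_smul]
  map_smul' r a := LinearMap.ext fun m => by simp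

@[simp] theorem actL_apply (a : A) (m : M) : D.actL M a m = D.inA a • m := rfl

/-- `A × M → M`, `(a, m) ↦ m (a # 1)`. -/
def actR : A →ₗ[k] M →ₗ[k] M where
  toFun a :=
    { toFun := fun m => MulOpposite.op (D.inA a) • m
      map_add' := fun m m' => smul_add _ m m'
      map_smul' := fun r m => smul_comm _ r m }
  map_add' a b := LinearMap.ext fun m => by simp [add_smul]
  map_smul' r a := LinearMap.ext fun m => by simp

@[simp] theorem actR_apply (a : A) (m : M) : D.actR M a m = MulOpposite.op (D.inA a) • m := rfl

/-- The `k`-module `M ⊗ H̄ˢ`, with the `A`-bimodule structure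
`a₁ (m ⊗ h) a₂ = a₁ m a₂^{h⁽¹⁾} ⊗ h⁽²⁾`, where `a^h = (⋯(a^{hₛ})⋯)^{h₁}`. -/
def TwTensor (_ : CrossedProduct k A H) (M : Type u) [AddCommGroup M] [Module k M] (s : ℕ) :
    Type u := M ⊗[k] BarPow k H s

section
variable {M}

instance (s : ℕ) : AddCommGroup (D.TwTensor M s) :=
  inferInstanceAs (AddCommGroup (M ⊗[k] BarPow k H s))

instance (s : ℕ) : Module k (D.TwTensor M s) := inferInstanceAs (Module k (M ⊗[k] BarPow k H s))

/-- The identity, seen as a map from `M ⊗ H̄ˢ` to the `A`-bimodule `M ⊗ H̄ˢ`. -/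
def toTwTensor (s : ℕ) : M ⊗[k] BarPow k H s ≃ₗ[k] D.TwTensor M s :=
  (LinearEquiv.refl k (D.TwTensor M s) : D.TwTensor M s ≃ₗ[k] D.TwTensor M s)

end

/-- `(m, a ⊗ x) ↦ m (a # 1) ⊗ x`. -/
def rightMul (X : Type u) [AddCommMonoid X] [Module k X] : M →ₗ[k] A ⊗[k] X →ₗ[k] M ⊗[k] X :=
  LinearMap.rTensorHom X ∘ₗ (D.actR M).flip

@[simp] theorem rightMul_tmul (X : Type u) [AddCommMonoid X] [Module k X] (m : M) (a : A) (x : X) :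
    D.rightMul M X m (a ⊗ₜ x) = (MulOpposite.op (D.inA a) • m) ⊗ₜ x := rfl

/-- Left multiplication by `a` on `M ⊗ H̄ˢ`: `m ⊗ h ↦ a m ⊗ h`. -/
def twL (s : ℕ) : A →ₗ[k] M ⊗[k] BarPow k H s →ₗ[k] M ⊗[k] BarPow k H s :=
  LinearMap.rTensorHom (BarPow k H s) ∘ₗ D.actL M

/-- Right multiplication by `a` on `M ⊗ H̄ˢ`: `m ⊗ h ↦ m a^{h⁽¹⁾} ⊗ h⁽²⁾`. -/
def twR (s : ℕ) : A →ₗ[k] M ⊗[k] BarPow k H s →ₗ[k] M ⊗[k] BarPow k H s where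
  toFun a := TensorProduct.lift ((D.rightMul M (BarPow k H s)).compl₂ (D.twistPow s a))
  map_add' a b := TensorProduct.ext' fun m x => by simp
  map_smul' r a := TensorProduct.ext' fun m x => by simp

@[simp] theorem twL_tmul (s : ℕ) (a : A) (m : M) (x : BarPow k H s) :
    D.twL M s a (m ⊗ₜ x) = (D.inA a • m) ⊗ₜ x := rfl

@[simp] theorem twR_tmul (s : ℕ) (a : A) (m : M) (x : BarPow k H s) :
    D.twR M s a (m ⊗ₜ x) = D.rightMul M _ m (D.twistPow s a x) := by simp [twR]

theorem twR_rightMul (s : ℕ) (a : A) (m : M) (z : A ⊗[k] BarPow k H s) :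
    D.twR M s a (D.rightMul M _ m z) = D.rightMul M _ m (D.twistMul s a z) := by
  induction z using TensorProduct.induction_on with
  | zero => simp only [map_zero]
  | add y z hy hz => simp only [map_add, hy, hz]
  | tmul b x =>
    rw [rightMul_tmul, twR_tmul, twistMul_tmul]
    generalize D.twistPow s a x = z
    induction z using TensorProduct.induction_on with
    | zero => simp only [map_zero]
    | add y z hy hz => simp only [map_add, hy, hz]
    | tmul c y => simp [mul_smul]

theorem twR_mul (s : ℕ) (a b : A) (x : M ⊗[k] BarPow k H s) :
    D.twR M s (a * b) x = D.twR M s b (D.twR M s a x) := by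
  induction x using TensorProduct.induction_on with
  | zero => simp only [map_zero]
  | add y z hy hz => simp only [map_add, hy, hz]
  | tmul m x => rw [twR_tmul, twistPow_mul, twR_tmul, twR_rightMul]

theorem twR_one (s : ℕ) (x : M ⊗[k] BarPow k H s) : D.twR M s 1 x = x := by
  induction x using TensorProduct.induction_on with
  | zero => simp only [map_zero]
  | add y z hy hz => simp only [map_add, hy, hz]
  | tmul m x => simp [twistPow_one]

theorem twL_mul (s : ℕ) (a b : A) (x : M ⊗[k] BarPow k H s) :
    D.twL M s (a * b) x = D.twL M s a (D.twL M s b x) := by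
  induction x using TensorProduct.induction_on with
  | zero => simp only [map_zero]
  | add y z hy hz => simp only [map_add, hy, hz]
  | tmul m x => simp [mul_smul]

theorem twL_one (s : ℕ) (x : M ⊗[k] BarPow k H s) : D.twL M s 1 x = x := by
  induction x using TensorProduct.induction_on with
  | zero => simp only [map_zero]
  | add y z hy hz => simp only [map_add, hy, hz]
  | tmul m x => simp

theorem twL_twR (s : ℕ) (a b : A) (x : M ⊗[k] BarPow k H s) :
    D.twL M s a (D.twR M s b x) = D.twR M s b (D.twL M s a x) := by
  induction x using TensorProduct.induction_on with
  | zero => simp only [map_zero]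
  | add y z hy hz => simp only [map_add, hy, hz]
  | tmul m x =>
    rw [twR_tmul, twL_tmul, twR_tmul]
    generalize D.twistPow s b x = z
    induction z using TensorProduct.induction_on with
    | zero => simp only [map_zero]
    | add y z hy hz => simp only [map_add, hy, hz]
    | tmul c y => simp [smul_comm]

instance (s : ℕ) : Module A (D.TwTensor M s) where
  smul a x := D.toTwTensor s (D.twL M s a ((D.toTwTensor s).symm x))
  one_smul x := D.twL_one M s x
  mul_smul a b x := D.twL_mul M s a b x
  smul_zero a := (D.twL M s a).map_zero
  smul_add a := (D.twL M s a).map_add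
  add_smul a b x := LinearMap.congr_fun ((D.twL M s).map_add a b) x
  zero_smul x := LinearMap.congr_fun ((D.twL M s).map_zero) x

instance (s : ℕ) : Module Aᵐᵒᵖ (D.TwTensor M s) where
  smul a x := D.toTwTensor s (D.twR M s a.unop ((D.toTwTensor s).symm x))
  one_smul x := D.twR_one M s x
  mul_smul a b x := D.twR_mul M s b.unop a.unop x
  smul_zero a := (D.twR M s a.unop).map_zero
  smul_add a := (D.twR M s a.unop).map_add
  add_smul a b x := LinearMap.congr_fun ((D.twR M s).map_add a.unop b.unop) x
  zero_smul x := LinearMap.congr_fun ((D.twR M s).map_zero) x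

instance (s : ℕ) : IsScalarTower k A (D.TwTensor M s) :=
  ⟨fun r a x => LinearMap.congr_fun ((D.twL M s).map_smul r a) x⟩

instance (s : ℕ) : IsScalarTower k Aᵐᵒᵖ (D.TwTensor M s) :=
  ⟨fun r a x => LinearMap.congr_fun ((D.twR M s).map_smul r a.unop) x⟩

instance (s : ℕ) : SMulCommClass A Aᵐᵒᵖ (D.TwTensor M s) :=
  ⟨fun a b x => D.twL_twR M s a b.unop x⟩

theorem TwTensor.smul_tmul (s : ℕ) (a : A) (m : M) (x : BarPow k H s) :
    a • D.toTwTensor s (m ⊗ₜ x) = D.toTwTensor s ((D.inA a • m) ⊗ₜ x) := rfl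

theorem TwTensor.op_smul_tmul (s : ℕ) (a : A) (m : M) (x : BarPow k H s) :
    MulOpposite.op a • D.toTwTensor s (m ⊗ₜ x) =
      D.toTwTensor s (D.rightMul M _ m (D.twistPow s a x)) := rfl

/-- The `k`-module `Hom_k(H̄ˢ, M)`, with the `A`-bimodule structure
`(a₁ φ a₂)(h) = a₁^{h⁽¹⁾} φ(h⁽²⁾) a₂`. -/
def TwHom (_ : CrossedProduct k A H) (M : Type u) [AddCommGroup M] [Module k M] (s : ℕ) :
    Type u := BarPow k H s →ₗ[k] M

section
variable {M}

instance (s : ℕ) : AddCommGroup (D.TwHom M s) :=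
  inferInstanceAs (AddCommGroup (BarPow k H s →ₗ[k] M))

instance (s : ℕ) : Module k (D.TwHom M s) := inferInstanceAs (Module k (BarPow k H s →ₗ[k] M))

/-- The identity, seen as a map from `Hom_k(H̄ˢ, M)` to the `A`-bimodule `Hom_k(H̄ˢ, M)`. -/
def toTwHom (s : ℕ) : (BarPow k H s →ₗ[k] M) ≃ₗ[k] D.TwHom M s :=
  (LinearEquiv.refl k (D.TwHom M s) : D.TwHom M s ≃ₗ[k] D.TwHom M s)

end

/-- `(φ, a ⊗ x) ↦ (a # 1) φ(x)`. -/
def leftEval (X : Type u) [AddCommMonoid X] [Module k X] :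
    (X →ₗ[k] M) →ₗ[k] A ⊗[k] X →ₗ[k] M where
  toFun φ := TensorProduct.lift ((D.actL M).compl₂ φ)
  map_add' φ ψ := TensorProduct.ext' fun a x => by simp
  map_smul' r φ := TensorProduct.ext' fun a x => by simp

@[simp] theorem leftEval_tmul (X : Type u) [AddCommMonoid X] [Module k X] (φ : X →ₗ[k] M) (a : A)
    (x : X) : D.leftEval M X φ (a ⊗ₜ x) = D.inA a • φ x := by simp [leftEval]

/-- Left multiplication by `a` on `Hom_k(H̄ˢ, M)`: `(a φ)(h) = a^{h⁽¹⁾} φ(h⁽²⁾)`. -/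
def homL (s : ℕ) : A →ₗ[k] (BarPow k H s →ₗ[k] M) →ₗ[k] (BarPow k H s →ₗ[k] M) :=
  LinearMap.mk₂ k (fun a φ => D.leftEval M _ φ ∘ₗ D.twistPow s a)
    (fun _ _ _ => by simp [LinearMap.comp_add]) (fun _ _ _ => by simp [LinearMap.comp_smul])
    (fun _ _ _ => by simp [LinearMap.add_comp]) (fun _ _ _ => by simp [LinearMap.smul_comp])

/-- Right multiplication by `a` on `Hom_k(H̄ˢ, M)`: `(φ a)(h) = φ(h) a`. -/
def homR (s : ℕ) : A →ₗ[k] (BarPow k H s →ₗ[k] M) →ₗ[k] (BarPow k H s →ₗ[k] M) :=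
  LinearMap.mk₂ k (fun a φ => D.actR M a ∘ₗ φ)
    (fun _ _ _ => by simp [LinearMap.add_comp]) (fun _ _ _ => by simp [LinearMap.smul_comp])
    (fun _ _ _ => by simp [LinearMap.comp_add]) (fun _ _ _ => by simp [LinearMap.comp_smul])

theorem homL_apply (s : ℕ) (a : A) (φ : BarPow k H s →ₗ[k] M) (x : BarPow k H s) :
    D.homL M s a φ x = D.leftEval M _ φ (D.twistPow s a x) := rfl

theorem homR_apply (s : ℕ) (a : A) (φ : BarPow k H s →ₗ[k] M) (x : BarPow k H s) :
    D.homR M s a φ x = MulOpposite.op (D.inA a) • φ x := rfl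

theorem leftEval_twistMul (s : ℕ) (b : A) (φ : BarPow k H s →ₗ[k] M) (z : A ⊗[k] BarPow k H s) :
    D.leftEval M _ φ (D.twistMul s b z) = D.leftEval M _ (D.homL M s b φ) z := by
  induction z using TensorProduct.induction_on with
  | zero => simp only [map_zero]
  | add y z hy hz => simp only [map_add, hy, hz]
  | tmul c x =>
    rw [leftEval_tmul, homL_apply, twistMul_tmul]
    generalize D.twistPow s b x = z
    induction z using TensorProduct.induction_on with
    | zero => simp only [map_zero, smul_zero]
    | add y z hy hz => simp only [map_add, smul_add, hy, hz]
    | tmul c y => simp [mul_smul]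

theorem homL_mul (s : ℕ) (a b : A) (φ : BarPow k H s →ₗ[k] M) :
    D.homL M s (a * b) φ = D.homL M s a (D.homL M s b φ) :=
  LinearMap.ext fun x => by
    rw [homL_apply, twistPow_mul, leftEval_twistMul, homL_apply]

theorem homL_one (s : ℕ) (φ : BarPow k H s →ₗ[k] M) : D.homL M s 1 φ = φ :=
  LinearMap.ext fun x => by rw [homL_apply, twistPow_one, leftEval_tmul, map_one, one_smul]

theorem homR_mul (s : ℕ) (a b : A) (φ : BarPow k H s →ₗ[k] M) :
    D.homR M s (a * b) φ = D.homR M s b (D.homR M s a φ) :=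
  LinearMap.ext fun x => by simp [homR_apply, mul_smul]

theorem homR_one (s : ℕ) (φ : BarPow k H s →ₗ[k] M) : D.homR M s 1 φ = φ :=
  LinearMap.ext fun x => by simp [homR_apply]

theorem homL_homR (s : ℕ) (a b : A) (φ : BarPow k H s →ₗ[k] M) :
    D.homL M s a (D.homR M s b φ) = D.homR M s b (D.homL M s a φ) :=
  LinearMap.ext fun x => by
    rw [homL_apply, homR_apply, homL_apply]
    generalize D.twistPow s a x = z
    induction z using TensorProduct.induction_on with
    | zero => simp only [map_zero, smul_zero]
    | add y z hy hz => simp only [map_add, smul_add, hy, hz]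
    | tmul c y => simp [homR_apply, smul_comm]

instance (s : ℕ) : Module A (D.TwHom M s) where
  smul a x := D.toTwHom s (D.homL M s a ((D.toTwHom s).symm x))
  one_smul x := D.homL_one M s x
  mul_smul a b x := D.homL_mul M s a b x
  smul_zero a := (D.homL M s a).map_zero
  smul_add a := (D.homL M s a).map_add
  add_smul a b x := LinearMap.congr_fun ((D.homL M s).map_add a b) x
  zero_smul x := LinearMap.congr_fun ((D.homL M s).map_zero) x

instance (s : ℕ) : Module Aᵐᵒᵖ (D.TwHom M s) where
  smul a x := D.toTwHom s (D.homR M s a.unop ((D.toTwHom s).symm x))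
  one_smul x := D.homR_one M s x
  mul_smul a b x := D.homR_mul M s b.unop a.unop x
  smul_zero a := (D.homR M s a.unop).map_zero
  smul_add a := (D.homR M s a.unop).map_add
  add_smul a b x := LinearMap.congr_fun ((D.homR M s).map_add a.unop b.unop) x
  zero_smul x := LinearMap.congr_fun ((D.homR M s).map_zero) x

instance (s : ℕ) : IsScalarTower k A (D.TwHom M s) :=
  ⟨fun r a x => LinearMap.congr_fun ((D.homL M s).map_smul r a) x⟩

instance (s : ℕ) : IsScalarTower k Aᵐᵒᵖ (D.TwHom M s) :=
  ⟨fun r a x => LinearMap.congr_fun ((D.homR M s).map_smul r a.unop) x⟩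

instance (s : ℕ) : SMulCommClass A Aᵐᵒᵖ (D.TwHom M s) :=
  ⟨fun a b x => D.homL_homR M s a b.unop x⟩

theorem TwHom.smul_apply (s : ℕ) (a : A) (φ : BarPow k H s →ₗ[k] M) :
    a • D.toTwHom s φ = D.toTwHom s (D.leftEval M _ φ ∘ₗ D.twistPow s a) := rfl

theorem TwHom.op_smul_apply (s : ℕ) (a : A) (φ : BarPow k H s →ₗ[k] M) :
    MulOpposite.op a • D.toTwHom s φ = D.toTwHom s (D.actR M a ∘ₗ φ) := rfl

end Twisted

section Resolution

/-- `(a ⊗ w, h) ↦ a^{h⁽¹⁾} ⊗ h̄⁽²⁾ ⊗ w`. -/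
def hopfPush (W : Type u) [AddCommMonoid W] [Module k W] :
    H →ₗ[k] A ⊗[k] W →ₗ[k] A ⊗[k] (Bar k H ⊗[k] W) where
  toFun h := (TensorProduct.assoc k A (Bar k H) W).toLinearMap ∘ₗ
    LinearMap.rTensor W (D.twistBarStep h)
  map_add' _ _ := by simp only [map_add, LinearMap.rTensor_add, LinearMap.comp_add]
  map_smul' _ _ := by
    simp only [map_smul, LinearMap.rTensor_smul, LinearMap.comp_smul, RingHom.id_apply]

theorem hopfPush_one (W : Type u) [AddCommMonoid W] [Module k W] : D.hopfPush W 1 = 0 := by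
  refine TensorProduct.ext' fun a w => ?_
  simp [hopfPush, twistBarStep_one]

theorem hopfPush_one_tmul (W : Type u) [AddCommMonoid W] [Module k W] (h : H) (w : W) :
    D.hopfPush W h (1 ⊗ₜ w) = 1 ⊗ₜ (Bar.mk k h ⊗ₜ w) := by
  simp [hopfPush, twistBarStep, twist_of_one]

/-- `(h₁, h₀, w) ↦ f(h₀⁽¹⁾, h₁⁽¹⁾) ⊗ h₀⁽²⁾h₁⁽²⁾ ⊗ w`. -/
def hopfJoin (W : Type u) [AddCommMonoid W] [Module k W] :
    H →ₗ[k] H →ₗ[k] W →ₗ[k] A ⊗[k] (Bar k H ⊗[k] W) :=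
  LinearMap.mk₂ k (fun h₁ h₀ => (TensorProduct.assoc k A (Bar k H) W).toLinearMap ∘ₗ
      TensorProduct.mk k (A ⊗[k] Bar k H) W (LinearMap.lTensor A (Bar.mk k) (D.chi (h₀ ⊗ₜ h₁))))
    (fun _ _ _ => by simp only [TensorProduct.tmul_add, map_add, LinearMap.comp_add])
    (fun _ _ _ => by simp only [TensorProduct.tmul_smul, map_smul, LinearMap.comp_smul])
    (fun _ _ _ => by simp only [TensorProduct.add_tmul, map_add, LinearMap.comp_add])
    (fun _ _ _ => by simp only [← TensorProduct.smul_tmul', map_smul, LinearMap.comp_smul])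

theorem hopfJoin_one_left (W : Type u) [AddCommMonoid W] [Module k W] (h : H) (w : W) :
    D.hopfJoin W 1 h w = 1 ⊗ₜ (Bar.mk k h ⊗ₜ w) := by
  simp [hopfJoin, chi_one]

theorem hopfJoin_one_right (W : Type u) [AddCommMonoid W] [Module k W] (h : H) (w : W) :
    D.hopfJoin W h 1 w = 1 ⊗ₜ (Bar.mk k h ⊗ₜ w) := by
  simp [hopfJoin, chi_one_left]

/-- One step of the recursion for `hopfMerge`. -/
def hopfMergeStep {n : ℕ} (K : H →ₗ[k] BarMod k H n →ₗ[k] A ⊗[k] BarMod k H n) :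
    H →ₗ[k] H →ₗ[k] BarMod k H n →ₗ[k] A ⊗[k] (Bar k H ⊗[k] BarMod k H n) :=
  LinearMap.mk₂ k (fun h₁ h₀ => D.hopfJoin (BarMod k H n) h₁ h₀ -
      D.hopfPush (BarMod k H n) h₀ ∘ₗ K h₁)
    (fun _ _ _ => by simp only [map_add, LinearMap.comp_add, LinearMap.add_apply]; abel)
    (fun _ _ _ => LinearMap.ext fun w => by simp [smul_sub])
    (fun _ _ _ => by simp only [map_add, LinearMap.add_comp]; abel)
    (fun _ _ _ => LinearMap.ext fun w => by simp [smul_sub])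

theorem hopfMergeStep_apply {n : ℕ} (K : H →ₗ[k] BarMod k H n →ₗ[k] A ⊗[k] BarMod k H n)
    (h₁ h₀ : H) (w : BarMod k H n) : D.hopfMergeStep K h₁ h₀ w =
      D.hopfJoin (BarMod k H n) h₁ h₀ w - D.hopfPush (BarMod k H n) h₀ (K h₁ w) := rfl

/-- The map underlying `hopfMerge`, with the fact that makes the recursion well defined. -/
def hopfMergeAux : (n : ℕ) → { K : H →ₗ[k] BarMod k H n →ₗ[k] A ⊗[k] BarMod k H n //
      K 1 = TensorProduct.mk k A (BarMod k H n) 1 }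
  | 0 => ⟨{ toFun := fun h => (TensorProduct.leftComm k (BarPow k H 0) A H).toLinearMap ∘ₗ
              LinearMap.lTensor (BarPow k H 0) (D.chi ∘ₗ TensorProduct.mk k H H h)
            map_add' := fun _ _ => by
              simp only [map_add, LinearMap.comp_add, LinearMap.lTensor_add]
            map_smul' := fun _ _ => by
              simp only [map_smul, LinearMap.comp_smul, LinearMap.lTensor_smul,
                RingHom.id_apply] }, by
      refine TensorProduct.ext' fun x y => ?_
      simp [chi_one_left]⟩
  | n + 1 =>
    ⟨{  toFun := fun h₀ => LinearMap.lTensor A (BarMod.cons k H n).toLinearMap ∘ₗ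
          (Bar.lift₃ (X := A ⊗[k] (Bar k H ⊗[k] BarMod k H n))
            (D.hopfMergeStep (hopfMergeAux n).1) (by
              refine LinearMap.ext fun h => LinearMap.ext fun w => ?_
              rw [hopfMergeStep_apply, (hopfMergeAux n).2, TensorProduct.mk_apply,
                hopfPush_one_tmul, hopfJoin_one_left, sub_self]
              rfl) h₀) ∘ₗ
          ((BarMod.cons k H n).symm.toLinearMap :
            BarMod k H (n + 1) →ₗ[k] Bar k H ⊗[k] BarMod k H n)
        map_add' := fun b b' => by simp only [map_add, LinearMap.add_comp, LinearMap.comp_add]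
        map_smul' := fun r b => by
          simp only [map_smul, LinearMap.smul_comp, LinearMap.comp_smul, RingHom.id_apply] }, by
      refine LinearMap.ext fun x => ?_
      induction x using BarMod.induction with
      | zero => simp only [map_zero]
      | cons b w =>
        simp [hopfMergeStep_apply, hopfJoin_one_right, hopfPush_one]
      | add x y hx hy => simp only [map_add, hx, hy]⟩

/-- For `h₀ ∈ H`, the map `H̄ⁿ ⊗ H → A ⊗ (H̄ⁿ ⊗ H)`, `h₁ ⊗ ⋯ ⊗ hₙ₊₁ ↦
∑_{0 ≤ i ≤ n} (-1)ⁱ f(hᵢ⁽¹⁾, hᵢ₊₁⁽¹⁾)^{h₀⁽¹⁾, …, hᵢ₋₁⁽¹⁾} ⊗ h₀⁽²⁾ ⊗ ⋯ ⊗ hᵢ₋₁⁽²⁾ ⊗ hᵢ⁽²⁾hᵢ₊₁⁽²⁾ ⊗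
hᵢ₊₂ ⊗ ⋯ ⊗ hₙ₊₁`, where `a^{h₀, …, hⱼ} = (⋯(a^{hⱼ})⋯)^{h₀}`; it is defined by the evident recursion
(the single summands do not descend to `H̄`, their sum does). -/
def hopfMerge (n : ℕ) : H →ₗ[k] BarMod k H n →ₗ[k] A ⊗[k] BarMod k H n := (D.hopfMergeAux n).1

theorem hopfMerge_one (n : ℕ) (w : BarMod k H n) : D.hopfMerge n 1 w = 1 ⊗ₜ w := by
  simp [hopfMerge, (D.hopfMergeAux n).2]

theorem hopfMerge_zero (h l : H) (x : BarPow k H 0) : D.hopfMerge 0 h (x ⊗ₜ l) =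
    LinearMap.lTensor A (TensorProduct.mk k (BarPow k H 0) H x) (D.chi (h ⊗ₜ l)) := by
  simp only [hopfMerge, hopfMergeAux, LinearMap.coe_mk, AddHom.coe_mk, LinearMap.comp_apply,
    LinearMap.lTensor_tmul, TensorProduct.mk_apply]
  generalize D.chi (h ⊗ₜ l) = z
  induction z using TensorProduct.induction_on with
  | zero => simp
  | tmul a l => simp
  | add y z hy hz => simp only [TensorProduct.tmul_add, map_add, hy, hz]

theorem hopfMerge_succ (n : ℕ) (h₀ h₁ : H) (w : BarMod k H n) :
    D.hopfMerge (n + 1) h₀ (BarMod.cons k H n (Bar.mk k h₁ ⊗ₜ w)) =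
      LinearMap.lTensor A (BarMod.cons k H n).toLinearMap (D.hopfJoin (BarMod k H n) h₁ h₀ w -
        D.hopfPush (BarMod k H n) h₀ (D.hopfMerge n h₁ w)) := by
  rw [hopfMerge, hopfMergeAux]
  simp only [LinearMap.coe_mk, AddHom.coe_mk, LinearMap.comp_apply, hopfMerge,
    LinearEquiv.coe_coe, LinearEquiv.symm_apply_apply, Bar.lift₃_tmul, hopfMergeStep_apply]

variable (k A H) in
/-- `H̄ˢ ⊗ Āʳ`. The free bimodule on it is `X_{rs} = E ⊗ H̄ˢ ⊗ Āʳ ⊗ E`. -/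
abbrev Gen (r s : ℕ) : Type u := BarPow k H s ⊗[k] BarPow k A r

/-- The map `(a, h, t) ↦ a^{h⁽¹⁾} ⊗ h⁽²⁾ ⊗ t ⊗ 1 - 1 ⊗ h ⊗ (a ⋆ (t ⊗ 1))`, where `a ⋆ -` is
`barMerge a`. -/
def d0Step (r s : ℕ) :
    A →ₗ[k] BarPow k H s →ₗ[k] BarPow k A r →ₗ[k] Bim k D.Alg (Gen k A H r s) where
  toFun a := LinearMap.mk₂ k (fun h t =>
      TensorProduct.map D.inA.toLinearMap ((TensorProduct.mk k (Gen k A H r s) D.Alg).flip 1 ∘ₗ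
        (TensorProduct.mk k (BarPow k H s) (BarPow k A r)).flip t) (D.twistPow s a h) -
      1 ⊗ₜ TensorProduct.map (TensorProduct.mk k (BarPow k H s) (BarPow k A r) h)
        D.inA.toLinearMap (barMerge k A r a (BarMod.inl r t)))
    (fun _ _ _ => by
      simp only [map_add, TensorProduct.map_add_left, LinearMap.add_apply, TensorProduct.tmul_add]
      abel)
    (fun _ _ _ => by
      simp only [map_smul, TensorProduct.map_smul_left, LinearMap.smul_apply,
        TensorProduct.tmul_smul, smul_sub])
    (fun _ _ _ => by
      simp only [map_add, LinearMap.comp_add, TensorProduct.map_add_right, LinearMap.add_apply,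
        TensorProduct.tmul_add]
      abel)
    (fun _ _ _ => by
      simp only [map_smul, LinearMap.comp_smul, TensorProduct.map_smul_right,
        LinearMap.smul_apply, TensorProduct.tmul_smul, smul_sub])
  map_add' _ _ := LinearMap.ext₂ fun h t => by
    simp only [LinearMap.mk₂_apply, map_add, LinearMap.add_apply, TensorProduct.tmul_add]
    abel
  map_smul' _ _ := LinearMap.ext₂ fun h t => by
    simp only [LinearMap.mk₂_apply, map_smul, LinearMap.smul_apply, TensorProduct.tmul_smul,
      smul_sub, RingHom.id_apply]

theorem d0Step_apply (r s : ℕ) (a : A) (h : BarPow k H s) (t : BarPow k A r) :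
    D.d0Step r s a h t =
      TensorProduct.map D.inA.toLinearMap ((TensorProduct.mk k (Gen k A H r s) D.Alg).flip 1 ∘ₗ
        (TensorProduct.mk k (BarPow k H s) (BarPow k A r)).flip t) (D.twistPow s a h) -
      1 ⊗ₜ TensorProduct.map (TensorProduct.mk k (BarPow k H s) (BarPow k A r) h)
        D.inA.toLinearMap (barMerge k A r a (BarMod.inl r t)) := rfl

theorem d0Step_one (r s : ℕ) : D.d0Step r s 1 = 0 :=
  LinearMap.ext₂ fun h t => by
    rw [d0Step_apply, twistPow_one, barMerge_one]
    simp [BarMod.inl]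

/-- `d⁰_{r+1,s} : X_{r+1,s} → X_{rs}`, on generators:
`h ⊗ a₁ ⊗ ⋯ ⊗ aᵣ₊₁ ↦ a₁^{h⁽¹⁾} ⊗ h⁽²⁾ ⊗ (a₂ ⊗ ⋯ ⊗ aᵣ₊₁) ⊗ 1
+ ∑ᵢ (-1)ⁱ 1 ⊗ h ⊗ (a₁ ⊗ ⋯ ⊗ aᵢaᵢ₊₁ ⊗ ⋯ ⊗ aᵣ₊₁) ⊗ 1 + (-1)ʳ⁺¹ 1 ⊗ h ⊗ (a₁ ⊗ ⋯ ⊗ aᵣ) ⊗ aᵣ₊₁`. -/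
def d0Gen (r s : ℕ) : Gen k A H (r + 1) s →ₗ[k] Bim k D.Alg (Gen k A H r s) :=
  TensorProduct.lift (Bar.lift₃ (X := Bim k D.Alg (Gen k A H r s)) (D.d0Step r s)
    (D.d0Step_one r s)) ∘ₗ LinearMap.lTensor (BarPow k H s) (BarPow.cons k A r).symm.toLinearMap

theorem d0Gen_tmul (r s : ℕ) (h : BarPow k H s) (a : A) (t : BarPow k A r) :
    D.d0Gen r s (h ⊗ₜ BarPow.cons k A r (Bar.mk k a ⊗ₜ t)) = D.d0Step r s a h t := by
  simp [d0Gen]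

/-- The map `(h, t, x) ↦ (1 # h) ⊗ t ⊗ x ⊗ 1 - ∑ a ⊗ t' ⊗ x ⊗ (1 # c)`, where `x ∈ Ā⁰ = k` and
`hopfMerge h (t ⊗ 1) = ∑ a ⊗ t' ⊗ c`. -/
def d1Step (s : ℕ) :
    H →ₗ[k] BarPow k H s →ₗ[k] BarPow k A 0 →ₗ[k] Bim k D.Alg (Gen k A H 0 s) where
  toFun h := LinearMap.mk₂ k (fun t x => D.inH h ⊗ₜ ((t ⊗ₜ x) ⊗ₜ 1) -
      TensorProduct.map D.inA.toLinearMap (TensorProduct.map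
        ((TensorProduct.mk k (BarPow k H s) (BarPow k A 0)).flip x) D.inH)
        (D.hopfMerge s h (BarMod.inl s t)))
    (fun _ _ _ => by
      simp only [map_add, TensorProduct.add_tmul, TensorProduct.tmul_add]
      abel)
    (fun _ _ _ => by
      simp only [map_smul, ← TensorProduct.smul_tmul', TensorProduct.tmul_smul, smul_sub])
    (fun _ _ _ => by
      simp only [map_add, TensorProduct.add_tmul, TensorProduct.tmul_add,
        TensorProduct.map_add_left, TensorProduct.map_add_right, LinearMap.add_apply]
      abel)
    (fun _ _ _ => by
      simp only [map_smul, ← TensorProduct.smul_tmul', TensorProduct.tmul_smul, smul_sub,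
        TensorProduct.map_smul_left, TensorProduct.map_smul_right, LinearMap.smul_apply])
  map_add' _ _ := LinearMap.ext₂ fun h t => by
    simp only [LinearMap.mk₂_apply, map_add, LinearMap.add_apply, TensorProduct.add_tmul]
    abel
  map_smul' _ _ := LinearMap.ext₂ fun h t => by
    simp only [LinearMap.mk₂_apply, map_smul, LinearMap.smul_apply, ← TensorProduct.smul_tmul',
      smul_sub, RingHom.id_apply]

theorem d1Step_apply (s : ℕ) (h : H) (t : BarPow k H s) (x : BarPow k A 0) :
    D.d1Step s h t x = D.inH h ⊗ₜ ((t ⊗ₜ x) ⊗ₜ 1) -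
      TensorProduct.map D.inA.toLinearMap (TensorProduct.map
        ((TensorProduct.mk k (BarPow k H s) (BarPow k A 0)).flip x) D.inH)
        (D.hopfMerge s h (BarMod.inl s t)) := rfl

theorem inH_one : D.inH 1 = 1 := rfl

theorem d1Step_one (s : ℕ) : D.d1Step s 1 = 0 :=
  LinearMap.ext₂ fun t x => by
    rw [d1Step_apply, hopfMerge_one]
    simp [BarMod.inl, inH_one]

/-- `d¹_{0,s+1} : X_{0,s+1} → X_{0s}`, on generators: `h₁ ⊗ ⋯ ⊗ hₛ₊₁ ↦ (1 # h₁) ⊗ (h₂ ⊗ ⋯ ⊗ hₛ₊₁) ⊗ 1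
+ ∑_{1 ≤ i ≤ s} (-1)ⁱ f(hᵢ⁽¹⁾, hᵢ₊₁⁽¹⁾)^{h₁⁽¹⁾, …, hᵢ₋₁⁽¹⁾} ⊗ (h₁⁽²⁾ ⊗ ⋯ ⊗ hᵢ₋₁⁽²⁾ ⊗ hᵢ⁽²⁾hᵢ₊₁⁽²⁾ ⊗
hᵢ₊₂ ⊗ ⋯ ⊗ hₛ₊₁) ⊗ 1 + (-1)ˢ⁺¹ 1 ⊗ (h₁ ⊗ ⋯ ⊗ hₛ) ⊗ (1 # hₛ₊₁)`. -/
def d1Gen (s : ℕ) : Gen k A H 0 (s + 1) →ₗ[k] Bim k D.Alg (Gen k A H 0 s) :=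
  TensorProduct.lift (Bar.lift₂ (X := BarPow k A 0 →ₗ[k] Bim k D.Alg (Gen k A H 0 s))
    (D.d1Step s) (D.d1Step_one s) ∘ₗ (BarPow.cons k H s).symm.toLinearMap)

theorem d1Gen_tmul (s : ℕ) (h : H) (t : BarPow k H s) (x : BarPow k A 0) :
    D.d1Gen s (BarPow.cons k H s (Bar.mk k h ⊗ₜ t) ⊗ₜ x) = D.d1Step s h t x := by
  simp [d1Gen]

/-- The contracting homotopy `σ⁰_{r+1,s} : X_{rs} → X_{r+1,s}` of the rows,
`e ⊗ h ⊗ (a₁ ⊗ ⋯ ⊗ aᵣ) ⊗ (aᵣ₊₁ # l) ↦ (-1)ʳ⁺¹ e ⊗ h ⊗ (a₁ ⊗ ⋯ ⊗ aᵣ₊₁) ⊗ (1 # l)`. -/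
def sigma0 (r s : ℕ) : Bim k D.Alg (Gen k A H r s) →ₗ[k] Bim k D.Alg (Gen k A H (r + 1) s) :=
  (-1 : k) ^ (r + 1) • LinearMap.lTensor D.Alg
    (TensorProduct.map
        (LinearMap.lTensor (BarPow k H s) ((BarPow.snoc k A r).toLinearMap ∘ₗ
          LinearMap.lTensor (BarPow k A r) (Bar.mk k)) ∘ₗ
          (TensorProduct.assoc k (BarPow k H s) (BarPow k A r) A).toLinearMap) D.inH ∘ₗ
      (TensorProduct.assoc k (Gen k A H r s) A H).symm.toLinearMap ∘ₗ
      LinearMap.lTensor (Gen k A H r s) D.toAlg.symm.toLinearMap)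

theorem sigma0_tmul (r s : ℕ) (e : D.Alg) (h : BarPow k H s) (t : BarPow k A r) (a : A) (l : H) :
    D.sigma0 r s (e ⊗ₜ ((h ⊗ₜ t) ⊗ₜ D.toAlg (a ⊗ₜ l))) =
      (-1 : k) ^ (r + 1) • (e ⊗ₜ ((h ⊗ₜ BarPow.snoc k A r (t ⊗ₜ Bar.mk k a)) ⊗ₜ D.inH l)) := by
  simp [sigma0]

/-- `σ⁰_{rs} : X_{r-1,s} → X_{rs}`, with the convention that it is `0` for `r = 0`. -/
def sigmaTo : (r s : ℕ) → Bim k D.Alg (Gen k A H (r - 1) s) →ₗ[k] Bim k D.Alg (Gen k A H r s)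
  | 0, _ => 0
  | r + 1, s => D.sigma0 r s

/-- The given components `d⁰_{rs} : X_{rs} → X_{r-1,s}` and `d¹_{0s} : X_{0s} → X_{0,s-1}`, seen as
maps `X_{rs} → X_{r's'}` for all indices (and zero for the other indices). -/
def dBase (r s r' s' : ℕ) : Gen k A H r s →ₗ[k] Bim k D.Alg (Gen k A H r' s') :=
  if h0 : r = r' + 1 ∧ s = s' then by
    rw [h0.1, h0.2]
    exact D.d0Gen r' s'
  else if h1 : r = 0 ∧ r' = 0 ∧ s = s' + 1 then by
    rw [h1.1, h1.2.1, h1.2.2]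
    exact D.d1Gen s'
  else 0

theorem dBase_d0 (r s : ℕ) : D.dBase (r + 1) s r s = D.d0Gen r s := by simp [dBase]

theorem dBase_d1 (s : ℕ) : D.dBase 0 (s + 1) 0 s = D.d1Gen s := by simp [dBase]

/-- The component `X_{rs} → X_{r's'}` of the differential of the resolution
`X_n = ⊕_{r+s=n} E ⊗ H̄ˢ ⊗ Āʳ ⊗ E`, on generators. It vanishes unless `r' + s' + 1 = r + s` and
`s' ≤ s`; for `s' = s - l` and `r' = r + l - 1` it is the map `dˡ_{rs}`, where `d⁰_{rs}` and `d¹_{0s}`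
are given and the others are
`dˡ_{rs} = - ∑_{0 ≤ j < l, r + j > 0} σ⁰_{r+l-1,s-l} ∘ d^{l-j}_{r+j-1,s-j} ∘ dʲ_{rs}` on generators. -/
def dGen (r s r' s' : ℕ) : Gen k A H r s →ₗ[k] Bim k D.Alg (Gen k A H r' s') :=
  if r' + s' + 1 = r + s ∧ s' < s ∧ 0 < r' then
    - (D.sigmaTo r' s' ∘ₗ ∑ j : Fin (s - s'),
        if 0 < r + j.1 then
          extend (dGen (r + j.1 - 1) (s - j.1) (r' - 1) s') ∘ₗ dGen r s (r + j.1 - 1) (s - j.1)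
        else 0)
  else D.dBase r s r' s'
termination_by (s - s', r)
decreasing_by
  all_goals
    have := j.2
    rw [Prod.lex_def]
    simp only
    omega

end Resolution

section Complexes
variable (M : Type u) [AddCommGroup M] [Module k M] [Module D.Alg M] [Module D.Algᵐᵒᵖ M]
  [IsScalarTower k D.Alg M] [IsScalarTower k D.Algᵐᵒᵖ M] [SMulCommClass D.Alg D.Algᵐᵒᵖ M]

/-- The pairs `(r, s)` with `r + s = n`. -/
abbrev Idx (n : ℕ) : Type := Finset.HasAntidiagonal.antidiagonal n

/-- The pair `(r, s)`, as an index in total degree `r + s`. -/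
def Idx.mk (r s : ℕ) : Idx (r + s) := ⟨(r, s), Finset.HasAntidiagonal.mem_antidiagonal.2 rfl⟩

variable (k A H) in
/-- `X̂ₙ = ⊕_{r+s=n} M ⊗ H̄ˢ ⊗ Āʳ`. -/
abbrev Xhat (M : Type u) [AddCommGroup M] [Module k M] (n : ℕ) : Type u :=
  ∀ p : Idx n, M ⊗[k] Gen k A H p.1.1 p.1.2

variable (k A H) in
/-- `X̂ⁿ = ⊕_{r+s=n} Hom_k(H̄ˢ ⊗ Āʳ, M)`. -/
abbrev XhatCo (M : Type u) [AddCommGroup M] [Module k M] (n : ℕ) : Type u :=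
  ∀ p : Idx n, Gen k A H p.1.1 p.1.2 →ₗ[k] M

/-- The differential `X̂ₙ₊₁ → X̂ₙ`, obtained from that of the resolution by `M ⊗_{Eᵉ} -`. -/
def dHat (n : ℕ) : Xhat k A H M (n + 1) →ₗ[k] Xhat k A H M n :=
  LinearMap.pi fun q => ∑ p : Idx (n + 1),
    chainMap M (D.dGen p.1.1 p.1.2 q.1.1 q.1.2) ∘ₗ LinearMap.proj p

/-- The differential `X̂ⁿ → X̂ⁿ⁺¹`, obtained from that of the resolution by `Hom_{Eᵉ}(-, M)`. -/
def dHatCo (n : ℕ) : XhatCo k A H M n →ₗ[k] XhatCo k A H M (n + 1) :=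
  LinearMap.pi fun q => ∑ p : Idx n,
    cochainMap M (D.dGen q.1.1 q.1.2 p.1.1 p.1.2) ∘ₗ LinearMap.proj p

/-- The complex `X̂_*(E, M)`. -/
def chain (hd : ∀ n, D.dHat M n ∘ₗ D.dHat M (n + 1) = 0) : ChainComplex (ModuleCat.{u} k) ℕ :=
  ChainComplex.of (fun n => ModuleCat.of k (Xhat k A H M n))
    (fun n => ModuleCat.ofHom (D.dHat M n))
    (fun n => by rw [← ModuleCat.ofHom_comp, hd]; rfl)

/-- The complex `X̂^*(E, M)`. -/
def cochain (hd : ∀ n, D.dHatCo M (n + 1) ∘ₗ D.dHatCo M n = 0) :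
    CochainComplex (ModuleCat.{u} k) ℕ :=
  CochainComplex.of (fun n => ModuleCat.of k (XhatCo k A H M n))
    (fun n => ModuleCat.ofHom (D.dHatCo M n))
    (fun n => by rw [← ModuleCat.ofHom_comp, hd]; rfl)

/-- The filtration of `X̂_*(E, M)` by the number of factors `H̄`:
`Fⁱ X̂ₙ = ⊕_{s ≤ i} M ⊗ H̄ˢ ⊗ Āⁿ⁻ˢ`. -/
def chainFil (hd : ∀ n, D.dHat M n ∘ₗ D.dHat M (n + 1) = 0) (i : ℤ) (n : ℕ) :
    Submodule k ((D.chain M hd).X n) where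
  carrier := {x : Xhat k A H M n | ∀ p : Idx n, i < p.1.2 → x p = 0}
  zero_mem' := fun p _ => rfl
  add_mem' := fun {x y} hx hy p hp => by
    have h : (x : Xhat k A H M n) p + (y : Xhat k A H M n) p = 0 := by rw [hx p hp, hy p hp, add_zero]
    exact h
  smul_mem' := fun c x hx p hp => by
    have h : c • (x : Xhat k A H M n) p = 0 := by rw [hx p hp, smul_zero]
    exact h

/-- The filtration of `X̂^*(E, M)` by the number of factors `H̄`, written as an increasing
filtration: the term of index `-i` is `Fⁱ X̂ⁿ = ⊕_{s ≥ i} Hom_k(H̄ˢ ⊗ Āⁿ⁻ˢ, M)`. -/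
def cochainFil (hd : ∀ n, D.dHatCo M (n + 1) ∘ₗ D.dHatCo M n = 0) (i : ℤ) (n : ℕ) :
    Submodule k ((D.cochain M hd).X n) where
  carrier := {x : XhatCo k A H M n | ∀ p : Idx n, (p.1.2 : ℤ) < -i → x p = 0}
  zero_mem' := fun p _ => rfl
  add_mem' := fun {x y} hx hy p hp => by
    have h : (x : XhatCo k A H M n) p + (y : XhatCo k A H M n) p = 0 := by
      rw [hx p hp, hy p hp, add_zero]
    exact h
  smul_mem' := fun c x hx p hp => by
    have h : c • (x : XhatCo k A H M n) p = 0 := by rw [hx p hp, smul_zero]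
    exact h

/-- The component of index `(r, s)` of an element of `X̂_{r+s}`, seen as a Hochschild chain of `A`
of degree `r` with coefficients in `M ⊗ H̄ˢ`. -/
def chainComponent (r s : ℕ) : Xhat k A H M (r + s) →ₗ[k] D.TwTensor M s ⊗[k] BarPow k A r :=
  LinearMap.rTensor (BarPow k A r) (D.toTwTensor s).toLinearMap ∘ₗ
    (TensorProduct.assoc k M (BarPow k H s) (BarPow k A r)).symm.toLinearMap ∘ₗ
    LinearMap.proj (Idx.mk r s)

/-- The component of index `(r, s)` of an element of `X̂^{r+s}`, seen as a Hochschild cochain of `A`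
of degree `r` with coefficients in `Hom_k(H̄ˢ, M)`: `t ↦ (h ↦ φ(h ⊗ t))`. -/
def cochainComponent (r s : ℕ) : XhatCo k A H M (r + s) →ₗ[k] (BarPow k A r →ₗ[k] D.TwHom M s) :=
  LinearMap.compRight k (D.toTwHom s).toLinearMap ∘ₗ LinearMap.lflip.toLinearMap ∘ₗ
    (TensorProduct.lift.equiv (RingHom.id k) (BarPow k H s) (BarPow k A r) M).symm.toLinearMap ∘ₗ
    LinearMap.proj (Idx.mk r s)

end Complexes

end CrossedProduct
end Crossed

section Filtered
variable {k : Type u} [CommRing k] {ι κ : Type} {c : ComplexShape ι}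
  (C : HomologicalComplex (ModuleCat.{u} k) c) (F : ℤ → ∀ n, Submodule k (C.X n))

/-- `Zᵖ_s = {x ∈ F_s | dx ∈ F_{s-p}}`, for an increasing filtration `F` of a complex. -/
def approxCycles (p s : ℤ) (n : ι) : Submodule k (C.X n) :=
  F s n ⊓ ⨅ j, Submodule.comap (C.d n j).hom (F (s - p) j)

/-- `Z^{p-1}_{s-1} + d Z^{p-1}_{s+p-1}`. The quotient of `Zᵖ_s` by it is `Eᵖ_s`. -/
def approxBoundaries (p s : ℤ) (n : ι) : Submodule k (C.X n) :=
  approxCycles C F (p - 1) (s - 1) n ⊔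
    ⨆ i, Submodule.map (C.d i n).hom (approxCycles C F (p - 1) (s + p - 1) i)

/-- The filtration of the homology of `C` induced by `F`: its term of index `s` consists of the
classes of the cycles that lie in `F_s`. -/
def homologyFil (s : ℤ) (n : ι) : Submodule k (C.homology n) :=
  Submodule.map (C.homologyπ n).hom (Submodule.comap (C.iCycles n).hom (F s n))

/-- An identification of a spectral sequence, starting at the page `1`, with the spectral sequence
of the filtered complex `(C, F)`: the position `q` of the pages has total degree `deg q` and
filtration degree `fil q`, one has `Eᵖ = Zᵖ_s / (Z^{p-1}_{s-1} + d Z^{p-1}_{s+p-1})` there, the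
differentials of the pages are induced by that of `C`, and the isomorphisms from the homology of
a page to the next page are the evident ones. -/
structure IsSpectralSequenceOf {cs : ℤ → ComplexShape κ}
    (S : SpectralSequence (ModuleCat.{u} k) cs 1) (deg : κ → ι) (fil : κ → ℤ) where
  /-- the projection `Zᵖ_s → Eᵖ` -/
  proj : ∀ (p : ℤ) (hp : 1 ≤ p) (q : κ),
    approxCycles C F p (fil q) (deg q) →ₗ[k] (S.page p hp).X q
  proj_surjective : ∀ p hp q, Function.Surjective (proj p hp q)
  proj_eq_zero_iff : ∀ p hp q (x : approxCycles C F p (fil q) (deg q)),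
    proj p hp q x = 0 ↔ (x : C.X (deg q)) ∈ approxBoundaries C F p (fil q) (deg q)
  d_proj : ∀ p hp q q', (cs p).Rel q q' → ∀ (x : approxCycles C F p (fil q) (deg q))
    (y : approxCycles C F p (fil q') (deg q')), (C.d (deg q) (deg q')).hom x = y →
    ((S.page p hp).d q q').hom (proj p hp q x) = proj p hp q' y
  iso_proj : ∀ (p : ℤ) (hp : 1 ≤ p) (q : κ) (x : approxCycles C F p (fil q) (deg q))
    (y : approxCycles C F (p + 1) (fil q) (deg q)) (z : (S.page p hp).cycles q),
    (x : C.X (deg q)) = y → ((S.page p hp).iCycles q).hom z = proj p hp q x →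
    (S.iso p (p + 1) q rfl hp).hom.hom (((S.page p hp).homologyπ q).hom z) =
      proj (p + 1) (by lia) q y

variable {C F}

/-- The spectral sequence `S` converges to the graded module `G` with the increasing filtration
`Φ`: in each degree the filtration is exhaustive, bounded, and jumps only in filtration degrees
that occur in `S`, and at each position `q` the pages become stationary, with
`E^∞ = Φ_s G_n / Φ_{s-1} G_n` where `n = deg q` and `s = fil q`. -/
structure Converges {cs : ℤ → ComplexShape κ} (S : SpectralSequence (ModuleCat.{u} k) cs 1)
    (deg : κ → ι) (fil : κ → ℤ) (G : ι → ModuleCat.{u} k)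
    (Φ : ℤ → ∀ n, Submodule k (G n)) : Prop where
  mono : ∀ n, Monotone fun s => Φ s n
  bot : ∀ n, ∃ s, Φ s n = ⊥
  top : ∀ n, ∃ s, Φ s n = ⊤
  jump : ∀ n s, (∀ q, ¬ (deg q = n ∧ fil q = s)) → Φ s n = Φ (s - 1) n
  abutment : ∀ q, ∃ (p₀ : ℤ) (hp₀ : 1 ≤ p₀) (e : ∀ (p : ℤ) (hp : p₀ ≤ p),
      (S.page p (hp₀.trans hp)).X q ≃ₗ[k]
        Φ (fil q) (deg q) ⧸ (Φ (fil q - 1) (deg q)).submoduleOf (Φ (fil q) (deg q))),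
    (∀ (p : ℤ) (hp : p₀ ≤ p) (q' : κ), (S.page p (hp₀.trans hp)).d q q' = 0 ∧
      (S.page p (hp₀.trans hp)).d q' q = 0) ∧
    ∀ (p : ℤ) (hp : p₀ ≤ p) (z : (S.page p (hp₀.trans hp)).cycles q),
      e (p + 1) (by lia) ((S.iso p (p + 1) q rfl (hp₀.trans hp)).hom.hom
        (((S.page p (hp₀.trans hp)).homologyπ q).hom z)) =
      e p hp (((S.page p (hp₀.trans hp)).iCycles q).hom z)

end Filtered

end HopfCrossed

end

open HopfCrossed

/-! Modulo the next smaller step of the filtration only `d⁰` survives in `X̂`, and `M ⊗_{Eᵉ} d⁰` is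
the Hochschild differential of `A` with coefficients in `M ⊗ H̄ˢ`; dually for `Hom`. Since the
filtration is finite in each degree, the first page and the convergence follow from the general
theory of filtered complexes (`pageOneIso`, `converges`). The substance is that `X̂` computes the
Hochschild (co)homology of `E`, that is, that `X_*` resolves the bimodule `E`.

Nothing is projective over `k` here, so "resolution" is meant relative to `k`: the bimodules have
the form `E ⊗ V ⊗ E`, and there is a `k`-linear contracting homotopy (`SplitResolution`). Two such
resolutions are compared by maps built recursively from the contractions, inverse to each other up
to homotopies of the same kind. Hence they have the same homology with coefficients
(`chainHomologyIso`, `cochainHomologyIso`), and one of them is the normalized bar resolution.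

To contract `X_*`, consider first its rows. The row of index `s`, with differential `d⁰`, resolves
`E ⊗_A (E/A) ⊗_A ⋯ ⊗_A (E/A) ⊗_A E`, with `s` factors `E/A`. As a module this is `Base s = E ⊗ H̄ˢ ⊗
H`; the augmentation is `mu`, and `σ` together with the section `sec` contracts the row
(`d0_sigma0`, `d0_sigma0_zero`). The modules `Base s` form the bar complex of `E` relative to `A`,
which has its own contraction `baseS`, and `d¹` on `X_{0s}` lifts its differential (`mu_d1`). The
recursion for the remaining `dˡ` solves the equations `∑ d^{l-j} dʲ = 0` one after the other, with
`σ` as a partial inverse of `d⁰` (`dGen_dGen`).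

Let `h` be `σ` plus the homotopy of the bar complex transported to `X_{0*}`, and let `p` be the
projection given by the augmentation in degree `0`. Then `U = dh + hd + p` is not the identity, but
`U - 1` strictly lowers the number of factors `H̄`, hence is nilpotent in each degree. So `U` is
invertible; it commutes with `d`, and `h U⁻¹` is the required contraction (`totD_totS`). -/

noncomputable section

namespace HopfCrossed

/-! ### Homology of complexes of modules, by elements -/

section Surjective
variable {k : Type u} [CommRing k] {T P Q : Type u} [AddCommGroup T] [Module k T] [AddCommGroup P]
  [Module k P] [AddCommGroup Q] [Module k Q]

/-- Two quotients of `T` by the same submodule are isomorphic. -/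
def quotientsEquiv (f : T →ₗ[k] P) (g : T →ₗ[k] Q) (hf : Function.Surjective f)
    (hg : Function.Surjective g) (h : ∀ t, f t = 0 ↔ g t = 0) : P ≃ₗ[k] Q :=
  (f.quotKerEquivOfSurjective hf).symm ≪≫ₗ
    Submodule.quotEquivOfEq _ _ (by ext t; exact h t) ≪≫ₗ g.quotKerEquivOfSurjective hg

theorem quotientsEquiv_apply (f : T →ₗ[k] P) (g : T →ₗ[k] Q) (hf : Function.Surjective f)
    (hg : Function.Surjective g) (h : ∀ t, f t = 0 ↔ g t = 0) (t : T) :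
    quotientsEquiv f g hf hg h (f t) = g t := by
  have h1 : (f.quotKerEquivOfSurjective hf).symm (f t) = Submodule.Quotient.mk t := by
    rw [LinearEquiv.symm_apply_eq]; rfl
  simp only [quotientsEquiv, LinearEquiv.trans_apply, h1]
  rfl

end Surjective

section Homology
variable {k : Type u} [CommRing k] {ι : Type} {c : ComplexShape ι}
  (K : HomologicalComplex (ModuleCat.{u} k) c) (q : ι)

theorem iCycles_injective : Function.Injective (K.iCycles q).hom :=
  (ModuleCat.mono_iff_injective (K.iCycles q)).1 inferInstance

theorem homologyπ_surjective : Function.Surjective (K.homologyπ q).hom :=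
  (ModuleCat.epi_iff_surjective (K.homologyπ q)).1 inferInstance

theorem d_iCycles (j : ι) (z : K.cycles q) : (K.d q j).hom ((K.iCycles q).hom z) = 0 := by
  rw [← ModuleCat.comp_apply, K.iCycles_d]; rfl

/-- If `q` has no predecessor, then `c.prev q` is `q` itself and the differential in question is
zero by shape; the criterion is still correct, because it then forces `z = 0`. -/
theorem homologyπ_eq_zero_iff (z : K.cycles q) : (K.homologyπ q).hom z = 0 ↔
    ∃ y : K.X (c.prev q), (K.d (c.prev q) q).hom y = (K.iCycles q).hom z := by
  have hS := ShortComplex.exact_of_g_is_cokernel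
    (ShortComplex.mk (K.toCycles (c.prev q) q) (K.homologyπ q) (K.toCycles_comp_homologyπ _ _))
    (K.homologyIsCokernel (c.prev q) q rfl)
  have hS' := hS
  rw [ShortComplex.moduleCat_exact_iff] at hS'
  have e : ∀ y, (K.iCycles q).hom ((K.toCycles (c.prev q) q).hom y) =
      (K.d (c.prev q) q).hom y := fun y => by
    rw [← ModuleCat.comp_apply, K.toCycles_i]
  constructor
  · intro h
    obtain ⟨y, hy⟩ := hS' z h
    refine ⟨y, ?_⟩
    rw [← e]
    exact congrArg _ hy
  · rintro ⟨y, hy⟩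
    have : (K.toCycles (c.prev q) q).hom y = z := iCycles_injective K q (by rw [e, hy])
    rw [← this, ← ModuleCat.comp_apply, K.toCycles_comp_homologyπ]
    rfl

variable {T : Type u} [AddCommGroup T] [Module k T]

/-- A linear map to the cycles induces a map to the homology. -/
def toHomology (f : T →ₗ[k] K.X q) (hf : ∀ t, (K.d q (c.next q)).hom (f t) = 0) :
    T →ₗ[k] K.homology q :=
  (K.liftCycles (A := ModuleCat.of k T) (ModuleCat.ofHom f) (c.next q) rfl (by
    ext t; exact hf t) ≫ K.homologyπ q).hom

variable (f : T →ₗ[k] K.X q) (hf : ∀ t, (K.d q (c.next q)).hom (f t) = 0)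

theorem exists_cycle (t : T) : ∃ z : K.cycles q, (K.iCycles q).hom z = f t ∧
    (K.homologyπ q).hom z = toHomology K q f hf t := by
  refine ⟨(K.liftCycles (A := ModuleCat.of k T) (ModuleCat.ofHom f) (c.next q) rfl (by
    ext t; exact hf t)).hom t, ?_, rfl⟩
  rw [← ModuleCat.comp_apply, K.liftCycles_i]
  rfl

theorem homologyπ_eq_toHomology (t : T) (z : K.cycles q) (h : (K.iCycles q).hom z = f t) :
    (K.homologyπ q).hom z = toHomology K q f hf t := by
  obtain ⟨z', h1, h2⟩ := exists_cycle K q f hf t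
  rw [← h2, iCycles_injective K q (h.trans h1.symm)]

theorem toHomology_eq_zero_iff (t : T) : toHomology K q f hf t = 0 ↔
    ∃ y : K.X (c.prev q), (K.d (c.prev q) q).hom y = f t := by
  obtain ⟨z', h1, h2⟩ := exists_cycle K q f hf t
  rw [← h2, homologyπ_eq_zero_iff, h1]

theorem toHomology_surjective (h : ∀ x : K.X q, (K.d q (c.next q)).hom x = 0 →
    ∃ t, ∃ y : K.X (c.prev q), x = f t + (K.d (c.prev q) q).hom y) :
    Function.Surjective (toHomology K q f hf) := by
  intro w
  obtain ⟨z, rfl⟩ := homologyπ_surjective K q w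
  obtain ⟨t, y, hy⟩ := h _ (d_iCycles K q _ z)
  refine ⟨t, ?_⟩
  obtain ⟨z', h1, h2⟩ := exists_cycle K q f hf t
  rw [← h2, ← sub_eq_zero, ← map_sub, homologyπ_eq_zero_iff]
  exact ⟨-y, by rw [map_neg, map_sub, h1, hy]; abel⟩

end Homology

/-! ### The spectral sequence of a filtered complex -/

section Filtered
variable {k : Type u} [CommRing k] {ι κ : Type} {c : ComplexShape ι}
  (C : HomologicalComplex (ModuleCat.{u} k) c) (F : ℤ → ∀ n, Submodule k (C.X n))

/-- A bounded exhaustive filtration of a complex by subcomplexes, with jumps only in the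
filtration degrees `fil q` in total degree `deg q`, where the shapes `cs p` connect the positions
that differ by `p` in filtration degree. -/
structure IsFiltration (cs : ℤ → ComplexShape κ) (deg : κ → ι) (fil : κ → ℤ) : Prop where
  mono : ∀ n, Monotone fun s => F s n
  d_mem : ∀ s i j x, x ∈ F s i → (C.d i j).hom x ∈ F s j
  bot : ∀ n, ∃ s, F s n = ⊥
  top : ∀ n, ∃ s, F s n = ⊤
  rel_iff : ∀ p q q', (cs p).Rel q q' ↔ c.Rel (deg q) (deg q') ∧ fil q' = fil q - p
  jump : ∀ n s, (∀ q, ¬ (deg q = n ∧ fil q = s)) → F s n = F (s - 1) n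

variable {C F}

theorem mem_approxCycles {p s : ℤ} {n : ι} {x : C.X n} : x ∈ approxCycles C F p s n ↔
    x ∈ F s n ∧ ∀ j, (C.d n j).hom x ∈ F (s - p) j := by
  simp [approxCycles, Submodule.mem_iInf]

theorem d_d_apply (i j l : ι) (x : C.X i) : (C.d j l).hom ((C.d i j).hom x) = 0 := by
  rw [← ModuleCat.comp_apply, C.d_comp_d]; rfl

theorem add_d_mem_approxBoundaries {p s : ℤ} {n i : ι} {a : C.X n} {b : C.X i}
    (ha : a ∈ approxCycles C F (p - 1) (s - 1) n) (hb : b ∈ approxCycles C F (p - 1) (s + p - 1) i) :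
    a + (C.d i n).hom b ∈ approxBoundaries C F p s n :=
  Submodule.add_mem_sup ha (Submodule.mem_iSup_of_mem i ⟨b, hb, rfl⟩)

/-- A degree has at most one predecessor and all other differentials into it vanish, so the supremum
over the source degrees collapses to a single term. -/
theorem exists_of_mem_approxBoundaries {p s : ℤ} {n : ι} (i : ι) (hi : c.prev n = i) {x : C.X n}
    (hx : x ∈ approxBoundaries C F p s n) : ∃ a ∈ approxCycles C F (p - 1) (s - 1) n,
      ∃ b ∈ approxCycles C F (p - 1) (s + p - 1) i, x = a + (C.d i n).hom b := by
  obtain ⟨a, ha, y, hy, rfl⟩ := Submodule.mem_sup.1 hx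
  have hle : ⨆ i, Submodule.map (C.d i n).hom (approxCycles C F (p - 1) (s + p - 1) i) ≤
      Submodule.map (C.d i n).hom (approxCycles C F (p - 1) (s + p - 1) i) := by
    refine iSup_le fun j => ?_
    by_cases hj : c.Rel j n
    · obtain rfl : i = j := hi.symm.trans (c.prev_eq' hj)
      exact le_rfl
    · rw [C.shape _ _ hj]
      rintro _ ⟨b, -, rfl⟩
      exact zero_mem _
  obtain ⟨b, hb, rfl⟩ := hle hy
  exact ⟨a, ha, b, hb, rfl⟩

namespace IsFiltration
variable {cs : ℤ → ComplexShape κ} {deg : κ → ι} {fil : κ → ℤ} (h : IsFiltration C F cs deg fil)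
include h

theorem approxCycles_le {p p' s s' : ℤ} (hs : s ≤ s') (hp : s - p ≤ s' - p') (n : ι) :
    approxCycles C F p s n ≤ approxCycles C F p' s' n := fun x hx => by
  rw [mem_approxCycles] at hx ⊢
  exact ⟨h.mono n hs hx.1, fun j => h.mono j hp (hx.2 j)⟩

theorem d_mem_approxCycles {p p' s s' : ℤ} (hs : s - p ≤ s') {n j : ι} {x : C.X n}
    (hx : x ∈ approxCycles C F p s n) : (C.d n j).hom x ∈ approxCycles C F p' s' j := by
  rw [mem_approxCycles] at hx ⊢
  exact ⟨h.mono j hs (hx.2 j), fun i => by rw [d_d_apply]; exact zero_mem _⟩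

/-- If the position that `dᵖ` would reach does not exist, the filtration does not jump there:
`F_{s-p} = F_{s-p-1}` in the next degree, and `Zᵖ` is already `Z^{p+1}`. -/
theorem mem_of_not_rel {p : ℤ} {q : κ} (hq : ¬ (cs p).Rel q ((cs p).next q)) {x : C.X (deg q)}
    (hx : x ∈ approxCycles C F p (fil q) (deg q)) :
    x ∈ approxCycles C F (p + 1) (fil q) (deg q) := by
  rw [mem_approxCycles] at hx ⊢
  refine ⟨hx.1, fun j => ?_⟩
  by_cases hj : c.Rel (deg q) j
  · have := h.jump j (fil q - p) (fun q' hq' => hq (by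
      have hr : (cs p).Rel q q' := (h.rel_iff p q q').2 ⟨by rw [hq'.1]; exact hj, hq'.2⟩
      rwa [(cs p).next_eq' hr]))
    have h2 := hx.2 j
    rw [this] at h2
    rwa [← sub_sub]
  · rw [C.shape _ _ hj]; exact zero_mem _

/-- The counterpart for a missing source position: no jump at `s + p` in the preceding degree. -/
theorem mem_of_not_rel_prev {p : ℤ} {q : κ} (hq : ¬ (cs p).Rel ((cs p).prev q) q) {i : ι}
    (hi : c.Rel i (deg q)) : F (fil q + p) i = F (fil q + p - 1) i :=
  h.jump i (fil q + p) fun q' hq' => hq (by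
    have hr : (cs p).Rel q' q := (h.rel_iff p q' q).2 ⟨by rw [hq'.1]; exact hi, by
      rw [hq'.2]; ring⟩
    rwa [(cs p).prev_eq' hr])

/-- Of `x = a + db` only `da` survives, and `a ∈ Z^{p-1}_{s-1}` has exactly the index `s - 1 = s' +
p - 1` of the sources of boundaries at `s'`. -/
theorem d_mem_approxBoundaries {p s s' : ℤ} {n j : ι} (hs : s' = s - p) {x : C.X n}
    (hx : x ∈ approxBoundaries C F p s n) :
    (C.d n j).hom x ∈ approxBoundaries C F p s' j := by
  obtain ⟨a, ha, b, hb, rfl⟩ := exists_of_mem_approxBoundaries _ rfl hx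
  rw [map_add, d_d_apply, add_zero]
  have := add_d_mem_approxBoundaries (p := p) (s := s') (n := j) (zero_mem _)
    (h.approxCycles_le (p := p - 1) (p' := p - 1) (s := s - 1) (s' := s' + p - 1) (by lia) (by lia)
      n ha)
  rwa [zero_add] at this

end IsFiltration

variable (C F) in
/-- `Eᵖ_s = Zᵖ_s / (Z^{p-1}_{s-1} + d Z^{p-1}_{s+p-1})`. -/
abbrev PageX (p s : ℤ) (n : ι) : Type u :=
  approxCycles C F p s n ⧸ (approxBoundaries C F p s n).submoduleOf (approxCycles C F p s n)

theorem PageX.mk_eq_zero_iff {p s : ℤ} {n : ι} (x : approxCycles C F p s n) :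
    (Submodule.mkQ _ x : PageX C F p s n) = 0 ↔ (x : C.X n) ∈ approxBoundaries C F p s n := by
  rw [Submodule.mkQ_apply, Submodule.Quotient.mk_eq_zero]; rfl

namespace IsFiltration
variable {cs : ℤ → ComplexShape κ} {deg : κ → ι} {fil : κ → ℤ} (h : IsFiltration C F cs deg fil)

/-- The differential of the page, at two connected positions. -/
def pageD (p : ℤ) (q q' : κ) (hr : (cs p).Rel q q') :
    PageX C F p (fil q) (deg q) →ₗ[k] PageX C F p (fil q') (deg q') :=
  Submodule.mapQ _ _ ((C.d (deg q) (deg q')).hom.restrict fun x hx =>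
    h.d_mem_approxCycles (by rw [((h.rel_iff p q q').1 hr).2]) hx) (fun x hx =>
      h.d_mem_approxBoundaries ((h.rel_iff p q q').1 hr).2 hx)

open Classical in
/-- The page `Eᵖ` of the spectral sequence of a filtered complex. -/
def page (p : ℤ) : HomologicalComplex (ModuleCat.{u} k) (cs p) where
  X q := ModuleCat.of k (PageX C F p (fil q) (deg q))
  d q q' := if hr : (cs p).Rel q q' then ModuleCat.ofHom (h.pageD p q q' hr) else 0
  shape q q' hr := dif_neg hr
  d_comp_d' q q' q'' hr hr' := by
    rw [dif_pos hr, dif_pos hr', ← ModuleCat.ofHom_comp]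
    refine congrArg ModuleCat.ofHom (LinearMap.ext fun x => ?_)
    obtain ⟨x, rfl⟩ := Submodule.mkQ_surjective _ x
    refine (PageX.mk_eq_zero_iff _).2 ?_
    have : (C.d (deg q') (deg q'')).hom ((C.d (deg q) (deg q')).hom x) ∈
        approxBoundaries C F p (fil q'') (deg q'') := by
      rw [d_d_apply]; exact zero_mem _
    exact this

/-- The projection `Zᵖ → Eᵖ`. -/
def pageProj (p : ℤ) (q : κ) : approxCycles C F p (fil q) (deg q) →ₗ[k] (h.page p).X q :=
  Submodule.mkQ _

theorem pageProj_surjective (p : ℤ) (q : κ) : Function.Surjective (h.pageProj p q) :=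
  Submodule.mkQ_surjective _

theorem pageProj_eq_zero_iff (p : ℤ) (q : κ) (x : approxCycles C F p (fil q) (deg q)) :
    h.pageProj p q x = 0 ↔ (x : C.X (deg q)) ∈ approxBoundaries C F p (fil q) (deg q) :=
  PageX.mk_eq_zero_iff x

theorem page_d_proj (p : ℤ) (q q' : κ) (hr : (cs p).Rel q q')
    (x : approxCycles C F p (fil q) (deg q)) (y : approxCycles C F p (fil q') (deg q'))
    (hxy : (C.d (deg q) (deg q')).hom x = y) :
    ((h.page p).d q q').hom (h.pageProj p q x) = h.pageProj p q' y := by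
  have h1 : (h.page p).d q q' = ModuleCat.ofHom (h.pageD p q q' hr) := dif_pos hr
  rw [h1]
  refine congrArg (Submodule.mkQ _) ?_
  exact Subtype.ext hxy

/-- For `x ∈ Z^{p+1}_s` the image `dx` lies in `F_{s-p-1}`, so it belongs to the summand
`Z^{p-1}_{s-p-1}` of the boundaries at the target. -/
theorem pageProj_cycle (p : ℤ) (q : κ) (x : C.X (deg q))
    (hx : x ∈ approxCycles C F (p + 1) (fil q) (deg q))
    (hx' : x ∈ approxCycles C F p (fil q) (deg q)) :
    ((h.page p).d q ((cs p).next q)).hom (h.pageProj p q ⟨x, hx'⟩) = 0 := by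
  by_cases hr : (cs p).Rel q ((cs p).next q)
  · have hf := ((h.rel_iff p _ _).1 hr).2
    rw [h.page_d_proj p q _ hr _ ⟨_, h.d_mem_approxCycles (by rw [hf]) hx'⟩ rfl,
      pageProj_eq_zero_iff]
    have h2 : (C.d (deg q) (deg ((cs p).next q))).hom x ∈
        approxCycles C F (p - 1) (fil ((cs p).next q) - 1) (deg ((cs p).next q)) :=
      h.d_mem_approxCycles (by rw [hf]; lia) hx
    have := add_d_mem_approxBoundaries h2 (i := deg q) (zero_mem _)
    rwa [map_zero, add_zero] at this
  · rw [(h.page p).shape _ _ hr]; rfl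

/-- The map from `Z^{p+1}` to the homology of the page `Eᵖ`. -/
def toPageHomology (p : ℤ) (q : κ) :
    approxCycles C F (p + 1) (fil q) (deg q) →ₗ[k] (h.page p).homology q :=
  toHomology (h.page p) q (h.pageProj p q ∘ₗ
    Submodule.inclusion (h.approxCycles_le le_rfl (by lia) (deg q))) fun x =>
      h.pageProj_cycle p q x x.2 _

theorem pageProj_eq_pageProj {p : ℤ} {q : κ} {x y : approxCycles C F p (fil q) (deg q)}
    (hxy : (x : C.X (deg q)) - y ∈ approxBoundaries C F p (fil q) (deg q)) :
    h.pageProj p q x = h.pageProj p q y := by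
  have h1 := (h.pageProj_eq_zero_iff p q (x - y)).2 hxy
  rwa [map_sub, sub_eq_zero] at h1

theorem page_d_proj_eq_iff (p : ℤ) (q q' : κ) (hr : (cs p).Rel q q')
    (x : approxCycles C F p (fil q) (deg q)) (y : approxCycles C F p (fil q') (deg q')) :
    ((h.page p).d q q').hom (h.pageProj p q x) = h.pageProj p q' y ↔
      (C.d (deg q) (deg q')).hom x - y ∈ approxBoundaries C F p (fil q') (deg q') := by
  have hx : (C.d (deg q) (deg q')).hom x ∈ approxCycles C F p (fil q') (deg q') :=
    h.d_mem_approxCycles (by rw [((h.rel_iff p _ _).1 hr).2]) x.2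
  rw [h.page_d_proj p q q' hr x ⟨_, hx⟩ rfl, ← sub_eq_zero, ← map_sub, pageProj_eq_zero_iff]
  rfl

/-- Cycles of the page lift to `Z^{p+1}`: the hypothesis says `dy = a + db` with `a` one filtration
step below the target and `b ∈ F_{s-1}`. Then `d(y - b) = a`, so `y - b` is in `Z^{p+1}`, and `b` is
one of the boundaries that the page ignores. -/
theorem exists_sub_mem_of_page_d_eq_zero (p : ℤ) (q : κ) (y : approxCycles C F p (fil q) (deg q))
    (hy : ((h.page p).d q ((cs p).next q)).hom (h.pageProj p q y) = 0) :
    ∃ x : approxCycles C F (p + 1) (fil q) (deg q),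
      (y : C.X (deg q)) - x ∈ approxBoundaries C F p (fil q) (deg q) := by
  by_cases hr : (cs p).Rel q ((cs p).next q)
  · obtain ⟨hc, hf⟩ := (h.rel_iff p _ _).1 hr
    have hw := (h.page_d_proj_eq_iff p q _ hr y 0).1 (by rw [hy, map_zero])
    rw [ZeroMemClass.coe_zero, sub_zero] at hw
    obtain ⟨a, ha, b, hb, hab⟩ := exists_of_mem_approxBoundaries (deg q) (c.prev_eq' hc) hw
    rw [hf] at ha hb
    have hb' : b ∈ approxCycles C F (p - 1) (fil q - 1) (deg q) :=
      h.approxCycles_le (by lia) (by lia) _ hb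
    refine ⟨⟨y - b, mem_approxCycles.2 ⟨sub_mem (mem_approxCycles.1 y.2).1
      (h.mono _ (by lia) (mem_approxCycles.1 hb').1), fun j => ?_⟩⟩, ?_⟩
    · by_cases hj : c.Rel (deg q) j
      · obtain rfl : deg ((cs p).next q) = j := (c.next_eq' hc).symm.trans (c.next_eq' hj)
        rw [map_sub, hab, add_sub_cancel_right]
        exact h.mono _ (by lia) (mem_approxCycles.1 ha).1
      · rw [C.shape _ _ hj]; exact zero_mem _
    · have := add_d_mem_approxBoundaries hb' (i := deg q) (zero_mem _)
      rw [map_zero, add_zero] at this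
      simpa using this
  · exact ⟨⟨y, h.mem_of_not_rel hr y.2⟩, by rw [sub_self]; exact zero_mem _⟩

theorem toPageHomology_surjective (p : ℤ) (q : κ) :
    Function.Surjective (h.toPageHomology p q) := by
  refine toHomology_surjective _ _ _ _ fun w hw => ?_
  obtain ⟨y, rfl⟩ := h.pageProj_surjective p q w
  obtain ⟨x, hx⟩ := h.exists_sub_mem_of_page_d_eq_zero p q y hw
  refine ⟨x, 0, ?_⟩
  rw [map_zero, add_zero]
  exact h.pageProj_eq_pageProj (by rwa [Submodule.coe_inclusion])

/-- The kernel of `Z^{p+1} → H(Eᵖ)` is the boundary module of the next page. If the class of `x` is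
hit by that of `b ∈ Zᵖ_{s+p}`, then `x = a + d(b' + b)` with `a ∈ F_{s-1}` and `b' ∈ F_{s+p-1}`.
Here `da = dx` is in `F_{s-p-1}`, which improves `a` from `Z^{p-1}_{s-1}` to `Zᵖ_{s-1}`. -/
theorem toPageHomology_eq_zero_iff (p : ℤ) (q : κ)
    (x : approxCycles C F (p + 1) (fil q) (deg q)) :
    h.toPageHomology p q x = 0 ↔
      (x : C.X (deg q)) ∈ approxBoundaries C F (p + 1) (fil q) (deg q) := by
  have hx' : (x : C.X (deg q)) ∈ approxCycles C F p (fil q) (deg q) :=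
    h.approxCycles_le le_rfl (by lia) _ x.2
  refine (toHomology_eq_zero_iff _ _ _ _ _).trans ?_
  have hxx : (h.pageProj p q ∘ₗ Submodule.inclusion (h.approxCycles_le le_rfl (by lia) (deg q))) x =
      h.pageProj p q ⟨x, hx'⟩ :=
    congrArg (h.pageProj p q) (Subtype.ext (Submodule.coe_inclusion _ _))
  rw [hxx]
  constructor
  · rintro ⟨y, hy⟩
    -- If no position precedes `q`, the incoming differential of the page is zero and `b = 0`
    -- serves, in an arbitrary degree.
    obtain ⟨i, b, hb, hxb⟩ : ∃ i, ∃ b ∈ approxCycles C F p (fil q + p) i,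
        (x : C.X (deg q)) - (C.d i (deg q)).hom b ∈ approxBoundaries C F p (fil q) (deg q) := by
      by_cases hr : (cs p).Rel ((cs p).prev q) q
      · obtain ⟨hc, hf⟩ := (h.rel_iff p _ _).1 hr
        obtain ⟨b, rfl⟩ := h.pageProj_surjective p _ y
        rw [h.page_d_proj_eq_iff p _ q hr] at hy
        refine ⟨_, b, by rw [← sub_eq_iff_eq_add.1 hf.symm]; exact b.2, ?_⟩
        rw [← neg_mem_iff, neg_sub]
        exact hy
      · rw [(h.page p).shape _ _ hr] at hy
        refine ⟨deg q, 0, zero_mem _, ?_⟩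
        rw [map_zero, sub_zero]
        exact (h.pageProj_eq_zero_iff p q ⟨x, hx'⟩).1 hy.symm
    by_cases hi : c.Rel i (deg q)
    · obtain ⟨a, ha, b', hb', hab⟩ := exists_of_mem_approxBoundaries i (c.prev_eq' hi) hxb
      have e : (x : C.X (deg q)) = a + (C.d i (deg q)).hom (b' + b) := by
        rw [map_add, ← add_assoc, ← hab, sub_add_cancel]
      rw [e]
      refine add_d_mem_approxBoundaries (mem_approxCycles.2 ⟨(mem_approxCycles.1 ha).1, fun j => ?_⟩)
        (add_mem (h.approxCycles_le (by lia) (by lia) _ hb')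
          (h.approxCycles_le (by lia) (by lia) _ hb))
      have : (C.d (deg q) j).hom a = (C.d (deg q) j).hom x := by
        rw [e, map_add, d_d_apply, add_zero]
      rw [this]
      exact h.mono _ (by lia) ((mem_approxCycles.1 x.2).2 j)
    · rw [C.shape _ _ hi] at hxb
      have hxb' : (x : C.X (deg q)) ∈ approxBoundaries C F p (fil q) (deg q) := by
        simpa using hxb
      obtain ⟨a, ha, b', hb', hab⟩ := exists_of_mem_approxBoundaries _ rfl hxb'
      rw [hab]
      refine add_d_mem_approxBoundaries (mem_approxCycles.2 ⟨(mem_approxCycles.1 ha).1, fun j => ?_⟩)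
        (h.approxCycles_le (by lia) (by lia) _ hb')
      have : (C.d (deg q) j).hom a = (C.d (deg q) j).hom x := by
        rw [hab, map_add, d_d_apply, add_zero]
      rw [this]
      exact h.mono _ (by lia) ((mem_approxCycles.1 x.2).2 j)
  · intro hx
    obtain ⟨a, ha, b, hb, hab⟩ := exists_of_mem_approxBoundaries _ rfl hx
    have ha' : a ∈ approxCycles C F (p - 1) (fil q - 1) (deg q) :=
      h.approxCycles_le (by lia) (by lia) _ ha
    by_cases hr : (cs p).Rel ((cs p).prev q) q
    · obtain ⟨hc, hf⟩ := (h.rel_iff p _ _).1 hr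
      obtain ⟨a, ha, b, hb, hab⟩ := exists_of_mem_approxBoundaries _ (c.prev_eq' hc) hx
      have ha' : a ∈ approxCycles C F (p - 1) (fil q - 1) (deg q) :=
        h.approxCycles_le (by lia) (by lia) _ ha
      have hb' : b ∈ approxCycles C F p (fil ((cs p).prev q)) (deg ((cs p).prev q)) :=
        h.approxCycles_le (by lia) (by lia) _ hb
      refine ⟨h.pageProj p _ ⟨b, hb'⟩, ?_⟩
      rw [h.page_d_proj_eq_iff p _ q hr, ← neg_mem_iff, neg_sub]
      have := add_d_mem_approxBoundaries ha' (i := deg q) (zero_mem _)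
      rw [map_zero, add_zero] at this
      change (x : C.X (deg q)) - (C.d _ _).hom b ∈ _
      rwa [hab, add_sub_cancel_right]
    -- Without a preceding position `F_{s+p} = F_{s+p-1}` in the preceding degree, so `b` is already
    -- a source of boundaries for the page `p`, and the class of `x` is zero there.
    · refine ⟨0, ?_⟩
      rw [map_zero, eq_comm, pageProj_eq_zero_iff]
      change (x : C.X (deg q)) ∈ _
      rw [hab]
      by_cases hi : c.Rel (c.prev (deg q)) (deg q)
      · refine add_d_mem_approxBoundaries ha' (mem_approxCycles.2 ⟨?_, fun j => ?_⟩)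
        · rw [← h.mem_of_not_rel_prev hr hi]
          exact h.mono _ (by lia) (mem_approxCycles.1 hb).1
        · exact h.mono _ (by lia) ((mem_approxCycles.1 hb).2 j)
      · rw [C.shape _ _ hi]
        have := add_d_mem_approxBoundaries ha' (i := deg q) (zero_mem _)
        rwa [map_zero] at this

theorem toPageHomology_eq_zero_iff_proj (p : ℤ) (q : κ)
    (x : approxCycles C F (p + 1) (fil q) (deg q)) :
    h.toPageHomology p q x = 0 ↔ h.pageProj (p + 1) q x = 0 := by
  rw [h.toPageHomology_eq_zero_iff p, pageProj_eq_zero_iff]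

/-- The identification of the homology of a page with the next page. -/
def pageIso (p : ℤ) (q : κ) : (h.page p).homology q ≅ (h.page (p + 1)).X q :=
  (quotientsEquiv (h.toPageHomology p q) (h.pageProj (p + 1) q) (h.toPageHomology_surjective p q)
    (h.pageProj_surjective (p + 1) q) (h.toPageHomology_eq_zero_iff_proj p q)).toModuleIso

/-- The spectral sequence of a filtered complex. -/
def spectralSequence : SpectralSequence (ModuleCat.{u} k) cs 1 where
  page p _ := h.page p
  iso p p' q hpp' hp := by
    subst hpp'
    exact h.pageIso p q

theorem spectralSequence_iso (p : ℤ) (hp : 1 ≤ p) (q : κ)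
    (x : approxCycles C F p (fil q) (deg q)) (y : approxCycles C F (p + 1) (fil q) (deg q))
    (z : (h.page p).cycles q) (hxy : (x : C.X (deg q)) = y)
    (hz : ((h.page p).iCycles q).hom z = h.pageProj p q x) :
    (h.spectralSequence.iso p (p + 1) q rfl hp).hom.hom (((h.page p).homologyπ q).hom z) =
      h.pageProj (p + 1) q y := by
  have h1 : ((h.page p).homologyπ q).hom z = h.toPageHomology p q y := by
    refine homologyπ_eq_toHomology _ _ _ _ _ _ (hz.trans ?_)
    exact congrArg (h.pageProj p q) (Subtype.ext (hxy.trans (Submodule.coe_inclusion _ _).symm))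
  rw [h1]
  exact quotientsEquiv_apply (h.toPageHomology p q) (h.pageProj (p + 1) q) _ _
    (h.toPageHomology_eq_zero_iff_proj p q) _

/-- The spectral sequence of a filtered complex is what its name says. -/
def isSpectralSequenceOf : IsSpectralSequenceOf C F h.spectralSequence deg fil where
  proj p _ q := h.pageProj p q
  proj_surjective p _ q := h.pageProj_surjective p q
  proj_eq_zero_iff p _ q x := h.pageProj_eq_zero_iff p q x
  d_proj p _ q q' hr x y hxy := h.page_d_proj p q q' hr x y hxy
  iso_proj p hp q x y z hxy hz := h.spectralSequence_iso p hp q x y z hxy hz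

/-! ### Convergence for bounded filtrations -/

section Convergence
variable {G : ι → ModuleCat.{u} k} (θ : ∀ n, C.homology n ≅ G n)

include h in
theorem homologyFil_mono (n : ι) : Monotone fun s => homologyFil C F s n := fun _ _ hs =>
  Submodule.map_mono (Submodule.comap_mono (h.mono n hs))

variable (F) in
/-- The filtration of `G` that corresponds to that of the homology. -/
abbrev abutmentFil (s : ℤ) (n : ι) : Submodule k (G n) :=
  Submodule.map (θ n).hom.hom (homologyFil C F s n)

variable {p : ℤ} {q : κ}

/-- The map from `Zᵖ`, if it consists of cycles, to the graded module of the abutment. -/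
def toAbutment (p : ℤ) (q : κ) (hd : ∀ x ∈ approxCycles C F p (fil q) (deg q),
      (C.d (deg q) (c.next (deg q))).hom x = 0) :
    approxCycles C F p (fil q) (deg q) →ₗ[k] abutmentFil F θ (fil q) (deg q) ⧸
      (abutmentFil F θ (fil q - 1) (deg q)).submoduleOf (abutmentFil F θ (fil q) (deg q)) :=
  Submodule.mkQ _ ∘ₗ LinearMap.codRestrict _
    ((θ (deg q)).hom.hom ∘ₗ toHomology C (deg q) (approxCycles C F p (fil q) (deg q)).subtype
      fun x => hd x x.2) fun x => by
        obtain ⟨z, h1, h2⟩ := exists_cycle C (deg q)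
          (approxCycles C F p (fil q) (deg q)).subtype (fun x => hd x x.2) x
        refine ⟨_, ⟨z, ?_, rfl⟩, congrArg _ h2⟩
        change (C.iCycles (deg q)).hom z ∈ F (fil q) (deg q)
        rw [h1]
        exact (mem_approxCycles.1 x.2).1

theorem toAbutment_surjective (hd : ∀ x ∈ approxCycles C F p (fil q) (deg q),
      (C.d (deg q) (c.next (deg q))).hom x = 0) :
    Function.Surjective (toAbutment θ p q hd) := by
  intro w
  obtain ⟨⟨_, _, ⟨z, hz, rfl⟩, rfl⟩, rfl⟩ := Submodule.mkQ_surjective _ w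
  refine ⟨⟨(C.iCycles (deg q)).hom z, mem_approxCycles.2 ⟨hz, fun j => ?_⟩⟩, ?_⟩
  · rw [d_iCycles]; exact zero_mem _
  · refine congrArg (Submodule.mkQ _) (Subtype.ext (congrArg (θ (deg q)).hom.hom ?_))
    exact (homologyπ_eq_toHomology C (deg q) (approxCycles C F p (fil q) (deg q)).subtype _ _ z
      rfl).symm

include h in
-- The class of `x` lies in step `s - 1` exactly when `x = z' + dy` with a cycle `z' ∈ F_{s-1}`.
-- Once `F_{s+p-1}` is everything one degree before, `y` automatically lies in `Z^{p-1}_{s+p-1}`,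
-- because `dy = x - z' ∈ F_s`. Once `F_{s-p}` is zero one degree after, every element of
-- `Z^{p-1}_{s-1}` is a true cycle.
theorem toAbutment_eq_zero_iff (hd : ∀ x ∈ approxCycles C F p (fil q) (deg q),
      (C.d (deg q) (c.next (deg q))).hom x = 0) (ht : F (fil q + p - 1) (c.prev (deg q)) = ⊤)
    (hb : F (fil q - p) (c.next (deg q)) = ⊥) (x : approxCycles C F p (fil q) (deg q)) :
    toAbutment θ p q hd x = 0 ↔
      (x : C.X (deg q)) ∈ approxBoundaries C F p (fil q) (deg q) := by
  have hd0 : ∀ a : C.X (deg q), (C.d (deg q) (c.next (deg q))).hom a = 0 →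
      ∀ j, (C.d (deg q) j).hom a = 0 := fun a ha j => by
    by_cases hj : c.Rel (deg q) j
    · obtain rfl := c.next_eq' hj; exact ha
    · rw [C.shape _ _ hj]; rfl
  rw [toAbutment, LinearMap.comp_apply, Submodule.mkQ_apply, Submodule.Quotient.mk_eq_zero]
  obtain ⟨z, h1, h2⟩ := exists_cycle C (deg q)
    (approxCycles C F p (fil q) (deg q)).subtype (fun x => hd x x.2) x
  have hinj : Function.Injective (θ (deg q)).hom.hom :=
    (ModuleCat.mono_iff_injective (θ (deg q)).hom).1 inferInstance
  have key : ∀ w : C.homology (deg q), (θ (deg q)).hom.hom w ∈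
      abutmentFil F θ (fil q - 1) (deg q) ↔ w ∈ homologyFil C F (fil q - 1) (deg q) := fun w =>
    ⟨fun ⟨w', hw', e⟩ => hinj e ▸ hw', fun hw => ⟨w, hw, rfl⟩⟩
  refine (key _).trans ?_
  rw [← h2]
  constructor
  · rintro ⟨z', hz', e⟩
    rw [eq_comm, ← sub_eq_zero, ← map_sub, homologyπ_eq_zero_iff] at e
    obtain ⟨y, hy⟩ := e
    have e2 : (x : C.X (deg q)) = (C.iCycles _).hom z' + (C.d (c.prev (deg q)) (deg q)).hom y := by
      rw [hy, map_sub, h1, add_sub_cancel]; rfl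
    have hz2 : (C.iCycles _).hom z' ∈ approxCycles C F (p - 1) (fil q - 1) (deg q) :=
      mem_approxCycles.2 ⟨hz', fun j => by rw [d_iCycles]; exact zero_mem _⟩
    rw [e2]
    by_cases hq : c.Rel (c.prev (deg q)) (deg q)
    · refine add_d_mem_approxBoundaries hz2 (mem_approxCycles.2 ⟨by rw [ht]; trivial, fun j => ?_⟩)
      by_cases hj : c.Rel (c.prev (deg q)) j
      · obtain rfl := c.next_eq hj hq
        have : (C.d (c.prev (deg q)) (deg q)).hom y ∈ F (fil q) (deg q) := by
          rw [hy, map_sub]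
          exact sub_mem (by rw [h1]; exact (mem_approxCycles.1 x.2).1) (h.mono _ (by lia) hz')
        exact h.mono _ (by lia) this
      · rw [C.shape _ _ hj]; exact zero_mem _
    · have := add_d_mem_approxBoundaries hz2 (i := deg q) (zero_mem _)
      rw [map_zero] at this
      rwa [C.shape _ _ hq]
  · intro hx
    obtain ⟨a, ha, b, hb', e⟩ := exists_of_mem_approxBoundaries _ rfl hx
    have hda : (C.d (deg q) (c.next (deg q))).hom a = 0 := by
      have := (mem_approxCycles.1 ha).2 (c.next (deg q))
      rw [show fil q - 1 - (p - 1) = fil q - p by ring, hb] at this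
      exact this
    -- `exists_cycle` is about linear maps into the cycles, so the single element `a` is replaced by
    -- the inclusion of its span.
    obtain ⟨z', h3, -⟩ := exists_cycle C (deg q) (Submodule.span k {a}).subtype (fun x => by
      obtain ⟨r, hr⟩ := Submodule.mem_span_singleton.1 x.2
      rw [Submodule.subtype_apply, ← hr, map_smul, hda, smul_zero])
      ⟨a, Submodule.mem_span_singleton_self a⟩
    refine ⟨z', ?_, ?_⟩
    · change (C.iCycles (deg q)).hom z' ∈ F (fil q - 1) (deg q)
      rw [h3]
      exact (mem_approxCycles.1 ha).1
    · rw [← sub_eq_zero, ← map_sub, homologyπ_eq_zero_iff]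
      refine ⟨-b, ?_⟩
      rw [map_sub, h3, h1, map_neg]
      change _ = a - (x : C.X (deg q))
      rw [e]
      abel

include h in
theorem eventually_stationary (q : κ) : ∃ p₀ : ℤ, 1 ≤ p₀ ∧ ∀ p, p₀ ≤ p →
    F (fil q + p - 1) (c.prev (deg q)) = ⊤ ∧ F (fil q - p) (c.next (deg q)) = ⊥ := by
  obtain ⟨a, ha⟩ := h.bot (c.next (deg q))
  obtain ⟨b, hb⟩ := h.top (c.prev (deg q))
  -- The second entry forces `s - p ≤ a`, where the filtration is zero; the third forces `b ≤ s + p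
  -- - 1`, where it is everything.
  refine ⟨max 1 (max (fil q - a) (b - fil q + 1)), le_max_left _ _, fun p hp => ⟨?_, ?_⟩⟩
  · exact top_le_iff.1 (hb.ge.trans (h.mono _ (by lia)))
  · exact le_bot_iff.1 ((h.mono _ (by lia)).trans ha.le)

theorem page_d_eq_zero (hb : F (fil q - p) (c.next (deg q)) = ⊥) (q' : κ) :
    (h.page p).d q q' = 0 := by
  by_cases hr : (cs p).Rel q q'
  · obtain ⟨hc, hf⟩ := (h.rel_iff p _ _).1 hr
    ext w
    obtain ⟨x, rfl⟩ := h.pageProj_surjective p q w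
    have h1 := (h.page_d_proj_eq_iff p q q' hr x 0).2 (by
      have h2 := (mem_approxCycles.1 x.2).2 (deg q')
      rw [c.next_eq' hc] at hb
      rw [hb] at h2
      rw [(Submodule.mem_bot k).1 h2, ZeroMemClass.coe_zero, sub_zero]
      exact zero_mem _)
    rw [map_zero] at h1
    exact h1
  · exact (h.page p).shape _ _ hr

/-- The source position has filtration degree `s + p`, and everything there lies one step lower
already, so the source term of the page is zero. -/
theorem page_d_prev_eq_zero (ht : F (fil q + p - 1) (c.prev (deg q)) = ⊤) (q' : κ) :
    (h.page p).d q' q = 0 := by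
  by_cases hr : (cs p).Rel q' q
  · obtain ⟨hc, hf⟩ := (h.rel_iff p _ _).1 hr
    ext w
    obtain ⟨x, rfl⟩ := h.pageProj_surjective p q' w
    have h1 : h.pageProj p q' x = 0 := by
      rw [c.prev_eq' hc] at ht
      have h2 : (x : C.X (deg q')) ∈ approxCycles C F (p - 1) (fil q' - 1) (deg q') :=
        mem_approxCycles.2 ⟨by
          rw [show fil q' - 1 = fil q + p - 1 by lia, ht]; trivial,
          fun j => h.mono _ (by lia) ((mem_approxCycles.1 x.2).2 j)⟩
      have h3 := add_d_mem_approxBoundaries h2 (i := deg q') (zero_mem _)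
      rw [map_zero, add_zero] at h3
      exact (h.pageProj_eq_zero_iff p q' x).2 h3
    rw [h1, map_zero, map_zero]
  · exact (h.page p).shape _ _ hr

theorem d_eq_zero_of_mem_approxCycles (hb : F (fil q - p) (c.next (deg q)) = ⊥) :
    ∀ x ∈ approxCycles C F p (fil q) (deg q), (C.d (deg q) (c.next (deg q))).hom x = 0 :=
  fun x hx => by
    have h2 := (mem_approxCycles.1 hx).2 (c.next (deg q))
    rw [hb] at h2
    exact (Submodule.mem_bot k).1 h2

/-- The identification of a stationary page with the graded module of the abutment. -/
def pageEquivAbutment (p : ℤ) (q : κ) (ht : F (fil q + p - 1) (c.prev (deg q)) = ⊤)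
    (hb : F (fil q - p) (c.next (deg q)) = ⊥) :
    (h.page p).X q ≃ₗ[k] abutmentFil F θ (fil q) (deg q) ⧸
      (abutmentFil F θ (fil q - 1) (deg q)).submoduleOf (abutmentFil F θ (fil q) (deg q)) :=
  quotientsEquiv (h.pageProj p q) (toAbutment θ p q (d_eq_zero_of_mem_approxCycles hb))
    (h.pageProj_surjective p q) (toAbutment_surjective θ _) fun x => by
      rw [pageProj_eq_zero_iff, h.toAbutment_eq_zero_iff θ _ ht hb]

theorem pageEquivAbutment_proj (p : ℤ) (q : κ) (ht : F (fil q + p - 1) (c.prev (deg q)) = ⊤)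
    (hb : F (fil q - p) (c.next (deg q)) = ⊥) (x : approxCycles C F p (fil q) (deg q)) :
    h.pageEquivAbutment θ p q ht hb (h.pageProj p q x) =
      toAbutment θ p q (d_eq_zero_of_mem_approxCycles hb) x :=
  quotientsEquiv_apply _ _ _ _ _ _

/-- On a stationary page a representative in `Zᵖ` is a true cycle, hence in `Z^{p+1}` as well, and
the same element computes both sides. -/
theorem pageEquivAbutment_iso (p : ℤ) (hp : 1 ≤ p) (q : κ)
    (ht : F (fil q + p - 1) (c.prev (deg q)) = ⊤) (hb : F (fil q - p) (c.next (deg q)) = ⊥)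
    (ht' : F (fil q + (p + 1) - 1) (c.prev (deg q)) = ⊤)
    (hb' : F (fil q - (p + 1)) (c.next (deg q)) = ⊥) (z : (h.page p).cycles q) :
    h.pageEquivAbutment θ (p + 1) q ht' hb' ((h.spectralSequence.iso p (p + 1) q rfl hp).hom.hom
      (((h.page p).homologyπ q).hom z)) =
    h.pageEquivAbutment θ p q ht hb (((h.page p).iCycles q).hom z) := by
  obtain ⟨x, hx⟩ := h.pageProj_surjective p q (((h.page p).iCycles q).hom z)
  have hx0 := d_eq_zero_of_mem_approxCycles hb x x.2
  have hx' : (x : C.X (deg q)) ∈ approxCycles C F (p + 1) (fil q) (deg q) :=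
    mem_approxCycles.2 ⟨(mem_approxCycles.1 x.2).1, fun j => by
      by_cases hj : c.Rel (deg q) j
      · obtain rfl := c.next_eq' hj
        rw [hx0]; exact zero_mem _
      · rw [C.shape _ _ hj]; exact zero_mem _⟩
  rw [h.spectralSequence_iso p hp q x ⟨x, hx'⟩ z rfl hx.symm, ← hx, pageEquivAbutment_proj,
    pageEquivAbutment_proj]
  refine congrArg (Submodule.mkQ _) (Subtype.ext (congrArg (θ (deg q)).hom.hom ?_))
  obtain ⟨z', h1, h2⟩ := exists_cycle C (deg q) (approxCycles C F p (fil q) (deg q)).subtype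
    (fun x => d_eq_zero_of_mem_approxCycles hb x x.2) x
  refine (homologyπ_eq_toHomology C (deg q) _ _ _ z' ?_).symm.trans h2
  rw [h1]
  rfl

/-- The spectral sequence of a bounded filtered complex converges to the homology. -/
theorem converges : Converges h.spectralSequence deg fil G (abutmentFil F θ) where
  mono n _ _ hs := Submodule.map_mono (h.homologyFil_mono n hs)
  bot n := by
    obtain ⟨s, hs⟩ := h.bot n
    refine ⟨s, ?_⟩
    have : homologyFil C F s n = ⊥ := by
      rw [homologyFil, hs, Submodule.comap_bot, LinearMap.ker_eq_bot.2 (iCycles_injective C n),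
        Submodule.map_bot]
    rw [abutmentFil, this, Submodule.map_bot]
  top n := by
    obtain ⟨s, hs⟩ := h.top n
    refine ⟨s, ?_⟩
    have : homologyFil C F s n = ⊤ := by
      rw [homologyFil, hs, Submodule.comap_top, Submodule.map_top,
        LinearMap.range_eq_top.2 (homologyπ_surjective C n)]
    rw [abutmentFil, this, Submodule.map_top, LinearMap.range_eq_top]
    exact (ModuleCat.epi_iff_surjective (θ n).hom).1 inferInstance
  jump n s hq := by
    rw [abutmentFil, abutmentFil, homologyFil, homologyFil, h.jump n s hq]
  abutment q := by
    obtain ⟨p₀, hp₀, hp⟩ := h.eventually_stationary q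
    refine ⟨p₀, hp₀, fun p hpp => h.pageEquivAbutment θ p q (hp p hpp).1 (hp p hpp).2, ?_, ?_⟩
    · exact fun p hpp q' => ⟨h.page_d_eq_zero (hp p hpp).2 q',
        h.page_d_prev_eq_zero (hp p hpp).1 q'⟩
    · exact fun p hpp z => h.pageEquivAbutment_iso θ p (hp₀.trans hpp) q _ _ _ _ z

end Convergence
end IsFiltration
end Filtered

/-! ### Bimodules `B ⊗ V ⊗ B`, and the comparison of split resolutions by them -/

section FreeBimodules
variable {k : Type u} [CommRing k] {B : Type u} [Ring B] [Algebra k B]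
  {U V W : Type u} [AddCommGroup U] [Module k U] [AddCommGroup V] [Module k V] [AddCommGroup W]
  [Module k W]

variable (k B V) in
/-- `v ↦ 1 ⊗ v ⊗ 1`. -/
def Bim.unit : V →ₗ[k] Bim k B V := TensorProduct.mk k B _ 1 ∘ₗ (TensorProduct.mk k V B).flip 1

@[simp] theorem Bim.unit_apply (v : V) : Bim.unit k B V v = 1 ⊗ₜ (v ⊗ₜ 1) := rfl

theorem Bim.hom_ext {X : Type u} [AddCommGroup X] [Module k X] {f g : Bim k B V →ₗ[k] X}
    (h : ∀ b v c, f (b ⊗ₜ (v ⊗ₜ c)) = g (b ⊗ₜ (v ⊗ₜ c))) : f = g :=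
  TensorProduct.ext' fun b y => by
    induction y using TensorProduct.induction_on with
    | zero => simp only [TensorProduct.tmul_zero, map_zero]
    | tmul v c => exact h b v c
    | add y z hy hz => simp only [TensorProduct.tmul_add, map_add, hy, hz]

theorem sandwich_sandwich (b c b' c' : B) (x : Bim k B V) :
    sandwich (k := k) b c (sandwich b' c' x) = sandwich (k := k) (b * b') (c' * c) x := by
  induction x using Bim.induction with
  | zero => simp only [map_zero]
  | add x y hx hy => simp only [map_add, hx, hy]
  | tmul d v e => simp [mul_assoc]

theorem sandwich_one_one (x : Bim k B V) : sandwich (k := k) (1 : B) 1 x = x := by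
  induction x using Bim.induction with
  | zero => simp only [map_zero]
  | add x y hx hy => simp only [map_add, hx, hy]
  | tmul d v e => simp

theorem extend_sandwich (g : V →ₗ[k] Bim k B W) (b c : B) (x : Bim k B V) :
    extend g (sandwich (k := k) b c x) = sandwich (k := k) b c (extend g x) := by
  induction x using Bim.induction with
  | zero => simp only [map_zero]
  | add x y hx hy => simp only [map_add, hx, hy]
  | tmul d v e => rw [sandwich_tmul, extend_tmul, extend_tmul, sandwich_sandwich]

theorem extend_comp_extend (f : V →ₗ[k] Bim k B W) (g : U →ₗ[k] Bim k B V) :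
    extend f ∘ₗ extend g = extend (extend f ∘ₗ g) :=
  Bim.hom_ext fun b u c => by
    rw [LinearMap.comp_apply, extend_tmul, extend_tmul, extend_sandwich, LinearMap.comp_apply]

theorem extend_extend (f : V →ₗ[k] Bim k B W) (g : U →ₗ[k] Bim k B V) (x : Bim k B U) :
    extend f (extend g x) = extend (extend f ∘ₗ g) x :=
  LinearMap.congr_fun (extend_comp_extend f g) x

@[simp] theorem extend_unit (g : V →ₗ[k] Bim k B W) (v : V) : extend g (Bim.unit k B V v) = g v := by
  rw [Bim.unit_apply, extend_tmul, sandwich_one_one]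

theorem extend_comp_unit (g : V →ₗ[k] Bim k B W) : extend g ∘ₗ Bim.unit k B V = g :=
  LinearMap.ext fun v => extend_unit g v

theorem extend_of_unit : extend (Bim.unit k B V) = LinearMap.id :=
  Bim.hom_ext fun b v c => by simp

variable (k B V W) in
/-- `g ↦ extend g`, as a linear map. -/
def extendₗ : (V →ₗ[k] Bim k B W) →ₗ[k] Bim k B V →ₗ[k] Bim k B W where
  toFun := extend
  map_add' f g := Bim.hom_ext fun b v c => by simp
  map_smul' r f := Bim.hom_ext fun b v c => by simp

theorem extend_sub (f g : V →ₗ[k] Bim k B W) : extend (f - g) = extend f - extend g :=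
  map_sub (extendₗ k B V W) f g

theorem extend_zero : extend (0 : V →ₗ[k] Bim k B W) = 0 := (extendₗ k B V W).map_zero

theorem extend_sum {ι : Type*} (t : Finset ι) (f : ι → V →ₗ[k] Bim k B W) :
    extend (∑ i ∈ t, f i) = ∑ i ∈ t, extend (f i) := map_sum (extendₗ k B V W) f t

variable (N : Type u) [AddCommGroup N] [Module k N] [Module B N] [Module Bᵐᵒᵖ N]
  [IsScalarTower k B N] [IsScalarTower k Bᵐᵒᵖ N] [SMulCommClass B Bᵐᵒᵖ N]

variable (k B V W) in
/-- `g ↦ chainMap N g`, as a linear map. -/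
def chainMapₗ : (V →ₗ[k] Bim k B W) →ₗ[k] N ⊗[k] V →ₗ[k] N ⊗[k] W where
  toFun := chainMap N
  map_add' f g := TensorProduct.ext' fun m v => by simp
  map_smul' r f := TensorProduct.ext' fun m v => by simp

variable (k B V W) in
/-- `g ↦ cochainMap N g`, as a linear map. -/
def cochainMapₗ : (V →ₗ[k] Bim k B W) →ₗ[k] (W →ₗ[k] N) →ₗ[k] (V →ₗ[k] N) where
  toFun := cochainMap N
  map_add' f g := LinearMap.ext₂ fun φ v => by simp
  map_smul' r f := LinearMap.ext₂ fun φ v => by simp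

theorem chainMap_unit : chainMap N (Bim.unit k B V) = LinearMap.id :=
  TensorProduct.ext' fun m v => by simp

theorem cochainMap_unit : cochainMap N (Bim.unit k B V) = LinearMap.id :=
  LinearMap.ext₂ fun φ v => by simp

theorem evaluate_sandwich (φ : V →ₗ[k] N) (b c : B) (x : Bim k B V) :
    evaluate N φ (sandwich (k := k) b c x) = b • MulOpposite.op c • evaluate N φ x := by
  induction x using Bim.induction with
  | zero => simp only [map_zero, smul_zero]
  | add x y hx hy => simp only [map_add, smul_add, hx, hy]
  | tmul d v e =>
    rw [sandwich_tmul, evaluate_tmul, evaluate_tmul, mul_smul, MulOpposite.op_mul, mul_smul,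
      smul_comm d]

/-- Both sides are bimodule maps with the same values on generators. With `N = B` this composes an
augmentation with a morphism of resolutions. -/
theorem evaluate_extend (φ : W →ₗ[k] N) (g : V →ₗ[k] Bim k B W) (x : Bim k B V) :
    evaluate N φ (extend g x) = evaluate N (evaluate N φ ∘ₗ g) x := by
  induction x using Bim.induction with
  | zero => simp only [map_zero]
  | add x y hx hy => simp only [map_add, hx, hy]
  | tmul b v c => rw [extend_tmul, evaluate_sandwich, evaluate_tmul, LinearMap.comp_apply]

end FreeBimodules

/-- A resolution of the `B`-bimodule `B` by free bimodules `B ⊗ Vₙ ⊗ B`, with a `k`-linear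
contracting homotopy. -/
structure SplitResolution (k B : Type u) [CommRing k] [Ring B] [Algebra k B] where
  /-- the generators -/
  V : ℕ → Type u
  [addCommGroup : ∀ n, AddCommGroup (V n)]
  [module : ∀ n, Module k (V n)]
  /-- the differential, on generators -/
  d : ∀ n, V (n + 1) →ₗ[k] Bim k B (V n)
  /-- the augmentation, on generators -/
  aug : V 0 →ₗ[k] B
  /-- the contracting homotopy in degree `-1` -/
  init : B →ₗ[k] Bim k B (V 0)
  /-- the contracting homotopy -/
  s : ∀ n, Bim k B (V n) →ₗ[k] Bim k B (V (n + 1))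
  d_d : ∀ n x, extend (d n) (d (n + 1) x) = 0
  aug_d : ∀ x, evaluate B aug (d 0 x) = 0
  aug_init : ∀ b, evaluate B aug (init b) = b
  d_s_zero : ∀ x, extend (d 0) (s 0 x) = x - init (evaluate B aug x)
  d_s : ∀ n x, extend (d (n + 1)) (s (n + 1) x) = x - s n (extend (d n) x)

namespace SplitResolution
attribute [instance] addCommGroup module
variable {k B : Type u} [CommRing k] [Ring B] [Algebra k B] (R R' R'' : SplitResolution k B)

/-- The comparison of two resolutions, on generators. -/
def compare : ∀ n, R.V n →ₗ[k] Bim k B (R'.V n)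
  | 0 => R'.init ∘ₗ R.aug
  | n + 1 => R'.s n ∘ₗ extend (compare n) ∘ₗ R.d n

theorem aug_compare : evaluate B R'.aug ∘ₗ R.compare R' 0 = R.aug :=
  LinearMap.ext fun _ => R'.aug_init _

/-- Apply `ds = 1 - sd` to the recursive definition. The error is `s` applied to `d f_n d = f_{n-1}
d d = 0`; in degree `0` the augmentation takes the place of the differential. -/
theorem compare_comm (n : ℕ) :
    extend (R'.d n) ∘ₗ R.compare R' (n + 1) = extend (R.compare R' n) ∘ₗ R.d n := by
  induction n with
  | zero =>
    refine LinearMap.ext fun x => ?_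
    simp only [compare, LinearMap.comp_apply]
    rw [R'.d_s_zero, evaluate_extend, ← compare, aug_compare, R.aug_d, map_zero, sub_zero]
  | succ n ih =>
    refine LinearMap.ext fun x => ?_
    simp only [LinearMap.comp_apply]
    rw [compare]
    simp only [LinearMap.comp_apply]
    rw [R'.d_s, extend_extend _ (R.compare R' (n + 1)), ih, ← extend_extend, R.d_d, map_zero,
      map_zero, sub_zero]

section Homotopy
variable {R R'} (f g : ∀ n, R.V n →ₗ[k] Bim k B (R'.V n))

/-- A homotopy between two morphisms of resolutions. -/
def homotopy : ∀ n, R.V n →ₗ[k] Bim k B (R'.V (n + 1))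
  | 0 => R'.s 0 ∘ₗ (f 0 - g 0)
  | n + 1 => R'.s (n + 1) ∘ₗ (f (n + 1) - g (n + 1) - extend (homotopy n) ∘ₗ R.d n)

variable {f g}
variable (haug : evaluate B R'.aug ∘ₗ f 0 = evaluate B R'.aug ∘ₗ g 0)
  (hf : ∀ n, extend (R'.d n) ∘ₗ f (n + 1) = extend (f n) ∘ₗ R.d n)
  (hg : ∀ n, extend (R'.d n) ∘ₗ g (n + 1) = extend (g n) ∘ₗ R.d n)
include haug

theorem homotopy_zero : extend (R'.d 0) ∘ₗ homotopy f g 0 = f 0 - g 0 := by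
  refine LinearMap.ext fun x => ?_
  have := LinearMap.congr_fun haug x
  simp only [LinearMap.comp_apply] at this
  simp only [homotopy, LinearMap.comp_apply, R'.d_s_zero, LinearMap.sub_apply, map_sub, this]
  simp

include hf hg

/-- The map `f - g - hd` takes values in cycles, by the homotopy relation one degree below, and `s`
lifts cycles along `d`. -/
theorem homotopy_succ (n : ℕ) : extend (R'.d (n + 1)) ∘ₗ homotopy f g (n + 1) =
    f (n + 1) - g (n + 1) - extend (homotopy f g n) ∘ₗ R.d n := by
  have key : ∀ x, extend (R'.d n) (f (n + 1) x - g (n + 1) x -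
      extend (homotopy f g n) (R.d n x)) = 0 := by
    intro x
    have h1 := LinearMap.congr_fun (hf n) x
    have h2 := LinearMap.congr_fun (hg n) x
    simp only [LinearMap.comp_apply] at h1 h2
    rw [map_sub, map_sub, h1, h2, extend_extend]
    cases n with
    | zero =>
      rw [homotopy_zero haug, extend_sub, LinearMap.sub_apply, sub_self]
    | succ n =>
      rw [homotopy_succ n, extend_sub, extend_sub, ← extend_comp_extend]
      simp only [LinearMap.sub_apply, LinearMap.comp_apply, R.d_d, map_zero, sub_zero, sub_self]
  refine LinearMap.ext fun x => ?_
  rw [homotopy]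
  simp only [LinearMap.comp_apply, LinearMap.sub_apply]
  rw [R'.d_s, key, map_zero, sub_zero]

end Homotopy

/-- The composition of the two comparisons of two resolutions. -/
def roundTrip (n : ℕ) : R.V n →ₗ[k] Bim k B (R.V n) :=
  extend (R'.compare R n) ∘ₗ R.compare R' n

theorem roundTrip_comm (n : ℕ) :
    extend (R.d n) ∘ₗ R.roundTrip R' (n + 1) = extend (R.roundTrip R' n) ∘ₗ R.d n := by
  rw [roundTrip, roundTrip, ← LinearMap.comp_assoc, extend_comp_extend, compare_comm,
    ← extend_comp_extend, LinearMap.comp_assoc, compare_comm, ← LinearMap.comp_assoc,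
    extend_comp_extend]

/-- Both comparisons respect the augmentations; this is the input of the uniqueness up to homotopy
applied to the round trip and the identity. -/
theorem aug_roundTrip : evaluate B R.aug ∘ₗ R.roundTrip R' 0 =
    evaluate B R.aug ∘ₗ Bim.unit k B (R.V 0) := by
  refine LinearMap.ext fun x => ?_
  simp only [LinearMap.comp_apply, roundTrip]
  rw [evaluate_extend, aug_compare, ← LinearMap.comp_apply, aug_compare, Bim.unit_apply,
    evaluate_tmul]
  simp

theorem unit_comm (n : ℕ) : extend (R.d n) ∘ₗ Bim.unit k B (R.V (n + 1)) =
    extend (Bim.unit k B (R.V n)) ∘ₗ R.d n := by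
  rw [extend_comp_unit, extend_of_unit, LinearMap.id_comp]

/-- The homotopy between the composition of the two comparisons and the identity. -/
def loop (n : ℕ) : R.V n →ₗ[k] Bim k B (R.V (n + 1)) :=
  homotopy (R := R) (R' := R) (R.roundTrip R') (fun n => Bim.unit k B (R.V n)) n

theorem roundTrip_zero : R.roundTrip R' 0 = Bim.unit k B (R.V 0) +
    extend (R.d 0) ∘ₗ R.loop R' 0 := by
  rw [loop, homotopy_zero (R.aug_roundTrip R')]
  abel

theorem roundTrip_succ (n : ℕ) : R.roundTrip R' (n + 1) = Bim.unit k B (R.V (n + 1)) +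
    extend (R.d (n + 1)) ∘ₗ R.loop R' (n + 1) + extend (R.loop R' n) ∘ₗ R.d n := by
  rw [loop, homotopy_succ (R.aug_roundTrip R') (R.roundTrip_comm R') R.unit_comm, loop]
  abel

section Complexes
variable (N : Type u) [AddCommGroup N] [Module k N] [Module B N] [Module Bᵐᵒᵖ N]
  [IsScalarTower k B N] [IsScalarTower k Bᵐᵒᵖ N] [SMulCommClass B Bᵐᵒᵖ N]

theorem extend_d_comp_d (n : ℕ) : extend (R.d n) ∘ₗ R.d (n + 1) = 0 :=
  LinearMap.ext fun x => R.d_d n x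

/-- The complex `N ⊗ V_*`. -/
def chain : ChainComplex (ModuleCat.{u} k) ℕ :=
  ChainComplex.of (fun n => ModuleCat.of k (N ⊗[k] R.V n))
    (fun n => ModuleCat.ofHom (chainMap N (R.d n)))
    (fun n => by
      rw [← ModuleCat.ofHom_comp, chainMap_comp, extend_d_comp_d]
      ext; simp [chainMap])

/-- The complex `Hom_k(V_*, N)`. -/
def cochain : CochainComplex (ModuleCat.{u} k) ℕ :=
  CochainComplex.of (fun n => ModuleCat.of k (R.V n →ₗ[k] N))
    (fun n => ModuleCat.ofHom (cochainMap N (R.d n)))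
    (fun n => by
      rw [← ModuleCat.ofHom_comp, cochainMap_comp, extend_d_comp_d]
      ext; simp [cochainMap])

theorem chain_d (n : ℕ) :
    (R.chain N).d (n + 1) n = ModuleCat.ofHom (chainMap N (R.d n)) :=
  ChainComplex.of_d (fun n => ModuleCat.of k (N ⊗[k] R.V n))
    (fun n => ModuleCat.ofHom (chainMap N (R.d n))) n

theorem cochain_d (n : ℕ) :
    (R.cochain N).d n (n + 1) = ModuleCat.ofHom (cochainMap N (R.d n)) :=
  CochainComplex.of_d (fun n => ModuleCat.of k (R.V n →ₗ[k] N))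
    (fun n => ModuleCat.ofHom (cochainMap N (R.d n))) n

theorem chain_d_apply (n : ℕ) (x : N ⊗[k] R.V (n + 1)) :
    ((R.chain N).d (n + 1) n).hom x = chainMap N (R.d n) x :=
  congrArg (fun f => f.hom x) (R.chain_d N n)

theorem cochain_d_apply (n : ℕ) (x : R.V n →ₗ[k] N) :
    ((R.cochain N).d n (n + 1)).hom x = cochainMap N (R.d n) x :=
  congrArg (fun f => f.hom x) (R.cochain_d N n)

theorem chainMap_add (N : Type u) [AddCommGroup N] [Module k N] [Module B N] [Module Bᵐᵒᵖ N]
    [IsScalarTower k B N] [IsScalarTower k Bᵐᵒᵖ N] [SMulCommClass B Bᵐᵒᵖ N]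
    {V W : Type u} [AddCommGroup V] [Module k V] [AddCommGroup W] [Module k W]
    (f g : V →ₗ[k] Bim k B W) : chainMap N (f + g) = chainMap N f + chainMap N g :=
  (chainMapₗ k B V W N).map_add f g

theorem cochainMap_add (N : Type u) [AddCommGroup N] [Module k N] [Module B N] [Module Bᵐᵒᵖ N]
    [IsScalarTower k B N] [IsScalarTower k Bᵐᵒᵖ N] [SMulCommClass B Bᵐᵒᵖ N]
    {V W : Type u} [AddCommGroup V] [Module k V] [AddCommGroup W] [Module k W]
    (f g : V →ₗ[k] Bim k B W) : cochainMap N (f + g) = cochainMap N f + cochainMap N g :=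
  (cochainMapₗ k B V W N).map_add f g

/-- The map of complexes `N ⊗ V_* → N ⊗ V'_*` induced by the comparison. -/
def chainCompare : R.chain N ⟶ R'.chain N where
  f n := ModuleCat.ofHom (chainMap N (R.compare R' n))
  comm' i j hij := by
    obtain rfl : j + 1 = i := hij
    refine ModuleCat.hom_ext (LinearMap.ext fun x => ?_)
    have h := LinearMap.congr_fun (congrArg (chainMap N) (R.compare_comm R' j)) x
    rw [← chainMap_comp, ← chainMap_comp] at h
    refine (R'.chain_d_apply N j _).trans (h.trans ?_)
    exact congrArg (chainMap N (R.compare R' j)) (R.chain_d_apply N j x).symm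

/-- The map of complexes `Hom(V'_*, N) → Hom(V_*, N)` induced by the comparison. -/
def cochainCompare : R'.cochain N ⟶ R.cochain N where
  f n := ModuleCat.ofHom (cochainMap N (R.compare R' n))
  comm' i j hij := by
    obtain rfl : i + 1 = j := hij
    refine ModuleCat.hom_ext (LinearMap.ext fun x => ?_)
    have h := LinearMap.congr_fun (congrArg (cochainMap N) (R.compare_comm R' i)) x
    rw [← cochainMap_comp, ← cochainMap_comp] at h
    refine (R.cochain_d_apply N i _).trans (h.symm.trans ?_)
    exact congrArg (cochainMap N (R.compare R' (i + 1))) (R'.cochain_d_apply N i x).symm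

/-- It suffices that `φ - 1` sends cycles to boundaries. The preceding degree is a free variable
tied to `c.prev q`, so that a numeral such as `n + 1` can be supplied without transport. -/
theorem homologyMap_eq_id {ι : Type} {c : ComplexShape ι}
    {K : HomologicalComplex (ModuleCat.{u} k) c} (φ : K ⟶ K) (q : ι)
    (h : ∀ x : K.X q, (∀ j, (K.d q j).hom x = 0) →
      ∃ i, c.prev q = i ∧ ∃ y : K.X i, (K.d i q).hom y = (φ.f q).hom x - x) :
    HomologicalComplex.homologyMap φ q = 𝟙 _ := by
  rw [← cancel_epi (K.homologyπ q), HomologicalComplex.homologyπ_naturality, Category.comp_id]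
  ext z
  rw [ModuleCat.comp_apply, ← sub_eq_zero]
  change (K.homologyπ q).hom ((HomologicalComplex.cyclesMap φ q).hom z) -
    (K.homologyπ q).hom z = 0
  rw [← map_sub, homologyπ_eq_zero_iff]
  obtain ⟨_, rfl, y, hy⟩ := h _ fun j => d_iCycles K q j z
  refine ⟨y, ?_⟩
  rw [hy, map_sub]
  refine congrArg (· - _) ?_
  rw [← ModuleCat.comp_apply, ← ModuleCat.comp_apply, HomologicalComplex.cyclesMap_i]

theorem chainMap_d_loop_zero (x : N ⊗[k] R.V 0) :
    chainMap N (R.d 0) (chainMap N (R.loop R' 0) x) = chainMap N (R.roundTrip R' 0) x - x := by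
  rw [roundTrip_zero, chainMap_add, chainMap_unit, ← chainMap_comp]
  simp

theorem chainMap_d_loop_succ (n : ℕ) (x : N ⊗[k] R.V (n + 1)) (hx : chainMap N (R.d n) x = 0) :
    chainMap N (R.d (n + 1)) (chainMap N (R.loop R' (n + 1)) x) =
      chainMap N (R.roundTrip R' (n + 1)) x - x := by
  rw [roundTrip_succ, chainMap_add, chainMap_add, chainMap_unit, ← chainMap_comp, ← chainMap_comp]
  simp [hx]

theorem homologyMap_chainCompare (n : ℕ) : HomologicalComplex.homologyMap
    (R.chainCompare R' N ≫ R'.chainCompare R N) n = 𝟙 _ := by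
  refine homologyMap_eq_id _ _ fun (x : N ⊗[k] R.V n) hx =>
    ⟨n + 1, ChainComplex.prev ℕ n, chainMap N (R.loop R' n) x, (R.chain_d_apply N n _).trans ?_⟩
  have e : ((R.chainCompare R' N ≫ R'.chainCompare R N).f n).hom x =
      chainMap N (R.roundTrip R' n) x := by
    rw [roundTrip, ← chainMap_comp]; rfl
  refine Eq.trans ?_ (congrArg (· - x) e.symm)
  cases n with
  | zero => exact R.chainMap_d_loop_zero R' N x
  | succ n => exact R.chainMap_d_loop_succ R' N n x ((R.chain_d_apply N n x).symm.trans (hx n))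

theorem cochainMap_loop_d (n : ℕ) (x : R.V n →ₗ[k] N) (hx : cochainMap N (R.d n) x = 0) :
    cochainMap N (extend (R.d n) ∘ₗ R.loop R' n) x = 0 := by
  rw [← cochainMap_comp, LinearMap.comp_apply, hx, map_zero]

/-- There are no coboundaries in degree `0`: the round trip fixes a cocycle exactly, because its
correction term factors through the coboundary of `x`. -/
theorem cochainMap_d_loop_zero (x : R.V 0 →ₗ[k] N) (hx : cochainMap N (R.d 0) x = 0) :
    0 = cochainMap N (R.roundTrip R' 0) x - x := by
  rw [roundTrip_zero, cochainMap_add, cochainMap_unit, LinearMap.add_apply,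
    cochainMap_loop_d _ _ _ _ _ hx]
  simp

theorem cochainMap_d_loop_succ (n : ℕ) (x : R.V (n + 1) →ₗ[k] N)
    (hx : cochainMap N (R.d (n + 1)) x = 0) :
    cochainMap N (R.d n) (cochainMap N (R.loop R' n) x) =
      cochainMap N (R.roundTrip R' (n + 1)) x - x := by
  rw [roundTrip_succ, cochainMap_add, cochainMap_add, cochainMap_unit, LinearMap.add_apply,
    LinearMap.add_apply, cochainMap_loop_d _ _ _ _ _ hx, ← cochainMap_comp]
  simp

theorem homologyMap_cochainCompare (n : ℕ) : HomologicalComplex.homologyMap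
    (R'.cochainCompare R N ≫ R.cochainCompare R' N) n = 𝟙 _ := by
  refine homologyMap_eq_id _ _ fun (x : R.V n →ₗ[k] N) hx => ?_
  have e : ((R'.cochainCompare R N ≫ R.cochainCompare R' N).f n).hom x =
      cochainMap N (R.roundTrip R' n) x := by
    rw [roundTrip, ← cochainMap_comp]; rfl
  have hx' := (R.cochain_d_apply N n x).symm.trans (hx (n + 1))
  cases n with
  | zero =>
    -- Degree `0` has no predecessor for cochains; the only available boundary is zero.
    exact ⟨_, rfl, 0, (map_zero _).trans
      ((R.cochainMap_d_loop_zero R' N x hx').trans (congrArg (· - x) e.symm))⟩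
  | succ n =>
    exact ⟨n, CochainComplex.prev_nat_succ n, cochainMap N (R.loop R' n) x,
      (R.cochain_d_apply N n _).trans
        ((R.cochainMap_d_loop_succ R' N n x hx').trans (congrArg (· - x) e.symm))⟩

/-- Two resolutions have the same homology with coefficients. -/
def chainHomologyIso (n : ℕ) : (R.chain N).homology n ≅ (R'.chain N).homology n where
  hom := HomologicalComplex.homologyMap (R.chainCompare R' N) n
  inv := HomologicalComplex.homologyMap (R'.chainCompare R N) n
  hom_inv_id := by
    rw [← HomologicalComplex.homologyMap_comp, homologyMap_chainCompare]
  inv_hom_id := by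
    rw [← HomologicalComplex.homologyMap_comp, homologyMap_chainCompare]

/-- Two resolutions have the same cohomology with coefficients. -/
def cochainHomologyIso (n : ℕ) : (R.cochain N).homology n ≅ (R'.cochain N).homology n where
  hom := HomologicalComplex.homologyMap (R'.cochainCompare R N) n
  inv := HomologicalComplex.homologyMap (R.cochainCompare R' N) n
  hom_inv_id := by
    rw [← HomologicalComplex.homologyMap_comp, homologyMap_cochainCompare]
  inv_hom_id := by
    rw [← HomologicalComplex.homologyMap_comp, homologyMap_cochainCompare]

end Complexes
end SplitResolution

/-! ### The normalized bar resolution as a split resolution -/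

section BarResolution
variable (k B : Type u) [CommRing k] [Ring B] [Algebra k B]

/-- `B̄⁰ = k`. -/
def BarPow.scalar : BarPow k B 0 ≃ₗ[k] k :=
  BarPow.equiv k B 0 ≪≫ₗ PiTensorProduct.isEmptyEquiv (Fin 0)

/-- The empty tensor. -/
def BarPow.empty : BarPow k B 0 := (BarPow.scalar k B).symm 1

theorem BarPow.scalar_empty : BarPow.scalar k B (BarPow.empty k B) = 1 :=
  (BarPow.scalar k B).apply_symm_apply 1

theorem BarPow.eq_scalar_smul_empty (x : BarPow k B 0) :
    x = BarPow.scalar k B x • BarPow.empty k B := by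
  refine (BarPow.scalar k B).injective ?_
  rw [map_smul, BarPow.scalar_empty, smul_eq_mul, mul_one]

theorem BarMod.induction_zero {p : BarMod k B 0 → Prop} (w : BarMod k B 0)
    (h : ∀ b, p (BarPow.empty k B ⊗ₜ b)) : p w := by
  have : ∃ b, w = BarPow.empty k B ⊗ₜ b := by
    induction w using TensorProduct.induction_on with
    | zero => exact ⟨0, by rw [TensorProduct.tmul_zero]⟩
    | tmul x b =>
      refine ⟨BarPow.scalar k B x • b, ?_⟩
      conv_lhs => rw [BarPow.eq_scalar_smul_empty k B x]
      rw [TensorProduct.smul_tmul]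
    | add x y hx hy =>
      obtain ⟨b, hb⟩ := hx
      obtain ⟨c, hc⟩ := hy
      exact ⟨b + c, by rw [hb, hc, TensorProduct.tmul_add]⟩
  obtain ⟨b, rfl⟩ := this
  exact h b

/-- The contracting homotopy `b ⊗ w ↦ 1 ⊗ b̄ ⊗ w` of the normalized bar resolution. -/
def barContraction (n : ℕ) : Bim k B (BarPow k B n) →ₗ[k] Bim k B (BarPow k B (n + 1)) :=
  TensorProduct.mk k B _ 1 ∘ₗ (BarMod.cons k B n).toLinearMap ∘ₗ
    LinearMap.rTensor (BarMod k B n) (Bar.mk k)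

theorem barContraction_tmul (n : ℕ) (b : B) (w : BarMod k B n) :
    barContraction k B n (b ⊗ₜ w) = 1 ⊗ₜ BarMod.cons k B n (Bar.mk k b ⊗ₜ w) := rfl

/-- The augmentation of the bar resolution, on generators. -/
def barAug : BarPow k B 0 →ₗ[k] B := Algebra.linearMap k B ∘ₗ (BarPow.scalar k B).toLinearMap

theorem evaluate_barAug (b c : B) :
    evaluate B (barAug k B) (b ⊗ₜ (BarPow.empty k B ⊗ₜ c)) = b * c := by
  rw [evaluate_tmul, barAug]
  simp [BarPow.scalar_empty]

/-- With `d(1 ⊗ b̄ ⊗ w) = b ⊗ w - 1 ⊗ (b ⋆ w)` and the recursion of `⋆`, the error in `ds = 1` is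
precisely `s` of the differential. Packing all inner faces into `⋆` spares every sum with signs. -/
theorem extend_barD_barContraction (n : ℕ) (x : Bim k B (BarPow k B (n + 1))) :
    extend (barD k B (n + 1)) (barContraction k B (n + 1) x) =
      x - barContraction k B n (extend (barD k B n) x) := by
  induction x using TensorProduct.induction_on with
  | zero => simp only [map_zero, sub_self]
  | add x y hx hy => simp only [map_add, hx, hy]; abel
  | tmul b w =>
    induction w using BarMod.induction with
    | zero => simp only [TensorProduct.tmul_zero, map_zero, sub_self]
    | add x y hx hy => simp only [TensorProduct.tmul_add, map_add, hx, hy]; abel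
    | cons c w =>
      rw [barContraction_tmul, extend_barD, one_mul, extend_barD, map_sub, barContraction_tmul,
        barContraction_tmul, barMerge_succ, map_sub, TensorProduct.tmul_sub]

/-- The normalized bar resolution. -/
def barResolution : SplitResolution k B where
  V := BarPow k B
  d := barD k B
  aug := barAug k B
  init := TensorProduct.mk k B _ 1 ∘ₗ TensorProduct.mk k _ B (BarPow.empty k B)
  s := barContraction k B
  d_d n x := LinearMap.congr_fun (extend_barD_barD k B n) x
  aug_d x := by
    obtain ⟨x, rfl⟩ := (BarPow.cons k B 0).surjective x
    induction x using TensorProduct.induction_on with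
    | zero => simp only [map_zero]
    | add x y hx hy => simp only [map_add, hx, hy, add_zero]
    | tmul b t =>
      obtain ⟨b, rfl⟩ := Bar.mk_surjective b
      rw [barD_cons]
      generalize BarMod.inl 0 t = w
      induction w using BarMod.induction_zero with
      | h c => rw [barMerge_zero, map_sub, evaluate_barAug, evaluate_barAug, one_mul, sub_self]
  aug_init b := by
    rw [LinearMap.comp_apply, TensorProduct.mk_apply, TensorProduct.mk_apply, evaluate_barAug,
      one_mul]
  d_s_zero x := by
    induction x using TensorProduct.induction_on with
    | zero => simp only [map_zero, sub_self]
    | add x y hx hy => simp only [map_add, hx, hy]; abel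
    | tmul b w =>
      induction w using BarMod.induction_zero with
      | h c =>
        rw [barContraction_tmul, extend_barD, one_mul, barMerge_zero, evaluate_barAug,
          LinearMap.comp_apply, TensorProduct.mk_apply, TensorProduct.mk_apply]
  d_s n x := extend_barD_barContraction k B n x

end BarResolution

/-! ### Appending a factor at the right end of a tensor power -/

section Snoc
variable (k B : Type u) [CommRing k] [Ring B] [Algebra k B]

variable {k B} in
theorem BarPow.induction {n : ℕ} {p : BarPow k B n → Prop} (x : BarPow k B n)
    (smul_tprod : ∀ (r : k) v, p (r • BarPow.tprod k B v)) (add : ∀ x y, p x → p y → p (x + y)) :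
    p x := by
  suffices h : ∀ y : ⨂[k]^n (Bar k B), p ((BarPow.equiv k B n).symm y) by
    simpa using h (BarPow.equiv k B n x)
  intro y
  induction y using PiTensorProduct.induction_on with
  | smul_tprod r v => exact smul_tprod r v
  | add y z hy hz => rw [map_add]; exact add _ _ hy hz

theorem BarPow.snoc_cons (n : ℕ) (b c : Bar k B) (x : BarPow k B n) :
    BarPow.snoc k B (n + 1) (BarPow.cons k B n (b ⊗ₜ x) ⊗ₜ c) =
      BarPow.cons k B (n + 1) (b ⊗ₜ BarPow.snoc k B n (x ⊗ₜ c)) := by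
  induction x using BarPow.induction with
  | add x y hx hy => simp only [TensorProduct.tmul_add, TensorProduct.add_tmul, map_add, hx, hy]
  | smul_tprod r v =>
    simp only [TensorProduct.tmul_smul, ← TensorProduct.smul_tmul', map_smul,
      BarPow.snoc_tprod, BarPow.cons_tprod, Fin.cons_snoc_eq_snoc_cons]

theorem BarPow.snoc_empty (c : Bar k B) : BarPow.snoc k B 0 (BarPow.empty k B ⊗ₜ c) =
    BarPow.cons k B 0 (c ⊗ₜ BarPow.empty k B) := by
  generalize BarPow.empty k B = x
  induction x using BarPow.induction with
  | add x y hx hy => simp only [TensorProduct.tmul_add, TensorProduct.add_tmul, map_add, hx, hy]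
  | smul_tprod r v =>
    simp only [TensorProduct.tmul_smul, ← TensorProduct.smul_tmul', map_smul,
      BarPow.snoc_tprod, BarPow.cons_tprod]
    refine congrArg (fun w => r • BarPow.tprod k B w) (funext fun i => ?_)
    fin_cases i
    rfl

/-- `x ⊗ b ↦ x ⊗ b̄`. -/
def BarMod.snoc (n : ℕ) : BarMod k B n →ₗ[k] BarPow k B (n + 1) :=
  (BarPow.snoc k B n).toLinearMap ∘ₗ LinearMap.lTensor (BarPow k B n) (Bar.mk k)

theorem BarMod.snoc_tmul (n : ℕ) (x : BarPow k B n) (b : B) :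
    BarMod.snoc k B n (x ⊗ₜ b) = BarPow.snoc k B n (x ⊗ₜ Bar.mk k b) := rfl

theorem BarMod.cons_tmul (n : ℕ) (b : Bar k B) (x : BarPow k B n) (c : B) :
    BarMod.cons k B n (b ⊗ₜ (x ⊗ₜ c)) = BarPow.cons k B n (b ⊗ₜ x) ⊗ₜ c := by
  simp [BarMod.cons]

theorem BarMod.snoc_cons (n : ℕ) (b : Bar k B) (w : BarMod k B n) :
    BarMod.snoc k B (n + 1) (BarMod.cons k B n (b ⊗ₜ w)) =
      BarPow.cons k B (n + 1) (b ⊗ₜ BarMod.snoc k B n w) := by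
  induction w using TensorProduct.induction_on with
  | zero => simp only [TensorProduct.tmul_zero, map_zero]
  | add x y hx hy => simp only [TensorProduct.tmul_add, map_add, hx, hy]
  | tmul x c => rw [BarMod.cons_tmul, BarMod.snoc_tmul, BarMod.snoc_tmul, BarPow.snoc_cons]

/-- `x ⊗ b ↦ x ⊗ b̄ ⊗ 1`. -/
def BarMod.snocOne (n : ℕ) : BarMod k B n →ₗ[k] BarMod k B (n + 1) :=
  BarMod.inl (n + 1) ∘ₗ BarMod.snoc k B n

theorem BarMod.snocOne_apply (n : ℕ) (w : BarMod k B n) :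
    BarMod.snocOne k B n w = BarMod.snoc k B n w ⊗ₜ 1 := rfl

theorem BarMod.snocOne_cons (n : ℕ) (b : Bar k B) (w : BarMod k B n) :
    BarMod.snocOne k B (n + 1) (BarMod.cons k B n (b ⊗ₜ w)) =
      BarMod.cons k B (n + 1) (b ⊗ₜ BarMod.snocOne k B n w) := by
  rw [BarMod.snocOne_apply, BarMod.snoc_cons, BarMod.snocOne_apply, BarMod.cons_tmul]

theorem BarMod.snocOne_empty (b : B) :
    BarMod.snocOne k B 0 (BarPow.empty k B ⊗ₜ b) =
      BarMod.cons k B 0 (Bar.mk k b ⊗ₜ (BarPow.empty k B ⊗ₜ 1)) := by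
  rw [BarMod.snocOne_apply, BarMod.snoc_tmul, BarPow.snoc_empty, BarMod.cons_tmul]

/-- Appending a final `1` does not affect the products already present in `b ⋆ w`; the only new
product is that of the old last factor with `1`, which returns `b ⊗ w` with the sign of position `n
+ 1`. This is the computation behind the contraction `σ` of the rows, which works at the right end
although the recursions peel off factors at the left. -/
theorem barMerge_snocOne (n : ℕ) (b : B) (w : BarMod k B n) :
    barMerge k B (n + 1) b (BarMod.snocOne k B n w) = BarMod.snocOne k B n (barMerge k B n b w) +
      (-1 : k) ^ (n + 1) • BarMod.cons k B n (Bar.mk k b ⊗ₜ w) := by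
  induction n generalizing b with
  | zero =>
    induction w using BarMod.induction_zero with
    | h c =>
      rw [BarMod.snocOne_empty, barMerge_succ, barMerge_zero, barMerge_zero, BarMod.snocOne_empty,
        map_sub, mul_one]
      simp [sub_eq_add_neg]
  | succ n ih =>
    induction w using BarMod.induction with
    | zero => simp only [TensorProduct.tmul_zero, map_zero, smul_zero, add_zero]
    | add x y hx hy => simp only [TensorProduct.tmul_add, map_add, smul_add, hx, hy]; abel
    | cons c w =>
      rw [BarMod.snocOne_cons, barMerge_succ, ih, barMerge_succ, TensorProduct.tmul_add, map_sub,
        map_sub, map_sub, map_add, BarMod.snocOne_cons, BarMod.snocOne_cons,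
        TensorProduct.tmul_smul, map_smul, pow_succ _ (n + 1), mul_neg_one, neg_smul]
      abel

end Snoc

/-! ### Multiplication in the crossed product, and the tensor powers of `E/A` over `A` -/

section Crossed
variable {k A H : Type u} [CommRing k] [Ring A] [Algebra k A] [Ring H] [Bialgebra k H]

namespace CrossedProduct
open WeakActionWithMap
variable (D : CrossedProduct k A H)

section Multiplication

theorem inA_eq (a : A) : D.inA a = D.toAlg (a ⊗ₜ 1) := rfl

theorem inH_eq (h : H) : D.inH h = D.toAlg (1 ⊗ₜ h) := rfl

theorem mulChi_one (z : A ⊗[k] H) : D.mulChi z 1 = z := by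
  induction z using TensorProduct.induction_on with
  | zero => simp only [map_zero, LinearMap.zero_apply]
  | add x y hx hy => simp only [map_add, LinearMap.add_apply, hx, hy]
  | tmul a h => rw [mulChi_tmul, chi_one, lmul_tmul, mul_one]

theorem inA_mul_toAlg (a : A) (z : A ⊗[k] H) : D.inA a * D.toAlg z = D.toAlg (lmul H a z) := by
  induction z using TensorProduct.induction_on with
  | zero => simp only [map_zero, mul_zero]
  | add x y hx hy => simp only [map_add, mul_add, hx, hy]
  | tmul b h =>
    rw [inA_eq, ← toAlg_mul, mul_tmul, twist_one, mulChi_tmul, chi_one_left, lmul_tmul, mul_one]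

/-- This and the next two formulas translate between coordinates and products in `E`. The cocycle
identity of `f` and the twisted module identity never have to be written out: they enter through the
associativity of `E`. -/
theorem inA_mul_inH (a : A) (h : H) : D.inA a * D.inH h = D.toAlg (a ⊗ₜ h) := by
  rw [inH_eq, inA_mul_toAlg, lmul_tmul, mul_one]

theorem inH_mul_inA (h : H) (a : A) : D.inH h * D.inA a = D.toAlg (D.twist a h) := by
  rw [inH_eq, inA_eq, ← toAlg_mul, mul_tmul, mulChi_one, lmul_one]

theorem inH_mul_inH (h l : H) : D.inH h * D.inH l = D.toAlg (D.chi (h ⊗ₜ l)) := by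
  rw [inH_eq, inH_eq, ← toAlg_mul, mul_tmul, twist_of_one, mulChi_tmul, lmul_one, lmul_one]

variable {D} in
theorem Alg.induction {p : D.Alg → Prop} (x : D.Alg) (zero : p 0)
    (mul : ∀ a h, p (D.inA a * D.inH h)) (add : ∀ x y, p x → p y → p (x + y)) : p x := by
  obtain ⟨x, rfl⟩ := D.toAlg.surjective x
  induction x using TensorProduct.induction_on with
  | zero => rwa [map_zero]
  | tmul a h => rw [← inA_mul_inH]; exact mul a h
  | add x y hx hy => rw [map_add]; exact add _ _ hx hy

end Multiplication

section Relative
/-! The module `A ⊗ (H̄ⁿ ⊗ H)` is `(E/A) ⊗_A ⋯ ⊗_A (E/A) ⊗_A E`, with `n` factors `E/A`. -/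

variable (k A H) in
/-- The `k`-module `A ⊗ (H̄ⁿ ⊗ H)`. -/
abbrev Rel (n : ℕ) : Type u := A ⊗[k] BarMod k H n

/-- `(y, w) ↦ y ⊗ w`, the projection `E × Rel n → Rel (n + 1)`. -/
def relCons (n : ℕ) : D.Alg →ₗ[k] Rel k A H n →ₗ[k] Rel k A H (n + 1) :=
  TensorProduct.lift (LinearMap.mk₂ k (fun a h => lmul (BarMod k H (n + 1)) a ∘ₗ
      LinearMap.lTensor A (BarMod.cons k H n).toLinearMap ∘ₗ D.hopfPush (BarMod k H n) h)
    (fun _ _ _ => by simp only [map_add, LinearMap.add_comp])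
    (fun _ _ _ => by simp only [map_smul, LinearMap.smul_comp])
    (fun _ _ _ => by simp only [map_add, LinearMap.comp_add])
    (fun _ _ _ => by simp only [map_smul, LinearMap.comp_smul])) ∘ₗ D.toAlg.symm.toLinearMap

theorem relCons_toAlg_tmul (n : ℕ) (a : A) (h : H) (w : Rel k A H n) :
    D.relCons n (D.toAlg (a ⊗ₜ h)) w = lmul (BarMod k H (n + 1)) a
      (LinearMap.lTensor A (BarMod.cons k H n).toLinearMap (D.hopfPush (BarMod k H n) h w)) := rfl

theorem relCons_inA_mul (n : ℕ) (a : A) (y : D.Alg) (w : Rel k A H n) :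
    D.relCons n (D.inA a * y) w = lmul (k := k) _ a (D.relCons n y w) := by
  induction y using Alg.induction with
  | zero => simp only [mul_zero, map_zero, LinearMap.zero_apply]
  | add x y hx hy => simp only [mul_add, map_add, LinearMap.add_apply, hx, hy]
  | mul b h =>
    rw [← mul_assoc, ← map_mul, inA_mul_inH, inA_mul_inH, relCons_toAlg_tmul, relCons_toAlg_tmul,
      lmul_mul]

theorem relCons_inH (n : ℕ) (h : H) (w : Rel k A H n) : D.relCons n (D.inH h) w =
    LinearMap.lTensor A (BarMod.cons k H n).toLinearMap (D.hopfPush (BarMod k H n) h w) := by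
  rw [inH_eq, relCons_toAlg_tmul, lmul_one]

theorem relCons_toAlg_one_tmul (n : ℕ) (z : A ⊗[k] H) (v : BarMod k H n) :
    D.relCons n (D.toAlg z) (1 ⊗ₜ v) = LinearMap.lTensor A ((BarMod.cons k H n).toLinearMap ∘ₗ
      (TensorProduct.mk k _ _).flip v ∘ₗ Bar.mk k) z := by
  induction z using TensorProduct.induction_on with
  | zero => simp only [map_zero, LinearMap.zero_apply]
  | add x y hx hy => simp only [map_add, LinearMap.add_apply, hx, hy]
  | tmul a h =>
    rw [relCons_toAlg_tmul, hopfPush_one_tmul]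
    simp

theorem relCons_inH_one_tmul (n : ℕ) (h : H) (v : BarMod k H n) :
    D.relCons n (D.inH h) (1 ⊗ₜ v) = 1 ⊗ₜ BarMod.cons k H n (Bar.mk k h ⊗ₜ v) := by
  rw [inH_eq, relCons_toAlg_one_tmul]
  rfl

theorem hopfPush_tmul (W : Type u) [AddCommMonoid W] [Module k W] (h : H) (a : A) (w : W) :
    D.hopfPush W h (a ⊗ₜ w) = LinearMap.lTensor A ((TensorProduct.mk k _ _).flip w ∘ₗ Bar.mk k)
      (D.twist a h) := by
  simp only [hopfPush, LinearMap.coe_mk, AddHom.coe_mk, LinearMap.comp_apply,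
    LinearMap.rTensor_tmul, twistBarStep, LinearMap.mk₂_apply]
  generalize D.twist a h = z
  induction z using TensorProduct.induction_on with
  | zero => simp
  | tmul x y => simp
  | add x y hx hy => simp only [map_add, TensorProduct.add_tmul, hx, hy]

theorem relCons_tmul (n : ℕ) (y : D.Alg) (b : A) (v : BarMod k H n) :
    D.relCons n y (b ⊗ₜ v) = D.relCons n (y * D.inA b) (1 ⊗ₜ v) := by
  induction y using Alg.induction with
  | zero => simp only [zero_mul, map_zero, LinearMap.zero_apply]
  | add x y hx hy => simp only [add_mul, map_add, LinearMap.add_apply, hx, hy]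
  | mul a h =>
    rw [mul_assoc, relCons_inA_mul, relCons_inA_mul, inH_mul_inA, relCons_toAlg_one_tmul,
      relCons_inH, hopfPush_tmul, ← LinearMap.comp_apply (LinearMap.lTensor A _),
      ← LinearMap.lTensor_comp]

/-- Balancedness over `A`: `y ⊗ w` depends only on its class in `E ⊗_A Rel n`. Coefficients in `A`
can therefore be pushed to the left until a formula has to be checked only for `y = 1 # h` and `w =
1 ⊗ v`. -/
theorem relCons_mul_inA (n : ℕ) (y : D.Alg) (b : A) (w : Rel k A H n) :
    D.relCons n (y * D.inA b) w = D.relCons n y (lmul (k := k) _ b w) := by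
  induction w using TensorProduct.induction_on with
  | zero => simp only [map_zero]
  | add x z hx hz => simp only [map_add, hx, hz]
  | tmul c v => rw [lmul_tmul, relCons_tmul, relCons_tmul _ _ _ (b * c), map_mul D.inA,
    mul_assoc]

/-- `(a # h, v) ↦ a · hopfMerge h v`. -/
def relActOne (n : ℕ) : D.Alg →ₗ[k] BarMod k H n →ₗ[k] Rel k A H n :=
  TensorProduct.lift (LinearMap.mk₂ k (fun a h => lmul (BarMod k H n) a ∘ₗ D.hopfMerge n h)
    (fun _ _ _ => by simp only [map_add, LinearMap.add_comp])
    (fun _ _ _ => by simp only [map_smul, LinearMap.smul_comp])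
    (fun _ _ _ => by simp only [map_add, LinearMap.comp_add])
    (fun _ _ _ => by simp only [map_smul, LinearMap.comp_smul])) ∘ₗ D.toAlg.symm.toLinearMap

theorem relActOne_toAlg_tmul (n : ℕ) (a : A) (h : H) (v : BarMod k H n) :
    D.relActOne n (D.toAlg (a ⊗ₜ h)) v = lmul (BarMod k H n) a (D.hopfMerge n h v) := rfl

theorem relActOne_inA_mul (n : ℕ) (a : A) (x : D.Alg) (v : BarMod k H n) :
    D.relActOne n (D.inA a * x) v = lmul (k := k) _ a (D.relActOne n x v) := by
  induction x using Alg.induction with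
  | zero => simp only [mul_zero, map_zero, LinearMap.zero_apply]
  | add x y hx hy => simp only [mul_add, map_add, LinearMap.add_apply, hx, hy]
  | mul b h =>
    rw [← mul_assoc, ← map_mul, inA_mul_inH, inA_mul_inH, relActOne_toAlg_tmul,
      relActOne_toAlg_tmul, lmul_mul]

/-- The left action of `E` on `Rel n`. -/
def relAct (n : ℕ) : D.Alg →ₗ[k] Rel k A H n →ₗ[k] Rel k A H n :=
  LinearMap.mk₂ k (fun x => TensorProduct.lift (LinearMap.mk₂ k
      (fun b v => D.relActOne n (x * D.inA b) v)
      (fun _ _ _ => by simp only [map_add, mul_add, LinearMap.add_apply])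
      (fun _ _ _ => by simp only [map_smul, mul_smul_comm, LinearMap.smul_apply])
      (fun _ _ _ => by simp only [map_add]) (fun _ _ _ => by simp only [map_smul])))
    (fun x y w => by
      induction w using TensorProduct.induction_on with
      | zero => simp only [map_zero, add_zero]
      | add w z hw hz => rw [map_add, map_add, map_add, hw, hz]; abel
      | tmul b v => simp [add_mul])
    (fun r x w => by
      induction w using TensorProduct.induction_on with
      | zero => simp only [map_zero, smul_zero]
      | add w z hw hz => rw [map_add, map_add, smul_add, hw, hz]
      | tmul b v => simp)
    (fun _ _ _ => by simp only [map_add]) (fun _ _ _ => by simp only [map_smul])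

theorem relAct_tmul (n : ℕ) (x : D.Alg) (b : A) (v : BarMod k H n) :
    D.relAct n x (b ⊗ₜ v) = D.relActOne n (x * D.inA b) v := rfl

theorem relAct_inA_mul (n : ℕ) (a : A) (x : D.Alg) (w : Rel k A H n) :
    D.relAct n (D.inA a * x) w = lmul (k := k) _ a (D.relAct n x w) := by
  induction w using TensorProduct.induction_on with
  | zero => simp only [map_zero]
  | add x z hx hz => simp only [map_add, hx, hz]
  | tmul c v => rw [relAct_tmul, relAct_tmul, mul_assoc, relActOne_inA_mul]

theorem relAct_mul_inA (n : ℕ) (x : D.Alg) (b : A) (w : Rel k A H n) :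
    D.relAct n (x * D.inA b) w = D.relAct n x (lmul (k := k) _ b w) := by
  induction w using TensorProduct.induction_on with
  | zero => simp only [map_zero]
  | add x z hx hz => simp only [map_add, hx, hz]
  | tmul c v => rw [relAct_tmul, lmul_tmul, relAct_tmul, mul_assoc, map_mul D.inA]

theorem relAct_inH_one_tmul (n : ℕ) (h : H) (v : BarMod k H n) :
    D.relAct n (D.inH h) (1 ⊗ₜ v) = D.hopfMerge n h v := by
  rw [relAct_tmul, map_one, mul_one, inH_eq, relActOne_toAlg_tmul, lmul_one]

theorem hopfJoin_apply (W : Type u) [AddCommMonoid W] [Module k W] (h l : H) (w : W) :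
    D.hopfJoin W l h w = LinearMap.lTensor A ((TensorProduct.mk k _ _).flip w ∘ₗ Bar.mk k)
      (D.chi (h ⊗ₜ l)) := by
  simp only [hopfJoin, LinearMap.mk₂_apply, LinearMap.comp_apply, TensorProduct.mk_apply]
  generalize D.chi (h ⊗ₜ l) = z
  induction z using TensorProduct.induction_on with
  | zero => simp
  | tmul x y => simp
  | add x y hx hy => simp only [map_add, TensorProduct.add_tmul, hx, hy]

/-- The coordinate-free form of `hopfMerge`: the same rule `x · (y ⊗ w) = xy ⊗ w - x ⊗ (y · w)` as
for `barMerge`, now over `A`. From here on the explicit expressions in `f` and the weak action are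
not needed to handle `hopfMerge`. -/
theorem relAct_relCons (n : ℕ) (x y : D.Alg) (w : Rel k A H n) :
    D.relAct (n + 1) x (D.relCons n y w) =
      D.relCons n (x * y) w - D.relCons n x (D.relAct n y w) := by
  induction w using TensorProduct.induction_on with
  | zero => simp only [map_zero, sub_zero]
  | add w z hw hz => simp only [map_add, hw, hz]; abel
  | tmul b v =>
    -- The coefficient of `w` is absorbed into `y`, then that of `y` into `x`, and that of `x`
    -- factors out. What remains, with `x = 1 # h` and `y = 1 # l`, is the defining recursion of
    -- `hopfMerge`.
    rw [← mul_one b, ← lmul_tmul (k := k), ← relCons_mul_inA, ← relCons_mul_inA, ← relAct_mul_inA,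
      mul_assoc]
    generalize y * D.inA b = y
    induction y using Alg.induction with
    | zero => simp only [mul_zero, map_zero, LinearMap.zero_apply, sub_zero]
    | add y z hy hz => simp only [mul_add, map_add, LinearMap.add_apply, hy, hz]; abel
    | mul c l =>
      rw [relCons_inA_mul, relAct_inA_mul, ← relCons_mul_inA, ← relAct_mul_inA, ← mul_assoc]
      generalize x * D.inA c = x
      induction x using Alg.induction with
      | zero => simp only [zero_mul, map_zero, LinearMap.zero_apply, sub_zero]
      | add y z hy hz => simp only [add_mul, map_add, LinearMap.add_apply, hy, hz]; abel
      | mul a h =>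
        rw [mul_assoc, relAct_inA_mul, relCons_inA_mul, relCons_inA_mul, ← map_sub,
          relCons_inH_one_tmul, relAct_inH_one_tmul, hopfMerge_succ, relAct_inH_one_tmul,
          inH_mul_inH, relCons_toAlg_one_tmul, relCons_inH, hopfJoin_apply, map_sub,
          ← LinearMap.comp_apply (LinearMap.lTensor A _), ← LinearMap.lTensor_comp]

/-- The identification `E = Rel 0`. -/
def relZero : D.Alg →ₗ[k] Rel k A H 0 :=
  LinearMap.lTensor A (TensorProduct.mk k _ _ (BarPow.empty k H)) ∘ₗ D.toAlg.symm.toLinearMap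

theorem relZero_toAlg (z : A ⊗[k] H) : D.relZero (D.toAlg z) =
    LinearMap.lTensor A (TensorProduct.mk k _ _ (BarPow.empty k H)) z := rfl

theorem relZero_inA_mul (a : A) (x : D.Alg) :
    D.relZero (D.inA a * x) = lmul (k := k) _ a (D.relZero x) := by
  induction x using Alg.induction with
  | zero => simp only [mul_zero, map_zero]
  | add x y hx hy => simp only [mul_add, map_add, hx, hy]
  | mul b h =>
    rw [← mul_assoc, ← map_mul, inA_mul_inH, inA_mul_inH, relZero_toAlg, relZero_toAlg]
    rfl

theorem relZero_surjective : Function.Surjective D.relZero := by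
  intro w
  induction w using TensorProduct.induction_on with
  | zero => exact ⟨0, map_zero _⟩
  | add x y hx hy =>
    obtain ⟨a, ha⟩ := hx
    obtain ⟨b, hb⟩ := hy
    exact ⟨a + b, by rw [map_add, ha, hb]⟩
  | tmul a v =>
    induction v using BarMod.induction_zero with
    | h l => exact ⟨D.toAlg (a ⊗ₜ l), rfl⟩

variable {D} in
theorem Rel.induction {n : ℕ} {p : Rel k A H (n + 1) → Prop} (w : Rel k A H (n + 1)) (zero : p 0)
    (cons : ∀ y w, p (D.relCons n y w)) (add : ∀ x y, p x → p y → p (x + y)) : p w := by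
  induction w using TensorProduct.induction_on with
  | zero => exact zero
  | add x y hx hy => exact add _ _ hx hy
  | tmul a v =>
    induction v using BarMod.induction with
    | zero => rwa [TensorProduct.tmul_zero]
    | add x y hx hy => rw [TensorProduct.tmul_add]; exact add _ _ hx hy
    | cons h v =>
      have : a ⊗ₜ BarMod.cons k H n (Bar.mk k h ⊗ₜ v) =
          D.relCons n (D.inA a * D.inH h) (1 ⊗ₜ v) := by
        rw [relCons_inA_mul, relCons_inH_one_tmul, lmul_tmul, mul_one]
      rw [this]
      exact cons _ _

theorem relAct_relZero (x y : D.Alg) : D.relAct 0 x (D.relZero y) = D.relZero (x * y) := by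
  induction y using Alg.induction with
  | zero => simp only [mul_zero, map_zero]
  | add y z hy hz => simp only [mul_add, map_add, hy, hz]
  | mul c l =>
    rw [relZero_inA_mul, ← relAct_mul_inA, ← mul_assoc]
    generalize x * D.inA c = x
    induction x using Alg.induction with
    | zero => simp only [zero_mul, map_zero, LinearMap.zero_apply]
    | add y z hy hz => simp only [add_mul, map_add, LinearMap.add_apply, hy, hz]
    | mul a h =>
      rw [mul_assoc, relAct_inA_mul, relZero_inA_mul, inH_mul_inH, relZero_toAlg]
      refine congrArg _ ?_
      rw [inH_eq D l, relZero_toAlg, LinearMap.lTensor_tmul, TensorProduct.mk_apply,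
        relAct_inH_one_tmul, hopfMerge_zero]

/-- In degree `0` this is associativity of `E`. On `z ⊗ w` the rule `relAct_relCons` makes the terms
`xyz ⊗ w` and `xy ⊗ (z · w)` agree, and the two remaining ones cancel by the induction hypothesis
for `y`, `z` and `w`. -/
theorem relAct_mul (n : ℕ) (x y : D.Alg) (w : Rel k A H n) :
    D.relAct n (x * y) w = D.relAct n x (D.relAct n y w) := by
  induction n generalizing x y with
  | zero =>
    obtain ⟨z, rfl⟩ := D.relZero_surjective w
    rw [relAct_relZero, relAct_relZero, relAct_relZero, mul_assoc]
  | succ n ih =>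
    induction w using Rel.induction (D := D) with
    | zero => simp only [map_zero]
    | add w z hw hz => simp only [map_add, hw, hz]
    | cons z w =>
      rw [relAct_relCons, relAct_relCons, map_sub, relAct_relCons, relAct_relCons, ih, mul_assoc]
      abel

/-- `(e, t) ↦ t ⊗ e`, with the factor of `e` in `A` moved to the left of `t ∈ H̄ⁿ`. -/
def relTmul (n : ℕ) : D.Alg →ₗ[k] BarPow k H n →ₗ[k] Rel k A H n :=
  TensorProduct.lift (LinearMap.mk₂ k (fun a l =>
      LinearMap.lTensor A ((TensorProduct.mk k (BarPow k H n) H).flip l) ∘ₗ D.twistPow n a)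
    (fun _ _ _ => by simp only [map_add, LinearMap.comp_add])
    (fun _ _ _ => by simp only [map_smul, LinearMap.comp_smul])
    (fun _ _ _ => by simp only [map_add, LinearMap.lTensor_add, LinearMap.add_comp])
    (fun _ _ _ => by simp only [map_smul, LinearMap.lTensor_smul, LinearMap.smul_comp])) ∘ₗ
  D.toAlg.symm.toLinearMap

theorem relTmul_inA_mul_inH (n : ℕ) (a : A) (l : H) (t : BarPow k H n) :
    D.relTmul n (D.inA a * D.inH l) t =
      LinearMap.lTensor A ((TensorProduct.mk k (BarPow k H n) H).flip l) (D.twistPow n a t) := by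
  rw [inA_mul_inH]
  rfl

theorem relTmul_inH (n : ℕ) (l : H) (t : BarPow k H n) :
    D.relTmul n (D.inH l) t = 1 ⊗ₜ (t ⊗ₜ l) := by
  rw [← one_mul (D.inH l), ← map_one D.inA, relTmul_inA_mul_inH, twistPow_one]
  rfl

/-- Moving a product past `t` amounts to moving its factors one after the other, which is the
multiplicativity `twistPow_mul`. It expresses the `A`-balancedness of `t ⊗ e`. -/
theorem relTmul_inA_mul (n : ℕ) (a : A) (e : D.Alg) (t : BarPow k H n) :
    D.relTmul n (D.inA a * e) t = TensorProduct.lift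
      ((D.relTmul n e).lcomp k _ ∘ₗ lmul (BarMod k H n)) (D.twistPow n a t) := by
  induction e using Alg.induction with
  | zero =>
    simp only [mul_zero, map_zero, LinearMap.zero_apply]
    generalize D.twistPow n a t = z
    induction z using TensorProduct.induction_on with
    | zero => simp only [map_zero]
    | add y z hy hz => rw [map_add, ← hy, ← hz, add_zero]
    | tmul c s => simp
  | add x y hx hy =>
    rw [mul_add, map_add, LinearMap.add_apply, hx, hy]
    generalize D.twistPow n a t = z
    induction z using TensorProduct.induction_on with
    | zero => simp only [map_zero, add_zero]
    | add y z hy hz => rw [map_add, map_add, map_add, ← hy, ← hz]; abel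
    | tmul c s => simp
  | mul b l =>
    rw [← mul_assoc, ← map_mul, relTmul_inA_mul_inH, twistPow_mul]
    generalize D.twistPow n a t = z
    induction z using TensorProduct.induction_on with
    | zero => simp only [map_zero]
    | add y z hy hz => simp only [map_add, hy, hz]
    | tmul c s =>
      simp only [twistMul_tmul, TensorProduct.lift.tmul, LinearMap.comp_apply,
        LinearMap.lcomp_apply, relTmul_inA_mul_inH]
      generalize D.twistPow n b s = z
      induction z using TensorProduct.induction_on with
      | zero => simp only [map_zero]
      | add y z hy hz => simp only [map_add, hy, hz]
      | tmul c s => simp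

theorem relTmul_cons (n : ℕ) (e : D.Alg) (h : H) (t : BarPow k H n) :
    D.relTmul (n + 1) e (BarPow.cons k H n (Bar.mk k h ⊗ₜ t)) =
      D.relCons n (D.inH h) (D.relTmul n e t) := by
  induction e using Alg.induction with
  | zero => simp only [map_zero, LinearMap.zero_apply]
  | add x y hx hy => simp only [map_add, LinearMap.add_apply, hx, hy]
  | mul b l =>
    rw [relTmul_inA_mul_inH, relTmul_inA_mul_inH, twistPow_succ]
    generalize D.twistPow n b t = z
    induction z using TensorProduct.induction_on with
    | zero => simp only [map_zero]
    | add y z hy hz => simp only [map_add, hy, hz]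
    | tmul c s =>
      rw [twistCons_tmul, LinearMap.lTensor_tmul, relCons_inH, hopfPush_tmul, twistBar_mk]
      generalize D.twist c h = z
      induction z using TensorProduct.induction_on with
      | zero => simp only [map_zero]
      | add y z hy hz => simp only [map_add, hy, hz]
      | tmul c s => simp [BarMod.cons_tmul]

theorem relTmul_empty (e : D.Alg) : D.relTmul 0 e (BarPow.empty k H) = D.relZero e := by
  induction e using Alg.induction with
  | zero => simp only [map_zero, LinearMap.zero_apply]
  | add x y hx hy => simp only [map_add, LinearMap.add_apply, hx, hy]
  | mul b l => rw [relTmul_inA_mul_inH, twistPow_zero, inA_mul_inH]; rfl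

/-- The right action of `E` on `Rel n`. -/
def relActR (n : ℕ) (e : D.Alg) : Rel k A H n →ₗ[k] Rel k A H n :=
  TensorProduct.lift (LinearMap.mk₂ k (fun a v => lmul (BarMod k H n) a
      (TensorProduct.lift (LinearMap.mk₂ k (fun t c => D.relTmul n (D.inH c * e) t)
        (fun _ _ _ => by simp only [map_add]) (fun _ _ _ => by simp only [map_smul])
        (fun _ _ _ => by simp only [map_add, add_mul, LinearMap.add_apply])
        (fun _ _ _ => by simp only [map_smul, smul_mul_assoc, LinearMap.smul_apply])) v))
    (fun _ _ _ => by simp only [map_add, LinearMap.add_apply])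
    (fun _ _ _ => by simp only [map_smul, LinearMap.smul_apply])
    (fun _ _ _ => by simp only [map_add]) (fun _ _ _ => by simp only [map_smul]))

theorem relActR_tmul (n : ℕ) (e : D.Alg) (a : A) (t : BarPow k H n) (c : H) :
    D.relActR n e (a ⊗ₜ (t ⊗ₜ c)) = lmul (k := k) _ a (D.relTmul n (D.inH c * e) t) := rfl

theorem relActR_lmul (n : ℕ) (e : D.Alg) (a : A) (w : Rel k A H n) :
    D.relActR n e (lmul (k := k) _ a w) = lmul (k := k) _ a (D.relActR n e w) := by
  induction w using TensorProduct.induction_on with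
  | zero => simp only [map_zero]
  | add y z hy hz => simp only [map_add, hy, hz]
  | tmul b v =>
    rw [lmul_tmul]
    induction v using TensorProduct.induction_on with
    | zero => simp only [TensorProduct.tmul_zero, map_zero]
    | add y z hy hz => simp only [TensorProduct.tmul_add, map_add, hy, hz]
    | tmul t c => rw [relActR_tmul, relActR_tmul, lmul_mul]

theorem relActR_relCons (n : ℕ) (e y : D.Alg) (w : Rel k A H n) :
    D.relActR (n + 1) e (D.relCons n y w) = D.relCons n y (D.relActR n e w) := by
  induction w using TensorProduct.induction_on with
  | zero => simp only [map_zero]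
  | add w z hw hz => simp only [map_add, hw, hz]
  | tmul b v =>
    rw [← mul_one b, ← lmul_tmul (k := k), relActR_lmul, ← relCons_mul_inA, ← relCons_mul_inA]
    generalize y * D.inA b = y
    induction y using Alg.induction with
    | zero => simp only [map_zero, LinearMap.zero_apply]
    | add y z hy hz => simp only [map_add, LinearMap.add_apply, hy, hz]
    | mul c l =>
      rw [relCons_inA_mul, relActR_lmul, relCons_inA_mul, relCons_inH_one_tmul]
      refine congrArg _ ?_
      induction v using TensorProduct.induction_on with
      | zero => simp only [TensorProduct.tmul_zero, map_zero]
      | add y z hy hz => simp only [TensorProduct.tmul_add, map_add, hy, hz]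
      | tmul t c =>
        rw [BarMod.cons_tmul, relActR_tmul, relActR_tmul, lmul_one, lmul_one, relTmul_cons]

theorem relActR_relZero (e y : D.Alg) :
    D.relActR 0 e (D.relZero y) = D.relZero (y * e) := by
  induction y using Alg.induction with
  | zero => simp only [zero_mul, map_zero]
  | add y z hy hz => simp only [add_mul, map_add, hy, hz]
  | mul a h =>
    rw [mul_assoc, relZero_inA_mul, relZero_inA_mul, relActR_lmul, inH_eq, relZero_toAlg,
      LinearMap.lTensor_tmul, TensorProduct.mk_apply, relActR_tmul, lmul_one, relTmul_empty,
      inH_eq]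

/-- The right action touches only the last factor of `y ⊗ w`, so the recursive rule of the left
action is compatible with it; in degree `0` this is associativity in `E`. -/
theorem relActR_relAct (n : ℕ) (e x : D.Alg) (w : Rel k A H n) :
    D.relActR n e (D.relAct n x w) = D.relAct n x (D.relActR n e w) := by
  induction n generalizing x with
  | zero =>
    obtain ⟨z, rfl⟩ := D.relZero_surjective w
    rw [relAct_relZero, relActR_relZero, relActR_relZero, relAct_relZero, mul_assoc]
  | succ n ih =>
    induction w using Rel.induction (D := D) with
    | zero => simp only [map_zero]
    | add w z hw hz => simp only [map_add, hw, hz]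
    | cons z w =>
      rw [relAct_relCons, map_sub, relActR_relCons, relActR_relCons, relActR_relCons,
        relAct_relCons, ih]

end Relative
end CrossedProduct
end Crossed

/-! ### The bar complex of `E` relative to `A` -/

section Crossed
variable {k A H : Type u} [CommRing k] [Ring A] [Algebra k A] [Ring H] [Bialgebra k H]

namespace CrossedProduct
open WeakActionWithMap
variable (D : CrossedProduct k A H)

section Base
/-! The complex `E ⊗ (H̄ⁿ ⊗ H)`, the bar resolution of `E` relative to `A`. -/

/-- The `k`-module `E ⊗ (H̄ⁿ ⊗ H)`. -/
abbrev Base (n : ℕ) : Type u := D.Alg ⊗[k] BarMod k H n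

/-- The projection `E × Rel n → E ⊗_A Rel n = E ⊗ (H̄ⁿ ⊗ H)`. -/
def baseMk (n : ℕ) : D.Alg →ₗ[k] Rel k A H n →ₗ[k] D.Base n :=
  LinearMap.mk₂ k (fun e => TensorProduct.lift (LinearMap.mk₂ k
      (fun b v => (e * D.inA b) ⊗ₜ[k] v)
      (fun _ _ _ => by simp only [map_add, mul_add, TensorProduct.add_tmul])
      (fun _ _ _ => by simp only [map_smul, mul_smul_comm, TensorProduct.smul_tmul'])
      (fun _ _ _ => by simp only [TensorProduct.tmul_add])
      (fun _ _ _ => by simp only [TensorProduct.tmul_smul])))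
    (fun x y w => by
      induction w using TensorProduct.induction_on with
      | zero => simp only [map_zero, add_zero]
      | add w z hw hz => rw [map_add, map_add, map_add, hw, hz]; abel
      | tmul b v =>
        exact (congrArg (· ⊗ₜ[k] v) (add_mul x y (D.inA b))).trans (TensorProduct.add_tmul _ _ _))
    (fun r x w => by
      induction w using TensorProduct.induction_on with
      | zero => simp only [map_zero, smul_zero]
      | add w z hw hz => rw [map_add, map_add, smul_add, hw, hz]
      | tmul b v =>
        exact (congrArg (· ⊗ₜ[k] v) (smul_mul_assoc r x (D.inA b))).trans
          (TensorProduct.smul_tmul' _ _ _).symm)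
    (fun _ _ _ => by simp only [map_add]) (fun _ _ _ => by simp only [map_smul])

theorem baseMk_tmul (n : ℕ) (e : D.Alg) (b : A) (v : BarMod k H n) :
    D.baseMk n e (b ⊗ₜ v) = (e * D.inA b) ⊗ₜ v := rfl

theorem baseMk_one_tmul (n : ℕ) (e : D.Alg) (v : BarMod k H n) :
    D.baseMk n e (1 ⊗ₜ v) = e ⊗ₜ v := by rw [baseMk_tmul, map_one, mul_one]

theorem baseMk_mul_inA (n : ℕ) (e : D.Alg) (b : A) (w : Rel k A H n) :
    D.baseMk n (e * D.inA b) w = D.baseMk n e (lmul (k := k) _ b w) := by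
  induction w using TensorProduct.induction_on with
  | zero => simp only [map_zero]
  | add x z hx hz => simp only [map_add, hx, hz]
  | tmul c v => rw [baseMk_tmul, lmul_tmul, baseMk_tmul, mul_assoc, map_mul D.inA]

/-- The map `(h, e, v) ↦ e (1 # h) ⊗ v - e · hopfMerge h v`. -/
def baseDStep (n : ℕ) : H →ₗ[k] D.Alg →ₗ[k] BarMod k H n →ₗ[k] D.Base n :=
  LinearMap.mk₂ k (fun h e => TensorProduct.mk k D.Alg (BarMod k H n) (e * D.inH h) -
      D.baseMk n e ∘ₗ D.hopfMerge n h)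
    (fun _ _ _ => by simp only [map_add, mul_add, LinearMap.comp_add]; abel)
    (fun _ _ _ => by simp only [map_smul, mul_smul_comm, LinearMap.comp_smul, smul_sub])
    (fun _ _ _ => by simp only [map_add, add_mul, LinearMap.add_comp]; abel)
    (fun _ _ _ => by simp only [map_smul, smul_mul_assoc, LinearMap.smul_comp, smul_sub])

theorem baseDStep_apply (n : ℕ) (h : H) (e : D.Alg) (v : BarMod k H n) :
    D.baseDStep n h e v = (e * D.inH h) ⊗ₜ v - D.baseMk n e (D.hopfMerge n h v) := rfl

theorem baseDStep_one (n : ℕ) : D.baseDStep n 1 = 0 :=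
  LinearMap.ext₂ fun e v => by
    rw [baseDStep_apply, hopfMerge_one, baseMk_one_tmul, inH_one, mul_one, sub_self]
    rfl

/-- The differential of `E ⊗ (H̄* ⊗ H)`, `e ⊗ h̄ ⊗ v ↦ e (1 # h) ⊗ v - e · hopfMerge h v`. -/
def baseD (n : ℕ) : D.Base (n + 1) →ₗ[k] D.Base n :=
  TensorProduct.lift ((LinearMap.lcomp k (D.Base n) (BarMod.cons k H n).symm.toLinearMap) ∘ₗ
    Bar.lift₃ (D.baseDStep n) (D.baseDStep_one n))

theorem baseD_tmul_cons (n : ℕ) (e : D.Alg) (h : H) (v : BarMod k H n) :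
    D.baseD n (e ⊗ₜ BarMod.cons k H n (Bar.mk k h ⊗ₜ v)) =
      (e * D.inH h) ⊗ₜ v - D.baseMk n e (D.hopfMerge n h v) := by
  simp only [baseD, TensorProduct.lift.tmul, LinearMap.comp_apply, LinearMap.lcomp_apply,
    LinearEquiv.coe_coe, LinearEquiv.symm_apply_apply, Bar.lift₃_tmul, baseDStep_apply]

/-- As for `relAct_relCons`, the coefficients in `A` are pushed to the left, into `e`; the remaining
case `y = 1 # l` is the definition. -/
theorem baseD_baseMk_relCons (n : ℕ) (e y : D.Alg) (w : Rel k A H n) :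
    D.baseD n (D.baseMk (n + 1) e (D.relCons n y w)) =
      D.baseMk n (e * y) w - D.baseMk n e (D.relAct n y w) := by
  induction w using TensorProduct.induction_on with
  | zero => simp only [map_zero, sub_zero]
  | add w z hw hz => simp only [map_add, hw, hz]; abel
  | tmul b v =>
    rw [← mul_one b, ← lmul_tmul (k := k), ← relCons_mul_inA, ← baseMk_mul_inA, ← relAct_mul_inA,
      mul_assoc]
    generalize y * D.inA b = y
    induction y using Alg.induction with
    | zero => simp only [mul_zero, map_zero, LinearMap.zero_apply, sub_zero]
    | add y z hy hz => simp only [mul_add, map_add, LinearMap.add_apply, hy, hz]; abel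
    | mul c l =>
      rw [relCons_inA_mul, relAct_inA_mul, ← baseMk_mul_inA, ← baseMk_mul_inA, ← mul_assoc,
        relCons_inH_one_tmul, baseMk_one_tmul, baseD_tmul_cons, baseMk_one_tmul,
        relAct_inH_one_tmul]

variable {D} in
theorem Base.induction {n : ℕ} {p : D.Base n → Prop} (x : D.Base n) (zero : p 0)
    (mk : ∀ e w, p (D.baseMk n e w)) (add : ∀ x y, p x → p y → p (x + y)) : p x := by
  induction x using TensorProduct.induction_on with
  | zero => exact zero
  | add x y hx hy => exact add _ _ hx hy
  | tmul e v => rw [← baseMk_one_tmul]; exact mk _ _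

variable {D} in
theorem Base.induction_succ {n : ℕ} {p : D.Base (n + 1) → Prop} (x : D.Base (n + 1)) (zero : p 0)
    (mk : ∀ e y w, p (D.baseMk (n + 1) e (D.relCons n y w))) (add : ∀ x y, p x → p y → p (x + y)) :
    p x := by
  induction x using Base.induction with
  | zero => exact zero
  | add x y hx hy => exact add _ _ hx hy
  | mk e w =>
    induction w using Rel.induction (D := D) with
    | zero => rwa [map_zero]
    | add x y hx hy => rw [map_add]; exact add _ _ hx hy
    | cons y w => exact mk e y w

/-- On `e ⊗ y ⊗ z ⊗ w` all terms cancel in pairs except `e ⊗ (yz) · w` against `e ⊗ y · (z · w)`,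
which agree by `relAct_mul`. -/
theorem baseD_baseD (n : ℕ) (x : D.Base (n + 2)) : D.baseD n (D.baseD (n + 1) x) = 0 := by
  induction x using Base.induction_succ with
  | zero => simp only [map_zero]
  | add x y hx hy => simp only [map_add, hx, hy, add_zero]
  | mk e y w =>
    rw [baseD_baseMk_relCons, map_sub]
    induction w using Rel.induction (D := D) with
    | zero => simp only [map_zero, sub_zero]
    | add w z hw hz =>
      simp only [map_add, add_sub_add_comm, hw, hz, add_zero]
    | cons z w =>
      rw [relAct_relCons, map_sub, map_sub, baseD_baseMk_relCons, baseD_baseMk_relCons,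
        baseD_baseMk_relCons, relAct_mul, mul_assoc]
      abel

/-- The augmentation `e ⊗ h ↦ e (1 # h)`. -/
def baseAug : D.Base 0 →ₗ[k] D.Alg :=
  TensorProduct.lift ((LinearMap.mul k D.Alg).compl₂ (D.inH ∘ₗ
    (TensorProduct.lid k H).toLinearMap ∘ₗ LinearMap.rTensor H (BarPow.scalar k H).toLinearMap))

theorem baseAug_tmul (e : D.Alg) (h : H) :
    D.baseAug (e ⊗ₜ (BarPow.empty k H ⊗ₜ h)) = e * D.inH h := by
  simp [baseAug, BarPow.scalar_empty]

theorem baseAug_baseMk (e y : D.Alg) : D.baseAug (D.baseMk 0 e (D.relZero y)) = e * y := by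
  induction y using Alg.induction with
  | zero => simp only [map_zero, mul_zero]
  | add x y hx hy => simp only [map_add, mul_add, hx, hy]
  | mul a h =>
    rw [relZero_inA_mul, ← baseMk_mul_inA, inH_eq, relZero_toAlg, LinearMap.lTensor_tmul,
      TensorProduct.mk_apply, baseMk_one_tmul, baseAug_tmul, mul_assoc, inH_eq]

theorem baseAug_baseD (x : D.Base 1) : D.baseAug (D.baseD 0 x) = 0 := by
  induction x using Base.induction_succ with
  | zero => simp only [map_zero]
  | add x y hx hy => simp only [map_add, hx, hy, add_zero]
  | mk e y w =>
    obtain ⟨z, rfl⟩ := D.relZero_surjective w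
    rw [baseD_baseMk_relCons, relAct_relZero, map_sub, baseAug_baseMk, baseAug_baseMk, mul_assoc,
      sub_self]

theorem hopfPush_map {W X : Type u} [AddCommMonoid W] [Module k W] [AddCommMonoid X] [Module k X]
    (g : W →ₗ[k] X) (h : H) (z : A ⊗[k] W) :
    D.hopfPush X h (LinearMap.lTensor A g z) =
      LinearMap.lTensor A (LinearMap.lTensor (Bar k H) g) (D.hopfPush W h z) := by
  induction z using TensorProduct.induction_on with
  | zero => simp only [map_zero]
  | add x y hx hy => simp only [map_add, hx, hy]
  | tmul a w =>
    rw [LinearMap.lTensor_tmul, hopfPush_tmul, hopfPush_tmul, ← LinearMap.lTensor_comp_apply]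
    rfl

theorem hopfJoin_map {W X : Type u} [AddCommMonoid W] [Module k W] [AddCommMonoid X] [Module k X]
    (g : W →ₗ[k] X) (h l : H) (w : W) : D.hopfJoin X l h (g w) =
      LinearMap.lTensor A (LinearMap.lTensor (Bar k H) g) (D.hopfJoin W l h w) := by
  rw [hopfJoin_apply, hopfJoin_apply, ← LinearMap.lTensor_comp_apply]
  rfl

theorem snocOne_comp_cons (n : ℕ) :
    (BarMod.cons k H (n + 1)).toLinearMap ∘ₗ LinearMap.lTensor (Bar k H) (BarMod.snocOne k H n) =
      BarMod.snocOne k H (n + 1) ∘ₗ (BarMod.cons k H n).toLinearMap :=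
  TensorProduct.ext' fun b w => (BarMod.snocOne_cons k H n b w).symm

/-- The argument of `barMerge_snocOne`. The new product is that of the last factor with `1`, and
`chi_one`, which comes from `1 ⊗ 1` being a right unit of `E`, makes its cocycle factor trivial. -/
theorem hopfMerge_snocOne (n : ℕ) (h : H) (w : BarMod k H n) :
    D.hopfMerge (n + 1) h (BarMod.snocOne k H n w) =
      LinearMap.lTensor A (BarMod.snocOne k H n) (D.hopfMerge n h w) +
      (-1 : k) ^ (n + 1) • 1 ⊗ₜ BarMod.cons k H n (Bar.mk k h ⊗ₜ w) := by
  induction n generalizing h with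
  | zero =>
    induction w using BarMod.induction_zero with
    | h c =>
      rw [BarMod.snocOne_empty, hopfMerge_succ, hopfMerge_zero, hopfMerge_zero, chi_one,
        hopfJoin_apply, LinearMap.lTensor_tmul, TensorProduct.mk_apply, hopfPush_one_tmul, map_sub,
        sub_eq_add_neg]
      congr 1
      · generalize D.chi (h ⊗ₜ c) = z
        induction z using TensorProduct.induction_on with
        | zero => simp only [map_zero]
        | add x y hx hy => simp only [map_add, hx, hy]
        | tmul a l => simp [BarMod.snocOne_empty]
      · rw [LinearMap.lTensor_tmul, pow_succ, pow_zero, one_mul]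
        exact (neg_one_smul k (M := A ⊗[k] BarMod k H 1) _).symm
  | succ n ih =>
    induction w using BarMod.induction with
    | zero => simp only [TensorProduct.tmul_zero, map_zero, smul_zero, add_zero]
    | add x y hx hy => simp only [TensorProduct.tmul_add, map_add, smul_add, hx, hy]; abel
    | cons c w =>
      rw [BarMod.snocOne_cons, hopfMerge_succ, ih, hopfMerge_succ, map_add, map_smul,
        hopfPush_one_tmul, hopfPush_map, hopfJoin_map, ← LinearMap.lTensor_comp_apply,
        ← snocOne_comp_cons, LinearMap.lTensor_comp_apply, map_sub, map_sub, map_sub, map_add,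
        map_smul, LinearMap.lTensor_tmul, pow_succ _ (n + 1), mul_neg_one, sub_add_eq_sub_sub,
        sub_eq_add_neg _ (_ • _)]
      exact congrArg _ (neg_smul _ (_ : A ⊗[k] BarMod k H (n + 2))).symm

/-- The contracting homotopy of `E ⊗ (H̄* ⊗ H)`, `e ⊗ t ⊗ h ↦ (-1)ⁿ⁺¹ e ⊗ t ⊗ h̄ ⊗ 1`. -/
def baseS (n : ℕ) : D.Base n →ₗ[k] D.Base (n + 1) :=
  (-1 : k) ^ (n + 1) • LinearMap.lTensor D.Alg (BarMod.snocOne k H n)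

theorem baseS_tmul (n : ℕ) (e : D.Alg) (v : BarMod k H n) : D.baseS n (e ⊗ₜ v) =
    (-1 : k) ^ (n + 1) • e ⊗ₜ BarMod.snocOne k H n v := rfl

theorem baseMk_map {n m : ℕ} (g : BarMod k H n →ₗ[k] BarMod k H m) (e : D.Alg)
    (w : Rel k A H n) : D.baseMk m e (LinearMap.lTensor A g w) =
      LinearMap.lTensor D.Alg g (D.baseMk n e w) := by
  induction w using TensorProduct.induction_on with
  | zero => simp only [map_zero]
  | add x y hx hy => simp only [map_add, hx, hy]
  | tmul a w => rfl

theorem neg_one_pow_mul_self (n : ℕ) : (-1 : k) ^ n * (-1) ^ n = 1 := by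
  rw [← mul_pow, neg_one_mul, neg_neg, one_pow]

/-- By `hopfMerge_snocOne` the differential commutes with appending `1` except for one extra term,
which is `x` up to sign. The sign `(-1)ⁿ⁺¹` in `baseS` turns the commutation into cancellation and
the extra term into `x`. -/
theorem baseD_baseS (n : ℕ) (x : D.Base (n + 1)) :
    D.baseD (n + 1) (D.baseS (n + 1) x) + D.baseS n (D.baseD n x) = x := by
  induction x using TensorProduct.induction_on with
  | zero => simp only [map_zero, add_zero]
  | add x y hx hy =>
    conv_rhs => rw [← hx, ← hy]
    simp only [map_add]
    abel
  | tmul e v =>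
    induction v using BarMod.induction with
    | zero => simp only [TensorProduct.tmul_zero, map_zero, add_zero]
    | add x y hx hy =>
      conv_rhs => rw [TensorProduct.tmul_add, ← hx, ← hy]
      simp only [TensorProduct.tmul_add, map_add]
      abel
    | cons h v =>
      rw [baseS_tmul, BarMod.snocOne_cons, map_smul, baseD_tmul_cons, hopfMerge_snocOne,
        baseD_tmul_cons, map_sub, baseS_tmul, map_add, baseMk_map, map_smul, baseMk_one_tmul,
        baseS, LinearMap.smul_apply, pow_succ _ (n + 1), mul_neg_one, neg_smul, smul_sub, smul_add,
        smul_smul, neg_one_pow_mul_self, one_smul]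
      abel

theorem baseD_baseS_zero (x : D.Base 0) : D.baseD 0 (D.baseS 0 x) +
    D.baseAug x ⊗ₜ (BarPow.empty k H ⊗ₜ 1) = x := by
  induction x using TensorProduct.induction_on with
  | zero => simp only [map_zero, TensorProduct.zero_tmul, add_zero]
  | add x y hx hy =>
    conv_rhs => rw [← hx, ← hy]
    simp only [map_add, TensorProduct.add_tmul]
    abel
  | tmul e v =>
    induction v using BarMod.induction_zero with
    | h l =>
      rw [baseS_tmul, BarMod.snocOne_empty, map_smul, baseD_tmul_cons, hopfMerge_zero, chi_one,
        LinearMap.lTensor_tmul, TensorProduct.mk_apply, baseMk_one_tmul, baseAug_tmul]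
      simp

end Base
end CrossedProduct
end Crossed

/-! ### The rows `X_{*s}` and their augmentations to the relative bar complex -/

section Crossed
variable {k A H : Type u} [CommRing k] [Ring A] [Algebra k A] [Ring H] [Bialgebra k H]

namespace CrossedProduct
open WeakActionWithMap
variable (D : CrossedProduct k A H)

section Row

/-- `e ⊗ (t ⊗ x) ⊗ (c # 1) e'`, as a function of `t` and `w = x ⊗ c`. -/
def row (r s : ℕ) (e e' : D.Alg) :
    BarPow k H s →ₗ[k] BarMod k A r →ₗ[k] Bim k D.Alg (Gen k A H r s) :=
  (TensorProduct.mk k (BarPow k H s) (BarMod k A r)).compr₂ (TensorProduct.mk k _ _ e ∘ₗ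
    LinearMap.lTensor (Gen k A H r s) (LinearMap.mulRight k e' ∘ₗ D.inA.toLinearMap) ∘ₗ
    (TensorProduct.assoc k (BarPow k H s) (BarPow k A r) A).symm.toLinearMap)

theorem row_tmul (r s : ℕ) (e e' : D.Alg) (t : BarPow k H s) (x : BarPow k A r) (c : A) :
    D.row r s e e' t (x ⊗ₜ c) = e ⊗ₜ ((t ⊗ₜ x) ⊗ₜ (D.inA c * e')) := rfl

theorem row_tmul_one (r s : ℕ) (e e' : D.Alg) (t : BarPow k H s) (x : BarPow k A r) :
    D.row r s e e' t (x ⊗ₜ 1) = e ⊗ₜ ((t ⊗ₜ x) ⊗ₜ e') := by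
  rw [row_tmul, map_one, one_mul]

variable {D} in
theorem row_induction {r s : ℕ} {p : Bim k D.Alg (Gen k A H r s) → Prop}
    (x : Bim k D.Alg (Gen k A H r s)) (zero : p 0)
    (row : ∀ e l t y c, p (D.row r s e (D.inH l) t (y ⊗ₜ c)))
    (add : ∀ x y, p x → p y → p (x + y)) : p x := by
  induction x using Bim.induction with
  | zero => exact zero
  | add x y hx hy => exact add _ _ hx hy
  | tmul e v e' =>
    induction v using TensorProduct.induction_on with
    | zero => rwa [TensorProduct.zero_tmul, TensorProduct.tmul_zero]
    | add x y hx hy => rw [TensorProduct.add_tmul, TensorProduct.tmul_add]; exact add _ _ hx hy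
    | tmul t y =>
      induction e' using Alg.induction with
      | zero => rwa [TensorProduct.tmul_zero, TensorProduct.tmul_zero]
      | add x y hx hy => rw [TensorProduct.tmul_add, TensorProduct.tmul_add]; exact add _ _ hx hy
      | mul c l => exact row e l t y c

variable {D} in
theorem row_induction_succ {r s : ℕ} {p : Bim k D.Alg (Gen k A H (r + 1) s) → Prop}
    (x : Bim k D.Alg (Gen k A H (r + 1) s)) (zero : p 0)
    (row : ∀ e l t a w, p (D.row (r + 1) s e (D.inH l) t (BarMod.cons k A r (Bar.mk k a ⊗ₜ w))))
    (add : ∀ x y, p x → p y → p (x + y)) : p x := by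
  induction x using row_induction with
  | zero => exact zero
  | add x y hx hy => exact add _ _ hx hy
  | row e l t y c =>
    generalize y ⊗ₜ[k] c = w
    induction w using BarMod.induction with
    | zero => rwa [map_zero]
    | add x y hx hy => rw [map_add]; exact add _ _ hx hy
    | cons a w => exact row e l t a w

variable {D} in
theorem row_induction_zero {s : ℕ} {p : Bim k D.Alg (Gen k A H 0 s) → Prop}
    (x : Bim k D.Alg (Gen k A H 0 s)) (zero : p 0)
    (row : ∀ e l t c, p (D.row 0 s e (D.inH l) t (BarPow.empty k A ⊗ₜ c)))
    (add : ∀ x y, p x → p y → p (x + y)) : p x := by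
  induction x using row_induction with
  | zero => exact zero
  | add x y hx hy => exact add _ _ hx hy
  | row e l t y c =>
    generalize y ⊗ₜ[k] c = w
    induction w using BarMod.induction_zero with
    | h c => exact row e l t c

/-- `a ⊗ t ↦ row (e a) e' t w`. -/
def rowTwist (r s : ℕ) (e e' : D.Alg) (w : BarMod k A r) :
    A ⊗[k] BarPow k H s →ₗ[k] Bim k D.Alg (Gen k A H r s) :=
  TensorProduct.map (LinearMap.mulLeft k e ∘ₗ D.inA.toLinearMap)
    (LinearMap.lTensor (Gen k A H r s) (LinearMap.mulRight k e' ∘ₗ D.inA.toLinearMap) ∘ₗ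
    (TensorProduct.assoc k (BarPow k H s) (BarPow k A r) A).symm.toLinearMap ∘ₗ
      (TensorProduct.mk k (BarPow k H s) (BarMod k A r)).flip w)

theorem rowTwist_tmul (r s : ℕ) (e e' : D.Alg) (w : BarMod k A r) (a : A) (t : BarPow k H s) :
    D.rowTwist r s e e' w (a ⊗ₜ t) = D.row r s (e * D.inA a) e' t w := rfl

theorem rowTwist_add (r s : ℕ) (e e' : D.Alg) (w w' : BarMod k A r) (z : A ⊗[k] BarPow k H s) :
    D.rowTwist r s e e' (w + w') z = D.rowTwist r s e e' w z + D.rowTwist r s e e' w' z := by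
  induction z using TensorProduct.induction_on with
  | zero => simp only [map_zero, add_zero]
  | add x y hx hy => rw [map_add, map_add, map_add, hx, hy]; abel
  | tmul a t => simp only [rowTwist_tmul, map_add]

/-- In terms of `row`, the differential `d⁰` is the bar differential of `A` with its first term
twisted by `t`. The factor in `A` of the right tensor factor `E` is kept inside `w`, so that
`barMerge` can act on it. -/
theorem extend_d0Gen_row (r s : ℕ) (e e' : D.Alg) (t : BarPow k H s) (a : A) (w : BarMod k A r) :
    extend (D.d0Gen r s) (D.row (r + 1) s e e' t (BarMod.cons k A r (Bar.mk k a ⊗ₜ w))) =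
      D.rowTwist r s e e' w (D.twistPow s a t) - D.row r s e e' t (barMerge k A r a w) := by
  induction w using TensorProduct.induction_on with
  | zero =>
    simp only [TensorProduct.tmul_zero, map_zero, sub_zero]
    generalize D.twistPow s a t = z
    induction z using TensorProduct.induction_on with
    | zero => simp only [map_zero]
    | add x y hx hy => rw [map_add, ← hx, ← hy, add_zero]
    | tmul a t => rw [rowTwist_tmul, map_zero]
  | add x y hx hy =>
    simp only [TensorProduct.tmul_add, map_add, hx, hy, rowTwist_add]
    abel
  | tmul x c =>
    rw [BarMod.cons_tmul, row_tmul, extend_tmul, d0Gen_tmul, d0Step_apply, map_sub]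
    congr 1
    · generalize D.twistPow s a t = z
      induction z using TensorProduct.induction_on with
      | zero => simp only [map_zero]
      | add x y hx hy => simp only [map_add, hx, hy]
      | tmul b t => simp [rowTwist_tmul, row_tmul]
    · have h : (x ⊗ₜ[k] c : BarMod k A r) = BarMod.mulRight k A r c (BarMod.inl r x) := by
        simp [BarMod.inl, BarMod.mulRight]
      rw [h, barMerge_mulRight]
      generalize barMerge k A r a (BarMod.inl r x) = y
      induction y using TensorProduct.induction_on with
      | zero => simp only [map_zero, TensorProduct.tmul_zero]
      | add x y hx hy => simp only [map_add, TensorProduct.tmul_add, hx, hy]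
      | tmul y d => simp [BarMod.mulRight, row_tmul, mul_assoc]

theorem sigma0_row (r s : ℕ) (e : D.Alg) (l : H) (t : BarPow k H s) (w : BarMod k A r) :
    D.sigma0 r s (D.row r s e (D.inH l) t w) =
      (-1 : k) ^ (r + 1) • D.row (r + 1) s e (D.inH l) t (BarMod.snocOne k A r w) := by
  induction w using TensorProduct.induction_on with
  | zero => simp only [map_zero, smul_zero]
  | add x y hx hy => simp only [map_add, smul_add, hx, hy]
  | tmul x c =>
    rw [row_tmul, inA_mul_inH, sigma0_tmul, BarMod.snocOne_apply, row_tmul_one, BarMod.snoc_tmul]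

theorem sigma0_rowTwist (r s : ℕ) (e : D.Alg) (l : H) (w : BarMod k A r)
    (z : A ⊗[k] BarPow k H s) : D.sigma0 r s (D.rowTwist r s e (D.inH l) w z) =
      (-1 : k) ^ (r + 1) • D.rowTwist (r + 1) s e (D.inH l) (BarMod.snocOne k A r w) z := by
  induction z using TensorProduct.induction_on with
  | zero => simp only [map_zero, smul_zero]
  | add x y hx hy => simp only [map_add, smul_add, hx, hy]
  | tmul a t => rw [rowTwist_tmul, sigma0_row, rowTwist_tmul]

/-- The twisted first term of `d⁰` concerns the left end and commutes with appending at the right;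
`barMerge_snocOne` gives the rest, with the sign in `σ` chosen so that the two compositions add up
to `x`. -/
theorem d0_sigma0 (r s : ℕ) (x : Bim k D.Alg (Gen k A H (r + 1) s)) :
    extend (D.d0Gen (r + 1) s) (D.sigma0 (r + 1) s x) +
      D.sigma0 r s (extend (D.d0Gen r s) x) = x := by
  induction x using row_induction_succ with
  | zero => simp only [map_zero, add_zero]
  | add x y hx hy =>
    conv_rhs => rw [← hx, ← hy]
    simp only [map_add]
    abel
  | row e l t a w =>
    rw [sigma0_row, BarMod.snocOne_cons, map_smul, extend_d0Gen_row, extend_d0Gen_row, map_sub,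
      sigma0_row, sigma0_rowTwist, barMerge_snocOne, map_add, map_smul, pow_succ _ (r + 1),
      mul_neg_one, neg_smul, smul_sub, smul_add, smul_smul, neg_one_pow_mul_self, one_smul]
    abel

/-- Besides the multiplicativity of `barMerge` this uses that of the twist: twisting by `a` and then
by `b` is twisting by `ab`. -/
theorem d0_d0 (r s : ℕ) (x : Bim k D.Alg (Gen k A H (r + 2) s)) :
    extend (D.d0Gen r s) (extend (D.d0Gen (r + 1) s) x) = 0 := by
  induction x using row_induction_succ with
  | zero => simp only [map_zero]
  | add x y hx hy => simp only [map_add, hx, hy, add_zero]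
  | row e l t a w =>
    rw [extend_d0Gen_row]
    generalize D.inH l = e'
    induction w using BarMod.induction with
    | zero =>
      simp only [map_zero, sub_zero]
      generalize D.twistPow s a t = z
      induction z using TensorProduct.induction_on with
      | zero => simp only [map_zero]
      | add x y hx hy => simp only [map_add, hx, hy, add_zero]
      | tmul a t => simp only [rowTwist_tmul, map_zero]
    | add x y hx hy =>
      simp only [map_add, rowTwist_add, map_sub] at hx hy ⊢
      rw [add_sub_add_comm, hx, hy, add_zero]
    | cons b w =>
      rw [barMerge_succ, map_sub, map_sub, map_sub, map_sub, extend_d0Gen_row, extend_d0Gen_row,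
        barMerge_mul, twistPow_mul]
      suffices h : ∀ z, extend (D.d0Gen r s) (D.rowTwist (r + 1) s e e'
          (BarMod.cons k A r (Bar.mk k b ⊗ₜ w)) z) =
          D.rowTwist r s e e' w (D.twistMul s b z) -
            D.rowTwist r s e e' (barMerge k A r b w) z by
        rw [h]; abel
      intro z
      induction z using TensorProduct.induction_on with
      | zero => simp only [map_zero, sub_zero]
      | add x y hx hy => simp only [map_add, hx, hy]; abel
      | tmul c t =>
        rw [rowTwist_tmul, extend_d0Gen_row, rowTwist_tmul, twistMul_tmul]
        congr 1
        generalize D.twistPow s b t = z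
        induction z using TensorProduct.induction_on with
        | zero => simp only [map_zero]
        | add x y hx hy => simp only [map_add, hx, hy]
        | tmul c t => rw [lmul_tmul, rowTwist_tmul, rowTwist_tmul, map_mul, mul_assoc]

/-- `a ⊗ (t ⊗ l) ↦ (e a) ⊗ t ⊗ (1 # l) e'`. -/
def relToBim (s : ℕ) (e e' : D.Alg) : Rel k A H s →ₗ[k] Bim k D.Alg (Gen k A H 0 s) :=
  sandwich e e' ∘ₗ TensorProduct.map D.inA.toLinearMap (TensorProduct.map
    ((TensorProduct.mk k (BarPow k H s) (BarPow k A 0)).flip (BarPow.empty k A)) D.inH)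

theorem relToBim_tmul (s : ℕ) (e e' : D.Alg) (a : A) (t : BarPow k H s) (l : H) :
    D.relToBim s e e' (a ⊗ₜ (t ⊗ₜ l)) =
      (e * D.inA a) ⊗ₜ ((t ⊗ₜ BarPow.empty k A) ⊗ₜ (D.inH l * e')) := rfl

/-- `e ⊗ t ⊗ l ↦ e ⊗ t ⊗ (1 # l)`. -/
def sec (s : ℕ) : D.Base s →ₗ[k] Bim k D.Alg (Gen k A H 0 s) :=
  LinearMap.lTensor D.Alg (TensorProduct.map
    ((TensorProduct.mk k (BarPow k H s) (BarPow k A 0)).flip (BarPow.empty k A)) D.inH)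

theorem sec_tmul (s : ℕ) (e : D.Alg) (t : BarPow k H s) (l : H) :
    D.sec s (e ⊗ₜ (t ⊗ₜ l)) = e ⊗ₜ ((t ⊗ₜ BarPow.empty k A) ⊗ₜ D.inH l) := rfl

theorem sec_baseMk (s : ℕ) (e : D.Alg) (w : Rel k A H s) :
    D.sec s (D.baseMk s e w) = D.relToBim s e 1 w := by
  induction w using TensorProduct.induction_on with
  | zero => simp only [map_zero]
  | add x y hx hy => simp only [map_add, hx, hy]
  | tmul a v =>
    induction v using TensorProduct.induction_on with
    | zero => simp only [TensorProduct.tmul_zero, map_zero]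
    | add x y hx hy => simp only [TensorProduct.tmul_add, map_add, hx, hy]
    | tmul t l => rw [baseMk_tmul, sec_tmul, relToBim_tmul, mul_one]

/-- `e ⊗ t ⊗ e' ↦ e ⊗_A (t ⊗ e')`. -/
def mu (s : ℕ) : Bim k D.Alg (Gen k A H 0 s) →ₗ[k] D.Base s :=
  TensorProduct.lift ((D.baseMk s).compl₂ (TensorProduct.lift ((D.relTmul s).flip ∘ₗ
    (TensorProduct.rid k (BarPow k H s)).toLinearMap ∘ₗ
    LinearMap.lTensor (BarPow k H s) (BarPow.scalar k A).toLinearMap)))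

theorem mu_tmul (s : ℕ) (e e' : D.Alg) (t : BarPow k H s) :
    D.mu s (e ⊗ₜ ((t ⊗ₜ BarPow.empty k A) ⊗ₜ e')) = D.baseMk s e (D.relTmul s e' t) := by
  simp [mu, BarPow.scalar_empty]

theorem mu_relToBim (s : ℕ) (e e' : D.Alg) (w : Rel k A H s) :
    D.mu s (D.relToBim s e e' w) = D.baseMk s e (D.relActR s e' w) := by
  induction w using TensorProduct.induction_on with
  | zero => simp only [map_zero]
  | add x y hx hy => simp only [map_add, hx, hy]
  | tmul a v =>
    induction v using TensorProduct.induction_on with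
    | zero => simp only [TensorProduct.tmul_zero, map_zero]
    | add x y hx hy => simp only [TensorProduct.tmul_add, map_add, hx, hy]
    | tmul t l => rw [relToBim_tmul, mu_tmul, baseMk_mul_inA, relActR_tmul]

theorem mu_sec (s : ℕ) (x : D.Base s) : D.mu s (D.sec s x) = x := by
  induction x using TensorProduct.induction_on with
  | zero => simp only [map_zero]
  | add x y hx hy => simp only [map_add, hx, hy]
  | tmul e v =>
    induction v using TensorProduct.induction_on with
    | zero => simp only [TensorProduct.tmul_zero, map_zero]
    | add x y hx hy => simp only [TensorProduct.tmul_add, map_add, hx, hy]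
    | tmul t l => rw [sec_tmul, mu_tmul, relTmul_inH, baseMk_one_tmul]

theorem extend_d1Gen_tmul (s : ℕ) (e e' : D.Alg) (h : H) (t : BarPow k H s) :
    extend (D.d1Gen s) (e ⊗ₜ ((BarPow.cons k H s (Bar.mk k h ⊗ₜ t) ⊗ₜ BarPow.empty k A) ⊗ₜ e')) =
      (e * D.inH h) ⊗ₜ ((t ⊗ₜ BarPow.empty k A) ⊗ₜ e') -
        D.relToBim s e e' (D.hopfMerge s h (BarMod.inl s t)) := by
  rw [extend_tmul, d1Gen_tmul, d1Step_apply, map_sub, sandwich_tmul, one_mul]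
  rfl

/-- The map `d¹` computes `hopfMerge` with a final `1` and multiplies by `e'` afterwards, while
`baseD` acts after `e'` has been put in place. The two orders agree because the left and right
actions on `Rel s` commute. -/
theorem mu_d1 (s : ℕ) (x : Bim k D.Alg (Gen k A H 0 (s + 1))) :
    D.mu s (extend (D.d1Gen s) x) = D.baseD s (D.mu (s + 1) x) := by
  induction x using row_induction_zero with
  | zero => simp only [map_zero]
  | add x y hx hy => simp only [map_add, hx, hy]
  | row e l t c =>
    rw [row_tmul]
    generalize D.inA c * D.inH l = e'
    obtain ⟨t, rfl⟩ := (BarPow.cons k H s).surjective t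
    induction t using TensorProduct.induction_on with
    | zero => simp only [map_zero, TensorProduct.zero_tmul, TensorProduct.tmul_zero]
    | add x y hx hy => simp only [map_add, TensorProduct.add_tmul, TensorProduct.tmul_add, hx, hy]
    | tmul h t =>
      obtain ⟨h, rfl⟩ := Bar.mk_surjective h
      rw [extend_d1Gen_tmul, map_sub, mu_tmul, mu_relToBim, mu_tmul, relTmul_cons,
        baseD_baseMk_relCons, ← relAct_inH_one_tmul, relActR_relAct]
      refine congrArg (fun w => _ - D.baseMk s e (D.relAct s (D.inH h) w)) ?_
      -- Acting by `e'` on the final `1` of `t ⊗ 1` produces `t ⊗ e'`.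
      exact (D.relActR_tmul s e' 1 t 1).trans (by rw [lmul_one, inH_one, one_mul])

/-- The last `d⁰` is the difference between moving `a` to the left of `t`, with the twist, and
leaving it at the right. These two agree in a tensor product over `A`. -/
theorem mu_d0 (s : ℕ) (x : Bim k D.Alg (Gen k A H 1 s)) :
    D.mu s (extend (D.d0Gen 0 s) x) = 0 := by
  induction x using row_induction_succ with
  | zero => simp only [map_zero]
  | add x y hx hy => simp only [map_add, hx, hy, add_zero]
  | row e l t a w =>
    induction w using BarMod.induction_zero with
    | h c =>
      rw [extend_d0Gen_row, barMerge_zero, map_sub, row_tmul, mu_tmul, map_mul D.inA, mul_assoc,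
        relTmul_inA_mul, sub_eq_zero]
      generalize D.twistPow s a t = z
      induction z using TensorProduct.induction_on with
      | zero => simp only [map_zero]
      | add x y hx hy => simp only [map_add, hx, hy]
      | tmul b t =>
        rw [rowTwist_tmul, row_tmul, mu_tmul, baseMk_mul_inA]
        rfl

/-- At `r = 0` the element `d⁰σx` is `x` minus the result of moving the factor `c ∈ A` of the
right-hand `E` across `t`. The latter is the normal form `sec (mu x)`, in which the right-hand
factor lies in `H`. -/
theorem d0_sigma0_zero (s : ℕ) (x : Bim k D.Alg (Gen k A H 0 s)) :
    extend (D.d0Gen 0 s) (D.sigma0 0 s x) + D.sec s (D.mu s x) = x := by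
  induction x using row_induction_zero with
  | zero => simp only [map_zero, add_zero]
  | add x y hx hy =>
    conv_rhs => rw [← hx, ← hy]
    simp only [map_add]
    abel
  | row e l t c =>
    rw [sigma0_row, BarMod.snocOne_empty, map_smul, extend_d0Gen_row, barMerge_zero, mul_one,
      row_tmul, mu_tmul, sec_baseMk, relTmul_inA_mul_inH, pow_succ, pow_zero, one_mul,
      neg_one_smul, neg_sub, sub_add, sub_eq_self, sub_eq_zero]
    generalize D.twistPow s c t = z
    induction z using TensorProduct.induction_on with
    | zero => simp only [map_zero]
    | add x y hx hy => simp only [map_add, hx, hy]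
    | tmul b t =>
      rw [rowTwist_tmul, row_tmul_one, LinearMap.lTensor_tmul]
      exact (D.relToBim_tmul s e 1 b t l).symm ▸ by rw [mul_one]

/-- The section `sec` is only needed against the differentials on the image of `baseS`, where the
last factor is `1`: there `hopfMerge` applied to `t ⊗ 1` enters both sides, and no element of `A`
has to cross it. -/
theorem d1_sec_baseS (s : ℕ) (x : D.Base s) :
    extend (D.d1Gen s) (D.sec (s + 1) (D.baseS s x)) = D.sec s (D.baseD s (D.baseS s x)) := by
  induction x using TensorProduct.induction_on with
  | zero => simp only [map_zero]
  | add x y hx hy => simp only [map_add, hx, hy]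
  | tmul e v =>
    rw [baseS_tmul, BarMod.snocOne_apply, map_smul, map_smul, map_smul, map_smul]
    refine congrArg _ ?_
    generalize BarMod.snoc k H s v = t
    obtain ⟨t, rfl⟩ := (BarPow.cons k H s).surjective t
    induction t using TensorProduct.induction_on with
    | zero => simp only [map_zero, TensorProduct.zero_tmul, TensorProduct.tmul_zero]
    | add x y hx hy => simp only [map_add, TensorProduct.add_tmul, TensorProduct.tmul_add, hx, hy]
    | tmul h t =>
      obtain ⟨h, rfl⟩ := Bar.mk_surjective h
      rw [sec_tmul, extend_d1Gen_tmul, ← BarMod.cons_tmul, baseD_tmul_cons, map_sub, sec_tmul,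
        sec_baseMk]
      rfl

end Row
end CrossedProduct
end Crossed

/-! ### The differential of `X_*` squares to zero -/

section Sums
open Finset
variable {M : Type*} [AddCommMonoid M]

/-- Among the maps into `X_{rs}` only those from indices with at least `s` factors `H̄` are nonzero.
The equality case is the single index `(r + 1, s)`, so this isolates the contribution of `d⁰`. -/
theorem sum_antidiagonal_split {n r s : ℕ} (h : r + s = n) (F : ℕ × ℕ → M)
    (hF : ∀ q ∈ HasAntidiagonal.antidiagonal (n + 1), q.2 < s → F q = 0) :
    ∑ q ∈ HasAntidiagonal.antidiagonal (n + 1), F q =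
      F (r + 1, s) + ∑ q ∈ HasAntidiagonal.antidiagonal (n + 1) with s < q.2, F q := by
  rw [← sum_filter_add_sum_filter_not (HasAntidiagonal.antidiagonal (n + 1)) (fun q => s < q.2), add_comm]
  congr 1
  refine sum_eq_single (r + 1, s) (fun q hq hne => ?_) (fun hq => ?_)
  · rw [mem_filter] at hq
    refine hF q hq.1 ((not_lt.1 hq.2).lt_of_ne fun he => hne ?_)
    have := HasAntidiagonal.mem_antidiagonal.1 hq.1
    exact Prod.ext (by simp only; omega) he
  · refine absurd ?_ hq
    rw [mem_filter, HasAntidiagonal.mem_antidiagonal]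
    exact ⟨by simp only; omega, lt_irrefl _⟩

theorem sum_antidiagonal_filter (n : ℕ) (F : ℕ × ℕ → M) :
    ∑ q ∈ HasAntidiagonal.antidiagonal (n + 1) with n < q.2, F q = F (0, n + 1) := by
  refine sum_eq_single (0, n + 1) (fun q hq hne => absurd ?_ hne) (fun hq => absurd ?_ hq)
  · rw [mem_filter, HasAntidiagonal.mem_antidiagonal] at hq
    exact Prod.ext (by simp only; omega) (by simp only; omega)
  · rw [mem_filter, HasAntidiagonal.mem_antidiagonal]
    exact ⟨by simp only; omega, n.lt_succ_self⟩

end Sums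

section Crossed
variable {k A H : Type u} [CommRing k] [Ring A] [Algebra k A] [Ring H] [Bialgebra k H]

namespace CrossedProduct
open WeakActionWithMap
variable (D : CrossedProduct k A H)

section Square
open Finset

theorem dGen_d0 (r s : ℕ) : D.dGen (r + 1) s r s = D.d0Gen r s := by
  rw [dGen, if_neg (by omega), dBase_d0]

theorem dGen_d1 (s : ℕ) : D.dGen 0 (s + 1) 0 s = D.d1Gen s := by
  rw [dGen, if_neg (by omega), dBase_d1]

theorem dGen_eq_zero {r s r' s' : ℕ} (h : r' + s' + 1 = r + s → s < s') :
    D.dGen r s r' s' = 0 := by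
  rw [dGen, if_neg (by omega), dBase, dif_neg (by omega), dif_neg (by omega)]

/-- The defining recursion, with the sum over the intermediate positions of total degree `n` in
place of `j`. Positions with more than `s` factors `H̄` contribute zero, so they may be included;
the condition `0 < r + j` is what makes `r + j - 1` a true subtraction. -/
theorem dGen_succ {n r s r' s' : ℕ} (hn : r + s = n + 1) (hn' : r' + 1 + s' = n) (hs : s' < s)
    (x : Gen k A H r s) : D.dGen r s (r' + 1) s' x =
      -D.sigma0 r' s' (∑ q ∈ HasAntidiagonal.antidiagonal n with s' < q.2,
        extend (D.dGen q.1 q.2 r' s') (D.dGen r s q.1 q.2 x)) := by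
  rw [dGen, if_pos (by omega)]
  simp only [LinearMap.neg_apply, LinearMap.comp_apply, LinearMap.sum_apply]
  refine congrArg (fun y => -D.sigma0 r' s' y) ?_
  have h := Fin.sum_univ_eq_sum_range (fun j => (if 0 < r + j then
      extend (D.dGen (r + j - 1) (s - j) r' s') ∘ₗ D.dGen r s (r + j - 1) (s - j) else 0) x) (s - s')
  refine h.trans ?_
  have h2 : ∑ q ∈ HasAntidiagonal.antidiagonal n with s' < q.2,
      extend (D.dGen q.1 q.2 r' s') (D.dGen r s q.1 q.2 x) =
      ∑ q ∈ HasAntidiagonal.antidiagonal n with s' < q.2 ∧ q.2 ≤ s,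
      extend (D.dGen q.1 q.2 r' s') (D.dGen r s q.1 q.2 x) := by
    refine (sum_subset (fun q hq => ?_) (fun q hq hq' => ?_)).symm
    · rw [mem_filter] at hq ⊢
      exact ⟨hq.1, hq.2.1⟩
    · rw [mem_filter] at hq hq'
      rw [D.dGen_eq_zero (r := r) (s := s) (fun _ => by
        by_contra hc; exact hq' ⟨hq.1, hq.2, not_lt.1 hc⟩), LinearMap.zero_apply, map_zero]
  rw [h2]
  have h3 : ∀ j, (if 0 < r + j then
      extend (D.dGen (r + j - 1) (s - j) r' s') ∘ₗ D.dGen r s (r + j - 1) (s - j) else 0) x =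
      if 0 < r + j then
        extend (D.dGen (r + j - 1) (s - j) r' s') (D.dGen r s (r + j - 1) (s - j) x) else 0 := by
    intro j
    split_ifs <;> rfl
  simp only [h3]
  rw [← sum_filter]
  refine sum_nbij' (fun j => (r + j - 1, s - j)) (fun q => s - q.2) ?_ ?_ ?_ ?_ ?_
  · intro j hj
    simp only [mem_filter, mem_range, HasAntidiagonal.mem_antidiagonal] at hj ⊢
    omega
  · intro q hq
    simp only [mem_filter, mem_range, HasAntidiagonal.mem_antidiagonal] at hq ⊢
    omega
  · intro j hj
    simp only [mem_filter, mem_range] at hj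
    simp only
    omega
  · intro q hq
    simp only [mem_filter, HasAntidiagonal.mem_antidiagonal] at hq
    exact Prod.ext (by simp only; omega) (by simp only; omega)
  · intro j hj
    rfl

theorem sum_dGen_dGen_split {n r s r' s' : ℕ} (h : r' + s' = n) (x : Gen k A H r s) :
    ∑ q ∈ HasAntidiagonal.antidiagonal (n + 1), extend (D.dGen q.1 q.2 r' s') (D.dGen r s q.1 q.2 x) =
      extend (D.d0Gen r' s') (D.dGen r s (r' + 1) s' x) +
      ∑ q ∈ HasAntidiagonal.antidiagonal (n + 1) with s' < q.2,
        extend (D.dGen q.1 q.2 r' s') (D.dGen r s q.1 q.2 x) := by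
  rw [sum_antidiagonal_split h, dGen_d0]
  intro q _ hq
  rw [D.dGen_eq_zero (s := q.2) (fun _ => hq), extend_zero, LinearMap.zero_apply]

theorem sum_extend_extend {n r s r' s' : ℕ} (h : ∀ x : Gen k A H r s, ∑ q ∈ HasAntidiagonal.antidiagonal n,
      extend (D.dGen q.1 q.2 r' s') (D.dGen r s q.1 q.2 x) = 0) (x : Bim k D.Alg (Gen k A H r s)) :
    ∑ q ∈ HasAntidiagonal.antidiagonal n,
      extend (D.dGen q.1 q.2 r' s') (extend (D.dGen r s q.1 q.2) x) = 0 := by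
  have h2 : ∑ q ∈ HasAntidiagonal.antidiagonal n, extend (D.dGen q.1 q.2 r' s') ∘ₗ D.dGen r s q.1 q.2 = 0 :=
    LinearMap.ext fun x => by
      simpa only [LinearMap.sum_apply, LinearMap.comp_apply, LinearMap.zero_apply] using h x
  have h3 := LinearMap.congr_fun (congrArg extend h2) x
  rw [extend_sum, extend_zero, LinearMap.sum_apply, LinearMap.zero_apply] at h3
  simpa only [extend_extend] using h3

theorem dGen_dGen_of_le {n r s r' s' : ℕ} (hn : r + s = n + 2) (hn' : r' + s' = n) (hs : s ≤ s')
    (x : Gen k A H r s) : ∑ q ∈ HasAntidiagonal.antidiagonal (n + 1),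
      extend (D.dGen q.1 q.2 r' s') (D.dGen r s q.1 q.2 x) = 0 := by
  rw [D.sum_dGen_dGen_split hn', sum_eq_zero, add_zero]
  · rcases hs.lt_or_eq with hs | rfl
    · rw [D.dGen_eq_zero (fun _ => hs), LinearMap.zero_apply, map_zero]
    · obtain rfl : r = r' + 2 := by omega
      have := D.d0_d0 r' s (Bim.unit k D.Alg _ x)
      rwa [extend_unit, ← dGen_d0 D (r' + 1)] at this
  · intro q hq
    rw [mem_filter] at hq
    rw [D.dGen_eq_zero (r := r) (fun _ => hs.trans_lt hq.2), LinearMap.zero_apply, map_zero]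

/-- At the end `r' = 0` of a row only `d⁰` from `(1, n)` and `d¹` from `(0, n + 1)` arrive. By the
recursion and `d⁰σ = 1 - sec ∘ mu` their sum vanishes once `mu` kills the `d¹` term. Since `mu d¹ =
baseD mu`, this follows from `mu d⁰ = 0` if the first map is `d⁰`, and from `baseD² = 0` if it is
`d¹`. -/
theorem dGen_dGen_zero {n r s : ℕ} (hn : r + s = n + 2) (hs : n < s)
    (x : Gen k A H r s) : ∑ q ∈ HasAntidiagonal.antidiagonal (n + 1),
      extend (D.dGen q.1 q.2 0 n) (D.dGen r s q.1 q.2 x) = 0 := by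
  rw [D.sum_dGen_dGen_split (zero_add n), D.dGen_succ (n := n + 1) hn (by omega) hs,
    sum_antidiagonal_filter, dGen_d1, map_neg, neg_add_eq_zero]
  have h2 := D.d0_sigma0_zero n (extend (D.d1Gen n) (D.dGen r s 0 (n + 1) x))
  suffices h : D.baseD n (D.mu (n + 1) (D.dGen r s 0 (n + 1) x)) = 0 by
    rwa [mu_d1, h, map_zero, add_zero] at h2
  obtain hs' | hs' : s = n + 1 ∨ s = n + 2 := by omega
  · obtain rfl : r = 1 := by omega
    subst hs'
    have := D.mu_d0 (n + 1) (Bim.unit k D.Alg _ x)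
    rw [extend_unit, ← dGen_d0] at this
    exact (congrArg _ this).trans (map_zero _)
  · obtain rfl : r = 0 := by omega
    subst hs'
    have := D.mu_d1 (n + 1) (Bim.unit k D.Alg _ x)
    rw [extend_unit, ← dGen_d1] at this
    exact (congrArg _ this).trans (D.baseD_baseD n _)

/-- The usual obstruction argument. Let `y` be the sum of all terms other than the one ending with
`d⁰`; by the recursion that one is `-d⁰σy`, so it has to be shown that `y` is a `d⁰`-cycle.
Induction on the total degree rewrites `d⁰` of each term of `y`, and induction on `r'` kills the
resulting sums. -/
theorem dGen_dGen {n r s r' s' : ℕ} (hn : r + s = n + 2) (hn' : r' + s' = n)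
    (x : Gen k A H r s) : ∑ q ∈ HasAntidiagonal.antidiagonal (n + 1),
      extend (D.dGen q.1 q.2 r' s') (D.dGen r s q.1 q.2 x) = 0 := by
  rcases le_or_gt s s' with hs | hs
  · exact D.dGen_dGen_of_le hn hn' hs x
  induction n generalizing r s r' s' with
  | zero =>
    obtain ⟨rfl, rfl⟩ : r' = 0 ∧ s' = 0 := by omega
    exact D.dGen_dGen_zero hn hs x
  | succ n ihn =>
    -- The condition `s' < s` had become part of the induction hypothesis; the case already settled
    -- removes it.
    replace ihn : ∀ (r s r' s' : ℕ), r + s = n + 2 → r' + s' = n → ∀ x : Gen k A H r s,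
        ∑ q ∈ HasAntidiagonal.antidiagonal (n + 1),
          extend (D.dGen q.1 q.2 r' s') (D.dGen r s q.1 q.2 x) = 0 := by
      intro r s r' s' hn hn' x
      rcases le_or_gt s s' with hs | hs
      · exact D.dGen_dGen_of_le hn hn' hs x
      · exact ihn hn hn' x hs
    induction r' using Nat.strong_induction_on generalizing s' with
    | _ r' ih =>
      cases r' with
      | zero =>
        obtain rfl : s' = n + 1 := by omega
        exact D.dGen_dGen_zero hn hs x
      | succ r' =>
        rw [D.sum_dGen_dGen_split hn', D.dGen_succ (n := n + 2) hn (by omega) hs, map_neg,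
          neg_add_eq_zero]
        set y := ∑ q ∈ HasAntidiagonal.antidiagonal (n + 1 + 1) with s' < q.2,
          extend (D.dGen q.1 q.2 (r' + 1) s') (D.dGen r s q.1 q.2 x) with hy
        suffices h : extend (D.d0Gen r' s') y = 0 by
          have h2 := D.d0_sigma0 r' s' y
          rwa [h, map_zero, add_zero] at h2
        -- The vanishing of the square from `q` to `(r', s')`, where the total degree is one less,
        -- expresses `d⁰` after the component from `q` through the other intermediate positions `u`.
        have h1 : ∀ q ∈ (HasAntidiagonal.antidiagonal (n + 1 + 1)).filter (fun q => s' < q.2),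
            extend (D.d0Gen r' s')
              (extend (D.dGen q.1 q.2 (r' + 1) s') (D.dGen r s q.1 q.2 x)) =
            -∑ u ∈ HasAntidiagonal.antidiagonal (n + 1) with s' < u.2,
              extend (D.dGen u.1 u.2 r' s')
                (extend (D.dGen q.1 q.2 u.1 u.2) (D.dGen r s q.1 q.2 x)) := by
          intro q hq
          rw [mem_filter, HasAntidiagonal.mem_antidiagonal] at hq
          have h2 := D.sum_extend_extend (ihn q.1 q.2 r' s' hq.1 (by omega))
            (D.dGen r s q.1 q.2 x)
          rw [sum_antidiagonal_split (r := r') (s := s') (by omega), dGen_d0] at h2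
          · exact eq_neg_of_add_eq_zero_left h2
          · intro u _ hu
            rw [D.dGen_eq_zero (s := u.2) (fun _ => hu), extend_zero, LinearMap.zero_apply]
        -- With the order of summation exchanged, the inner sum for each `u` is a component of the
        -- square ending at `u`. As `u` has more than `s'` factors `H̄` and the same total degree as
        -- the original target, its first index is smaller, and the induction applies.
        rw [hy, map_sum, sum_congr rfl h1, sum_neg_distrib, sum_comm, neg_eq_zero]
        refine sum_eq_zero fun u hu => ?_
        rw [mem_filter, HasAntidiagonal.mem_antidiagonal] at hu
        rw [← map_sum]
        refine (congrArg _ ?_).trans (map_zero _)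
        have h3 : ∑ q ∈ HasAntidiagonal.antidiagonal (n + 1 + 1),
            extend (D.dGen q.1 q.2 u.1 u.2) (D.dGen r s q.1 q.2 x) = 0 := by
          rcases le_or_gt s u.2 with hs' | hs'
          · exact D.dGen_dGen_of_le hn hu.1 hs' x
          · exact ih u.1 (by omega) hu.1 hs'
        rw [← h3]
        -- The positions left out have `q.2 ≤ s' < u.2`, and no component of the differential raises
        -- the number of factors `H̄`.
        refine sum_subset (filter_subset _ _) fun q hq hq' => ?_
        rw [D.dGen_eq_zero (s := q.2) (s' := u.2) (fun _ => ?_), extend_zero, LinearMap.zero_apply]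
        by_contra hc
        exact hq' (mem_filter.2 ⟨hq, by omega⟩)

end Square

end CrossedProduct
end Crossed

/-! ### A contracting homotopy of the total complex, by perturbation -/

section Crossed
variable {k A H : Type u} [CommRing k] [Ring A] [Algebra k A] [Ring H] [Bialgebra k H]

namespace CrossedProduct
open WeakActionWithMap
variable (D : CrossedProduct k A H)

section Contraction
open Finset

/-- The product of all the bimodules `X_{rs}`. -/
abbrev Tot : Type u := ∀ p : ℕ × ℕ, Bim k D.Alg (Gen k A H p.1 p.2)

/-- The differential of `Tot`. -/
def totD : D.Tot →ₗ[k] D.Tot :=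
  LinearMap.pi fun q => ∑ p ∈ HasAntidiagonal.antidiagonal (q.1 + q.2 + 1),
    extend (D.dGen p.1 p.2 q.1 q.2) ∘ₗ LinearMap.proj p

theorem totD_apply {n : ℕ} (z : D.Tot) (q : ℕ × ℕ) (hq : q.1 + q.2 = n) : D.totD z q =
    ∑ p ∈ HasAntidiagonal.antidiagonal (n + 1), extend (D.dGen p.1 p.2 q.1 q.2) (z p) := by
  subst hq
  simp [totD]

theorem totD_totD (z : D.Tot) : D.totD (D.totD z) = 0 := by
  funext q
  rw [totD_apply D _ q rfl]
  have h : ∀ p ∈ HasAntidiagonal.antidiagonal (q.1 + q.2 + 1),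
      extend (D.dGen p.1 p.2 q.1 q.2) (D.totD z p) =
      ∑ u ∈ HasAntidiagonal.antidiagonal (q.1 + q.2 + 2), extend (D.dGen p.1 p.2 q.1 q.2)
        (extend (D.dGen u.1 u.2 p.1 p.2) (z u)) := by
    intro p hp
    rw [totD_apply D _ p (HasAntidiagonal.mem_antidiagonal.1 hp), map_sum]
  rw [sum_congr rfl h, sum_comm]
  exact sum_eq_zero fun u hu => D.sum_extend_extend
    (D.dGen_dGen (HasAntidiagonal.mem_antidiagonal.1 hu) rfl) _

/-- The homotopy of `X_{0s}`, `τ` conjugated with `mu`. -/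
def columnHomotopy (s : ℕ) : Bim k D.Alg (Gen k A H 0 s) →ₗ[k] Bim k D.Alg (Gen k A H 0 (s + 1)) :=
  D.sec (s + 1) ∘ₗ D.baseS s ∘ₗ D.mu s

/-- A contracting homotopy of `Tot`, up to a map that lowers the filtration. -/
def totH : D.Tot →ₗ[k] D.Tot :=
  LinearMap.pi fun q => match q with
    | (r + 1, s) => D.sigma0 r s ∘ₗ LinearMap.proj (r, s)
    | (0, s + 1) => D.columnHomotopy s ∘ₗ LinearMap.proj (0, s)
    | (0, 0) => 0

theorem totH_succ (z : D.Tot) (r s : ℕ) : D.totH z (r + 1, s) = D.sigma0 r s (z (r, s)) := rfl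

theorem totH_zero_succ (z : D.Tot) (s : ℕ) :
    D.totH z (0, s + 1) = D.sec (s + 1) (D.baseS s (D.mu s (z (0, s)))) := rfl

theorem totH_zero_zero (z : D.Tot) : D.totH z (0, 0) = 0 := rfl

/-- `e ↦ e ⊗ 1`. -/
def totInit : D.Alg →ₗ[k] Bim k D.Alg (Gen k A H 0 0) :=
  D.sec 0 ∘ₗ (TensorProduct.mk k _ _).flip (BarPow.empty k H ⊗ₜ 1)

theorem totInit_apply (e : D.Alg) : D.totInit e = D.sec 0 (e ⊗ₜ (BarPow.empty k H ⊗ₜ 1)) := rfl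

/-- The augmentation of `Tot`. -/
def totAug : Bim k D.Alg (Gen k A H 0 0) →ₗ[k] D.Alg := D.baseAug ∘ₗ D.mu 0

theorem totAug_apply (x : Bim k D.Alg (Gen k A H 0 0)) : D.totAug x = D.baseAug (D.mu 0 x) := rfl

theorem totAug_totInit (e : D.Alg) : D.totAug (D.totInit e) = e := by
  rw [totInit_apply, totAug_apply, mu_sec, baseAug_tmul, inH_one, mul_one]

/-- The projection of `Tot` onto the image of `totInit`. -/
def totP : D.Tot →ₗ[k] D.Tot :=
  LinearMap.pi fun q => match q with
    | (0, 0) => D.totInit ∘ₗ D.totAug ∘ₗ LinearMap.proj (0, 0)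
    | (_ + 1, _) => 0
    | (0, _ + 1) => 0

theorem totP_zero (z : D.Tot) : D.totP z (0, 0) = D.totInit (D.totAug (z (0, 0))) := rfl

theorem totP_of_ne (z : D.Tot) {q : ℕ × ℕ} (hq : q.1 + q.2 ≠ 0) : D.totP z q = 0 := by
  obtain ⟨_ | r, _ | s⟩ := q
  · exact absurd rfl hq
  · rfl
  · rfl
  · rfl

theorem totD_zero (z : D.Tot) (s : ℕ) : D.totD z (0, s) =
    extend (D.d0Gen 0 s) (z (1, s)) + extend (D.d1Gen s) (z (0, s + 1)) := by
  rw [totD_apply D z (0, s) (zero_add s), sum_antidiagonal_split (zero_add s),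
    sum_antidiagonal_filter, dGen_d0, dGen_d1]
  intro p _ hp
  rw [D.dGen_eq_zero (s := p.2) (fun _ => hp), extend_zero, LinearMap.zero_apply]

theorem mu_totD (z : D.Tot) (s : ℕ) :
    D.mu s (D.totD z (0, s)) = D.baseD s (D.mu (s + 1) (z (0, s + 1))) := by
  rw [totD_zero, map_add, mu_d0, mu_d1, zero_add]

theorem totP_totD (z : D.Tot) : D.totP (D.totD z) = 0 := by
  funext q
  by_cases hq : q.1 + q.2 = 0
  · obtain ⟨r, s⟩ := q
    obtain ⟨rfl, rfl⟩ : r = 0 ∧ s = 0 := by simp only at hq; omega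
    rw [totP_zero, totAug_apply, mu_totD, baseAug_baseD, map_zero]
    rfl
  · exact D.totP_of_ne _ hq

theorem totD_totP (z : D.Tot) : D.totD (D.totP z) = 0 := by
  funext q
  rw [totD_apply D _ q rfl]
  refine sum_eq_zero fun p hp => ?_
  rw [HasAntidiagonal.mem_antidiagonal] at hp
  rw [D.totP_of_ne _ (by omega), map_zero]

/-- `totU - 1` lowers the filtration. -/
def totU : D.Tot →ₗ[k] D.Tot := D.totD ∘ₗ D.totH + D.totH ∘ₗ D.totD + D.totP

theorem totU_apply (z : D.Tot) :
    D.totU z = D.totD (D.totH z) + D.totH (D.totD z) + D.totP z := rfl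

/-- On the indices `(0, s)` there is no error. There `dh` contributes `d⁰σ + sec ∘ baseD ∘ baseS ∘
mu`, and `hd + p` contributes `sec` applied to the other half of the contraction of the relative bar
complex, so the sum is `d⁰σ + sec ∘ mu = 1`. -/
theorem totU_zero (z : D.Tot) (s : ℕ) : D.totU z (0, s) = z (0, s) := by
  have h := D.d0_sigma0_zero s (z (0, s))
  rw [totU_apply]
  simp only [Pi.add_apply]
  rw [totD_zero, totH_zero_succ, d1_sec_baseS]
  replace h : extend (D.d0Gen 0 s) (D.totH z (1, s)) + D.sec s (D.mu s (z (0, s))) = z (0, s) := h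
  cases s with
  | zero =>
    have h2 := D.baseD_baseS_zero (D.mu 0 (z (0, 0)))
    rw [totH_zero_zero, totP_zero, totInit_apply, totAug_apply, add_zero, add_assoc, ← map_add, h2,
      h]
  | succ s =>
    have h2 := D.baseD_baseS s (D.mu (s + 1) (z (0, s + 1)))
    rw [totH_zero_succ, mu_totD, D.totP_of_ne _ (by simp only; omega), add_zero, add_assoc,
      ← map_add, h2, h]

/-- The error `U - 1` at `q` depends only on components of the same total degree with smaller first
index, that is, with more factors `H̄`. Indeed the `d⁰` parts of `dh + hd` give the identity by
`d0_sigma0`, and every other part of `d` lowers the number of factors `H̄`. -/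
theorem totU_of_eq_zero (z : D.Tot) (q : ℕ × ℕ)
    (h : ∀ p : ℕ × ℕ, p.1 + p.2 = q.1 + q.2 → p.1 < q.1 → z p = 0) : D.totU z q = z q := by
  obtain ⟨_ | r, s⟩ := q
  · exact D.totU_zero z s
  rw [totU_apply]
  simp only [Pi.add_apply]
  simp only at h
  rw [D.totP_of_ne _ (by simp only; omega), add_zero, totH_succ, totD_apply D z (r, s) rfl,
    totD_apply D _ (r + 1, s) rfl, sum_antidiagonal_split (r := r) (s := s) rfl,
    sum_antidiagonal_split (r := r + 1) (s := s) rfl, dGen_d0, dGen_d0, totH_succ,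
    sum_eq_zero, sum_eq_zero, add_zero, add_zero, d0_sigma0]
  · intro p hp
    rw [mem_filter, HasAntidiagonal.mem_antidiagonal] at hp
    rw [h p (by omega) (by omega), map_zero]
  · intro p hp
    rw [mem_filter, HasAntidiagonal.mem_antidiagonal] at hp
    refine (congrArg _ ?_).trans (map_zero _)
    obtain ⟨_ | p, _ | t⟩ := p
    · rfl
    · rw [totH_zero_succ, h (0, t) (by simp only at hp ⊢; omega) (Nat.succ_pos r),
        map_zero, map_zero, map_zero]
    · simp only at hp; omega
    · rw [totH_succ, h (p, t + 1) (by simp only at hp ⊢; omega) (by simp only at hp ⊢; omega),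
        map_zero]
  · intro p _ hp
    rw [D.dGen_eq_zero (s := p.2) (fun _ => hp), extend_zero, LinearMap.zero_apply]
  · intro p _ hp
    rw [D.dGen_eq_zero (s := p.2) (fun _ => hp), extend_zero, LinearMap.zero_apply]

theorem totD_totU (z : D.Tot) : D.totD (D.totU z) = D.totU (D.totD z) := by
  rw [totU_apply, totU_apply, map_add, map_add, totD_totD, totD_totP, totD_totD, totP_totD,
    map_zero, zero_add, add_zero, add_zero]

/-- Apply `totU_of_eq_zero` to the difference, which vanishes in the whole total degree. -/
theorem totU_local (z z' : D.Tot) (q : ℕ × ℕ)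
    (h : ∀ p : ℕ × ℕ, p.1 + p.2 = q.1 + q.2 → z p = z' p) : D.totU z q = D.totU z' q := by
  have := D.totU_of_eq_zero (z - z') q (fun p hp _ => by rw [Pi.sub_apply, h p hp, sub_self])
  rw [map_sub, Pi.sub_apply, Pi.sub_apply, h q rfl, sub_self] at this
  exact sub_eq_zero.1 this

theorem totU_injective : Function.Injective D.totU := by
  refine (injective_iff_map_eq_zero D.totU).2 fun z hz => ?_
  have h : ∀ n, ∀ q : ℕ × ℕ, q.1 = n → z q = 0 := by
    intro n
    induction n using Nat.strong_induction_on with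
    | _ n ih =>
      rintro q rfl
      rw [← D.totU_of_eq_zero z q (fun p _ hp => ih p.1 hp p rfl), hz]
      rfl
  exact funext fun q => h q.1 q rfl

/-- Each application of `1 - U` clears one more value of the first index, starting with `0`. -/
theorem one_sub_totU_pow (m : ℕ) (z : D.Tot) (q : ℕ × ℕ) (hq : q.1 < m) :
    ((1 - D.totU) ^ m) z q = 0 := by
  induction m generalizing q with
  | zero => exact absurd hq (Nat.not_lt_zero _)
  | succ m ih =>
    rw [pow_succ', Module.End.mul_apply, LinearMap.sub_apply, Module.End.one_apply, Pi.sub_apply,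
      D.totU_of_eq_zero _ q (fun p _ hp => ih p (by omega)), sub_self]

/-- The preimage is the geometric series of `1 - U` applied to `z`. It need not be finite on the
product, but it is finite in each component. -/
theorem totU_surjective : Function.Surjective D.totU := by
  intro z
  let W : ℕ → D.Tot := fun n => (∑ m ∈ range n, (1 - D.totU) ^ m) z
  have hW : ∀ (n : ℕ) (p : ℕ × ℕ), p.1 < n → W n p = W (p.1 + 1) p := by
    intro n p hp
    simp only [W, LinearMap.sum_apply, Finset.sum_apply]
    refine (sum_subset (range_mono hp) fun m _ hm => ?_).symm
    exact D.one_sub_totU_pow m z p (by rw [mem_range] at hm; omega)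
  -- At `q` the terms with exponent above `q.1` vanish. To apply `U`, the preimage is replaced by
  -- one partial sum of length `q.1 + q.2 + 1`, which agrees with it in the whole total degree of
  -- `q`.
  refine ⟨fun q => W (q.1 + 1) q, funext fun q => ?_⟩
  rw [D.totU_local _ (W (q.1 + q.2 + 1)) q (fun p hp => (hW _ p (by omega)).symm)]
  have h := LinearMap.congr_fun (mul_neg_geom_sum (1 - D.totU) (q.1 + q.2 + 1)) z
  rw [sub_sub_cancel, Module.End.mul_apply] at h
  refine (congrFun h q).trans ?_
  rw [LinearMap.sub_apply, Module.End.one_apply, Pi.sub_apply,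
    D.one_sub_totU_pow _ z q (by omega), sub_zero]

/-- `totU`, as an automorphism. -/
def totUEquiv : D.Tot ≃ₗ[k] D.Tot := LinearEquiv.ofBijective D.totU
  ⟨D.totU_injective, D.totU_surjective⟩

/-- A contracting homotopy of the augmented complex `Tot`. -/
def totS : D.Tot →ₗ[k] D.Tot := D.totH ∘ₗ D.totUEquiv.symm.toLinearMap

theorem totP_totU (z : D.Tot) : D.totP (D.totU z) = D.totP z := by
  funext q
  by_cases hq : q.1 + q.2 = 0
  · obtain ⟨r, s⟩ := q
    obtain ⟨rfl, rfl⟩ : r = 0 ∧ s = 0 := by simp only at hq; omega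
    rw [totP_zero, totP_zero, totU_zero]
  · rw [D.totP_of_ne _ hq, D.totP_of_ne _ hq]

/-- Since `U` commutes with `d` and `pU = p`, composing `dh + hd = U - p` with `U⁻¹` gives `ds + sd
= 1 - p`. -/
theorem totD_totS (z : D.Tot) : D.totD (D.totS z) = z - D.totP z - D.totS (D.totD z) := by
  obtain ⟨z, rfl⟩ := D.totUEquiv.surjective z
  have h : D.totD (D.totUEquiv z) = D.totUEquiv (D.totD z) := D.totD_totU z
  rw [h]
  simp only [totS, LinearMap.comp_apply, LinearEquiv.coe_coe, LinearEquiv.symm_apply_apply]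
  rw [eq_sub_iff_add_eq, eq_sub_iff_add_eq, show D.totP (D.totUEquiv z) = D.totP z from
    D.totP_totU z]
  rfl

end Contraction
end CrossedProduct
end Crossed

/-! ### Assembling the resolution, degree by degree -/

section FreeMap
variable {k : Type u} [CommRing k] {B : Type u} [Ring B] [Algebra k B]
  {U V W : Type u} [AddCommGroup U] [Module k U] [AddCommGroup V] [Module k V] [AddCommGroup W]
  [Module k W]

variable (B) in
/-- The bimodule map `B ⊗ V ⊗ B → B ⊗ W ⊗ B` induced by a linear map `V → W`. -/
def Bim.map (f : V →ₗ[k] W) : Bim k B V →ₗ[k] Bim k B W :=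
  LinearMap.lTensor B (LinearMap.rTensor B f)

@[simp] theorem Bim.map_tmul (f : V →ₗ[k] W) (b c : B) (v : V) :
    Bim.map B f (b ⊗ₜ (v ⊗ₜ c)) = b ⊗ₜ (f v ⊗ₜ c) := rfl

theorem Bim.map_map (f : V →ₗ[k] W) (g : U →ₗ[k] V) (x : Bim k B U) :
    Bim.map B f (Bim.map B g x) = Bim.map B (f ∘ₗ g) x :=
  LinearMap.congr_fun (Bim.hom_ext (f := Bim.map B f ∘ₗ Bim.map B g) (g := Bim.map B (f ∘ₗ g))
    fun _ _ _ => rfl) x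

theorem Bim.map_id (x : Bim k B V) : Bim.map B LinearMap.id x = x :=
  LinearMap.congr_fun (Bim.hom_ext (f := Bim.map B LinearMap.id) (g := LinearMap.id)
    fun _ _ _ => rfl) x

theorem Bim.map_zero (x : Bim k B V) : Bim.map B (0 : V →ₗ[k] W) x = 0 :=
  LinearMap.congr_fun (Bim.hom_ext (f := Bim.map B (0 : V →ₗ[k] W)) (g := 0)
    fun _ _ _ => by simp) x

theorem Bim.map_sum {ι : Type*} (t : Finset ι) (f : ι → V →ₗ[k] W) (x : Bim k B V) :
    Bim.map B (∑ i ∈ t, f i) x = ∑ i ∈ t, Bim.map B (f i) x := by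
  refine LinearMap.congr_fun (Bim.hom_ext (f := Bim.map B (∑ i ∈ t, f i))
    (g := ∑ i ∈ t, Bim.map B (f i)) fun _ _ _ => ?_) x |>.trans (LinearMap.sum_apply _ _ _)
  simp [TensorProduct.sum_tmul, TensorProduct.tmul_sum]

theorem extend_map (g : V →ₗ[k] Bim k B W) (f : U →ₗ[k] V) (x : Bim k B U) :
    extend g (Bim.map B f x) = extend (g ∘ₗ f) x :=
  LinearMap.congr_fun (Bim.hom_ext (f := extend g ∘ₗ Bim.map B f) (g := extend (g ∘ₗ f))
    fun _ _ _ => by simp) x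

theorem map_sandwich (f : V →ₗ[k] W) (b c : B) (x : Bim k B V) :
    Bim.map B f (sandwich b c x) = sandwich (k := k) b c (Bim.map B f x) := by
  induction x using Bim.induction with
  | zero => simp only [_root_.map_zero]
  | add x y hx hy => simp only [map_add, hx, hy]
  | tmul d v e => rfl

theorem map_extend (f : V →ₗ[k] W) (g : U →ₗ[k] Bim k B V) (x : Bim k B U) :
    Bim.map B f (extend g x) = extend (Bim.map B f ∘ₗ g) x :=
  LinearMap.congr_fun (Bim.hom_ext (f := Bim.map B f ∘ₗ extend g) (g := extend (Bim.map B f ∘ₗ g))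
    fun _ _ _ => by
      rw [LinearMap.comp_apply, extend_tmul, extend_tmul, map_sandwich, LinearMap.comp_apply]) x

variable (N : Type u) [AddCommGroup N] [Module k N] [Module B N] [Module Bᵐᵒᵖ N]
  [IsScalarTower k B N] [IsScalarTower k Bᵐᵒᵖ N] [SMulCommClass B Bᵐᵒᵖ N]

theorem evaluate_map (φ : W →ₗ[k] N) (f : V →ₗ[k] W) (x : Bim k B V) :
    evaluate N φ (Bim.map B f x) = evaluate N (φ ∘ₗ f) x :=
  LinearMap.congr_fun (Bim.hom_ext (f := evaluate N φ ∘ₗ Bim.map B f) (g := evaluate N (φ ∘ₗ f))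
    fun _ _ _ => by simp) x

theorem contract_map (f : V →ₗ[k] W) (m : N) (x : Bim k B V) :
    contract N m (Bim.map B f x) = LinearMap.lTensor N f (contract N m x) :=
  LinearMap.congr_fun (Bim.hom_ext (f := contract N m ∘ₗ Bim.map B f)
    (g := LinearMap.lTensor N f ∘ₗ contract N m) fun _ _ _ => by simp) x

theorem lTensor_chainMap (f : V →ₗ[k] W) (g : U →ₗ[k] Bim k B V) (x : N ⊗[k] U) :
    LinearMap.lTensor N f (chainMap N g x) = chainMap N (Bim.map B f ∘ₗ g) x :=
  LinearMap.congr_fun (TensorProduct.ext' (g := LinearMap.lTensor N f ∘ₗ chainMap N g)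
    (h := chainMap N (Bim.map B f ∘ₗ g)) fun _ _ => by simp [contract_map]) x

theorem chainMap_lTensor (f : U →ₗ[k] V) (g : V →ₗ[k] Bim k B W) (x : N ⊗[k] U) :
    chainMap N g (LinearMap.lTensor N f x) = chainMap N (g ∘ₗ f) x :=
  LinearMap.congr_fun (TensorProduct.ext' (g := chainMap N g ∘ₗ LinearMap.lTensor N f)
    (h := chainMap N (g ∘ₗ f)) fun _ _ => by simp) x

theorem chainMap_sum {ι : Type*} (t : Finset ι) (f : ι → V →ₗ[k] Bim k B W) (x : N ⊗[k] V) :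
    chainMap N (∑ i ∈ t, f i) x = ∑ i ∈ t, chainMap N (f i) x := by
  rw [← LinearMap.sum_apply]
  exact LinearMap.congr_fun (map_sum (chainMapₗ k B V W N) f t) x

end FreeMap

section Crossed
variable {k A H : Type u} [CommRing k] [Ring A] [Algebra k A] [Ring H] [Bialgebra k H]

namespace CrossedProduct
open WeakActionWithMap
variable (D : CrossedProduct k A H)

section Total
open Finset

variable (k A H) in
/-- `⊕_{r+s=n} H̄ˢ ⊗ Āʳ`. -/
abbrev TotGen (n : ℕ) : Type u := ∀ p : Idx n, Gen k A H p.1.1 p.1.2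

variable (k A H) in
/-- The inclusion of the summand `H̄ˢ ⊗ Āʳ`. -/
abbrev genIncl {n : ℕ} (p : Idx n) : Gen k A H p.1.1 p.1.2 →ₗ[k] TotGen k A H n :=
  LinearMap.single k (fun p : Idx n => Gen k A H p.1.1 p.1.2) p

variable (k A H) in
/-- The projection onto the summand `H̄ˢ ⊗ Āʳ`. -/
abbrev genProj {n : ℕ} (p : Idx n) : TotGen k A H n →ₗ[k] Gen k A H p.1.1 p.1.2 :=
  LinearMap.proj p

/-- The differential of the resolution `X_*`, on generators. -/
def totDGen (n : ℕ) : TotGen k A H (n + 1) →ₗ[k] Bim k D.Alg (TotGen k A H n) :=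
  ∑ p : Idx (n + 1), ∑ q : Idx n, Bim.map D.Alg (genIncl k A H q) ∘ₗ
    D.dGen p.1.1 p.1.2 q.1.1 q.1.2 ∘ₗ genProj k A H p

theorem totDGen_single (n : ℕ) (p : Idx (n + 1)) (x : Gen k A H p.1.1 p.1.2) :
    D.totDGen n (genIncl k A H p x) =
      ∑ q : Idx n, Bim.map D.Alg (genIncl k A H q) (D.dGen p.1.1 p.1.2 q.1.1 q.1.2 x) := by
  simp only [totDGen, LinearMap.sum_apply, LinearMap.comp_apply, LinearMap.proj_apply]
  rw [sum_eq_single p]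
  · simp only [LinearMap.single_apply, Pi.single_eq_same]
  · intro p' _ hp
    refine sum_eq_zero fun q _ => ?_
    rw [LinearMap.single_apply, Pi.single_eq_of_ne hp, map_zero, map_zero]
  · exact fun h => absurd (mem_univ _) h

theorem map_proj_single (n : ℕ) (q q' : Idx n) (x : Bim k D.Alg (Gen k A H q'.1.1 q'.1.2)) :
    Bim.map D.Alg (genProj k A H q) (Bim.map D.Alg (genIncl k A H q') x) =
      Pi.single (M := fun p : Idx n => Bim k D.Alg (Gen k A H p.1.1 p.1.2)) q' x q := by
  rw [Bim.map_map]
  by_cases h : q = q'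
  · subst h
    rw [Pi.single_eq_same, LinearMap.proj_comp_single_same, Bim.map_id]
  · rw [Pi.single_eq_of_ne h, LinearMap.proj_comp_single_ne _ _ _ _ h, Bim.map_zero]

theorem map_proj_totDGen (n : ℕ) (q : Idx n) (x : TotGen k A H (n + 1)) :
    Bim.map D.Alg (genProj k A H q) (D.totDGen n x) =
      ∑ p : Idx (n + 1), D.dGen p.1.1 p.1.2 q.1.1 q.1.2 (x p) := by
  simp only [totDGen, LinearMap.sum_apply, LinearMap.comp_apply, LinearMap.proj_apply, map_sum,
    map_proj_single]
  refine sum_congr rfl fun p _ => ?_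
  rw [sum_eq_single q (fun q' _ h => Pi.single_eq_of_ne h.symm _)
    (fun h => absurd (mem_univ _) h), Pi.single_eq_same]

theorem map_proj_comp_totDGen (n : ℕ) (q : Idx n) :
    Bim.map D.Alg (genProj k A H q) ∘ₗ D.totDGen n =
      ∑ p : Idx (n + 1), D.dGen p.1.1 p.1.2 q.1.1 q.1.2 ∘ₗ genProj k A H p :=
  LinearMap.ext fun y => by
    rw [LinearMap.comp_apply, map_proj_totDGen, LinearMap.sum_apply]
    rfl

theorem totDGen_comp_genIncl (n : ℕ) (p : Idx (n + 1)) : D.totDGen n ∘ₗ genIncl k A H p =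
    ∑ q : Idx n, Bim.map D.Alg (genIncl k A H q) ∘ₗ D.dGen p.1.1 p.1.2 q.1.1 q.1.2 :=
  LinearMap.ext fun y => by
    rw [LinearMap.comp_apply, totDGen_single, LinearMap.sum_apply]
    rfl

/-- The inclusion of the bimodules of degree `n` into `Tot`. -/
def toTot (n : ℕ) : Bim k D.Alg (TotGen k A H n) →ₗ[k] D.Tot :=
  LinearMap.pi fun q => if h : q.1 + q.2 = n then
    Bim.map D.Alg (genProj k A H (⟨q, HasAntidiagonal.mem_antidiagonal.2 h⟩ : Idx n)) else 0

theorem toTot_apply (n : ℕ) (x : Bim k D.Alg (TotGen k A H n)) (q : Idx n) :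
    D.toTot n x q.1 = Bim.map D.Alg (genProj k A H q) x := by
  rw [toTot, LinearMap.pi_apply, dif_pos (HasAntidiagonal.mem_antidiagonal.1 q.2)]

theorem toTot_of_ne (n : ℕ) (x : Bim k D.Alg (TotGen k A H n)) {q : ℕ × ℕ} (hq : q.1 + q.2 ≠ n) :
    D.toTot n x q = 0 := by
  rw [toTot, LinearMap.pi_apply, dif_neg hq, LinearMap.zero_apply]

/-- The projection of `Tot` onto the bimodules of degree `n`. -/
def ofTot (n : ℕ) : D.Tot →ₗ[k] Bim k D.Alg (TotGen k A H n) :=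
  ∑ p : Idx n, Bim.map D.Alg (genIncl k A H p) ∘ₗ LinearMap.proj p.1

theorem ofTot_apply (n : ℕ) (z : D.Tot) : D.ofTot n z =
    ∑ p : Idx n, Bim.map D.Alg (genIncl k A H p) (z p.1) := by
  simp [ofTot]

/-- The bimodule in degree `n` is a direct factor of `Tot`, so the identities proved on `Tot`, where
no degrees have to be matched, descend to each degree. -/
theorem ofTot_toTot (n : ℕ) (x : Bim k D.Alg (TotGen k A H n)) : D.ofTot n (D.toTot n x) = x := by
  simp only [ofTot_apply, toTot_apply, Bim.map_map]
  rw [← Bim.map_sum]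
  refine (congrArg (fun f => Bim.map D.Alg f x) ?_).trans (Bim.map_id x)
  refine LinearMap.ext fun y => ?_
  rw [LinearMap.sum_apply]
  exact univ_sum_single y

theorem toTot_extend (n : ℕ) (x : Bim k D.Alg (TotGen k A H (n + 1))) :
    D.toTot n (extend (D.totDGen n) x) = D.totD (D.toTot (n + 1) x) := by
  funext q
  by_cases hq : q.1 + q.2 = n
  · rw [totD_apply D _ q hq, D.toTot_apply n _ ⟨q, HasAntidiagonal.mem_antidiagonal.2 hq⟩,
      map_extend, ← sum_coe_sort]
    rw [map_proj_comp_totDGen, extend_sum, LinearMap.sum_apply]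
    refine sum_congr rfl fun p _ => ?_
    rw [toTot_apply, extend_map]
  · rw [D.toTot_of_ne n _ hq, totD_apply D _ q rfl]
    refine (sum_eq_zero fun p hp => ?_).symm
    rw [HasAntidiagonal.mem_antidiagonal] at hp
    rw [D.toTot_of_ne _ _ (by omega), map_zero]

theorem totD_toTot_zero (x : Bim k D.Alg (TotGen k A H 0)) : D.totD (D.toTot 0 x) = 0 := by
  funext q
  rw [totD_apply D _ q rfl]
  refine sum_eq_zero fun p hp => ?_
  rw [HasAntidiagonal.mem_antidiagonal] at hp
  rw [D.toTot_of_ne _ _ (by omega), map_zero]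

theorem extend_ofTot (n : ℕ) (z : D.Tot) :
    extend (D.totDGen n) (D.ofTot (n + 1) z) = D.ofTot n (D.totD z) := by
  rw [ofTot_apply, ofTot_apply, map_sum]
  simp only [extend_map, totDGen_comp_genIncl, extend_sum, LinearMap.sum_apply]
  rw [sum_comm]
  refine sum_congr rfl fun q _ => ?_
  rw [totD_apply D _ q.1 (HasAntidiagonal.mem_antidiagonal.1 q.2), map_sum,
    ← sum_coe_sort (HasAntidiagonal.antidiagonal (n + 1))]
  refine sum_congr rfl fun p _ => ?_
  rw [map_extend]

/-- `x ⊗ y ↦ x y`, on `H̄⁰ ⊗ Ā⁰ = k`. -/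
def augGen : Gen k A H 0 0 →ₗ[k] D.Alg :=
  Algebra.linearMap k D.Alg ∘ₗ LinearMap.mul' k k ∘ₗ
    TensorProduct.map (BarPow.scalar k H).toLinearMap (BarPow.scalar k A).toLinearMap

/-- The augmentation has two descriptions: through generators, as a split resolution requires, and
through `mu` and the relative bar complex, as the contraction uses it. Both are multiplication in
`E`. -/
theorem evaluate_augGen (x : Bim k D.Alg (Gen k A H 0 0)) :
    evaluate D.Alg D.augGen x = D.totAug x := by
  induction x using row_induction_zero with
  | zero => simp only [map_zero]
  | add x y hx hy => simp only [map_add, hx, hy]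
  | row e l t c =>
    rw [row_tmul, totAug_apply, mu_tmul, evaluate_tmul]
    generalize D.inA c * D.inH l = e'
    rw [BarPow.eq_scalar_smul_empty k H t, map_smul, relTmul_empty, map_smul, map_smul, baseAug_baseMk]
    simp [augGen, BarPow.scalar_empty, Algebra.algebraMap_eq_smul_one]

/-- The index `(0, 0)`. -/
abbrev Idx.zero : Idx 0 := ⟨(0, 0), HasAntidiagonal.mem_antidiagonal.2 rfl⟩

instance : Unique (Idx 0) where
  default := Idx.zero
  uniq := by
    rintro ⟨⟨r, s⟩, h⟩
    obtain ⟨rfl, rfl⟩ : r = 0 ∧ s = 0 := by simpa using h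
    rfl

/-- The augmentation of the resolution `X_*`, on generators. -/
def totAugGen : TotGen k A H 0 →ₗ[k] D.Alg := D.augGen ∘ₗ genProj k A H Idx.zero

theorem evaluate_totAugGen (x : Bim k D.Alg (TotGen k A H 0)) :
    evaluate D.Alg D.totAugGen x = D.totAug (Bim.map D.Alg (genProj k A H Idx.zero) x) := by
  rw [← evaluate_augGen, evaluate_map]
  rfl

/-- `e ↦ e ⊗ 1`, in degree `0` of the resolution `X_*`. -/
def totInitGen : D.Alg →ₗ[k] Bim k D.Alg (TotGen k A H 0) :=
  Bim.map D.Alg (genIncl k A H Idx.zero) ∘ₗ D.totInit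

/-- The contracting homotopy of the resolution `X_*`. -/
def totSGen (n : ℕ) : Bim k D.Alg (TotGen k A H n) →ₗ[k] Bim k D.Alg (TotGen k A H (n + 1)) :=
  D.ofTot (n + 1) ∘ₗ D.totS ∘ₗ D.toTot n

theorem extend_totDGen_totDGen (n : ℕ) (x : TotGen k A H (n + 2)) :
    extend (D.totDGen n) (D.totDGen (n + 1) x) = 0 := by
  rw [← extend_unit (D.totDGen (n + 1)), ← D.ofTot_toTot n (extend _ _), toTot_extend,
    toTot_extend, totD_totD, map_zero]

theorem evaluate_totDGen (x : TotGen k A H 1) :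
    evaluate D.Alg D.totAugGen (D.totDGen 0 x) = 0 := by
  rw [evaluate_totAugGen, ← extend_unit (D.totDGen 0), ← D.toTot_apply 0 _ Idx.zero,
    toTot_extend, totAug_apply]
  exact (congrArg _ (D.mu_totD _ 0)).trans (D.baseAug_baseD _)

theorem evaluate_totInitGen (b : D.Alg) : evaluate D.Alg D.totAugGen (D.totInitGen b) = b := by
  rw [evaluate_totAugGen, totInitGen, LinearMap.comp_apply, map_proj_single, Pi.single_eq_same,
    totAug_totInit]

theorem extend_totSGen_zero (x : Bim k D.Alg (TotGen k A H 0)) :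
    extend (D.totDGen 0) (D.totSGen 0 x) =
      x - D.totInitGen (evaluate D.Alg D.totAugGen x) := by
  rw [totSGen, LinearMap.comp_apply, LinearMap.comp_apply, extend_ofTot, totD_totS,
    totD_toTot_zero, map_zero, sub_zero, map_sub, ofTot_toTot, evaluate_totAugGen,
    ← D.toTot_apply 0 _ Idx.zero, D.ofTot_apply 0 (D.totP _), Fintype.sum_unique]
  rfl

theorem extend_totSGen_succ (n : ℕ) (x : Bim k D.Alg (TotGen k A H (n + 1))) :
    extend (D.totDGen (n + 1)) (D.totSGen (n + 1) x) =
      x - D.totSGen n (extend (D.totDGen n) x) := by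
  rw [totSGen, totSGen, LinearMap.comp_apply, LinearMap.comp_apply, LinearMap.comp_apply,
    LinearMap.comp_apply, extend_ofTot, totD_totS, map_sub, map_sub, ofTot_toTot, toTot_extend,
    D.ofTot_apply _ (D.totP _), sum_eq_zero, sub_zero]
  intro p _
  rw [D.totP_of_ne _ (by have := HasAntidiagonal.mem_antidiagonal.1 p.2; omega), map_zero]

/-- The resolution `X_*` of `E`. -/
def resolution : SplitResolution k D.Alg where
  V := TotGen k A H
  d := D.totDGen
  aug := D.totAugGen
  init := D.totInitGen
  s := D.totSGen
  d_d := D.extend_totDGen_totDGen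
  aug_d := D.evaluate_totDGen
  aug_init := D.evaluate_totInitGen
  d_s_zero := D.extend_totSGen_zero
  d_s := D.extend_totSGen_succ

end Total
end CrossedProduct
end Crossed

/-! ### The complexes `X̂`, their homology and their filtrations -/

section Crossed
variable {k A H : Type u} [CommRing k] [Ring A] [Algebra k A] [Ring H] [Bialgebra k H]

namespace CrossedProduct
open WeakActionWithMap
variable (D : CrossedProduct k A H)

section Complexes
open Finset
variable (M : Type u) [AddCommGroup M] [Module k M] [Module D.Alg M] [Module D.Algᵐᵒᵖ M]
  [IsScalarTower k D.Alg M] [IsScalarTower k D.Algᵐᵒᵖ M] [SMulCommClass D.Alg D.Algᵐᵒᵖ M]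

variable (k A H) in
/-- `M ⊗ (⊕ H̄ˢ ⊗ Āʳ) = ⊕ M ⊗ H̄ˢ ⊗ Āʳ`. -/
def xhatEquiv (M : Type u) [AddCommGroup M] [Module k M] (n : ℕ) :
    M ⊗[k] TotGen k A H n ≃ₗ[k] Xhat k A H M n :=
  TensorProduct.piRight k k M (fun p : Idx n => Gen k A H p.1.1 p.1.2)

theorem xhatEquiv_apply (n : ℕ) (x : M ⊗[k] TotGen k A H n) (p : Idx n) :
    xhatEquiv k A H M n x p = LinearMap.lTensor M (genProj k A H p) x := by
  induction x using TensorProduct.induction_on with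
  | zero => simp only [map_zero, Pi.zero_apply]
  | add x y hx hy => rw [map_add, map_add, Pi.add_apply, hx, hy]
  | tmul m y => simp [xhatEquiv]

theorem dHat_apply (n : ℕ) (x : Xhat k A H M (n + 1)) (q : Idx n) :
    D.dHat M n x q = ∑ p : Idx (n + 1), chainMap M (D.dGen p.1.1 p.1.2 q.1.1 q.1.2) (x p) := by
  simp [dHat]

theorem dHat_xhatEquiv (n : ℕ) (x : M ⊗[k] TotGen k A H (n + 1)) :
    D.dHat M n (xhatEquiv k A H M (n + 1) x) =
      xhatEquiv k A H M n (chainMap M (D.totDGen n) x) := by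
  funext q
  rw [dHat_apply, xhatEquiv_apply, lTensor_chainMap, map_proj_comp_totDGen, chainMap_sum]
  refine sum_congr rfl fun p _ => ?_
  rw [xhatEquiv_apply, chainMap_lTensor]

/-- Inherited from the resolution: `M ⊗_{Eᵉ} -` respects composition, and under `xhatEquiv` the
differential of `X̂_*` is the one it induces. -/
theorem dHat_dHat (n : ℕ) : D.dHat M n ∘ₗ D.dHat M (n + 1) = 0 := by
  refine LinearMap.ext fun x => ?_
  obtain ⟨x, rfl⟩ := (xhatEquiv k A H M (n + 2)).surjective x
  have h : extend (D.totDGen n) ∘ₗ D.totDGen (n + 1) = 0 :=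
    LinearMap.ext (D.extend_totDGen_totDGen n)
  have h2 := LinearMap.congr_fun (chainMap_comp M (D.totDGen n) (D.totDGen (n + 1))) x
  rw [h, LinearMap.comp_apply] at h2
  rw [LinearMap.comp_apply, dHat_xhatEquiv, dHat_xhatEquiv, h2]
  exact (congrArg _ (LinearMap.congr_fun (chainMapₗ k D.Alg _ _ M).map_zero x)).trans (map_zero _)

variable (k A H) in
/-- `Hom(⊕ H̄ˢ ⊗ Āʳ, M) = ⊕ Hom(H̄ˢ ⊗ Āʳ, M)`. -/
def xhatCoEquiv (M : Type u) [AddCommGroup M] [Module k M] (n : ℕ) :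
    (TotGen k A H n →ₗ[k] M) ≃ₗ[k] XhatCo k A H M n :=
  (LinearMap.lsum k (fun p : Idx n => Gen k A H p.1.1 p.1.2) k).symm

theorem xhatCoEquiv_apply (n : ℕ) (φ : TotGen k A H n →ₗ[k] M) (p : Idx n) :
    xhatCoEquiv k A H M n φ p = φ ∘ₗ genIncl k A H p := rfl

theorem dHatCo_apply (n : ℕ) (x : XhatCo k A H M n) (q : Idx (n + 1)) :
    D.dHatCo M n x q = ∑ p : Idx n, cochainMap M (D.dGen q.1.1 q.1.2 p.1.1 p.1.2) (x p) := by
  simp [dHatCo]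

theorem dHatCo_xhatCoEquiv (n : ℕ) (φ : TotGen k A H n →ₗ[k] M) :
    D.dHatCo M n (xhatCoEquiv k A H M n φ) =
      xhatCoEquiv k A H M (n + 1) (cochainMap M (D.totDGen n) φ) := by
  funext q
  rw [dHatCo_apply, xhatCoEquiv_apply]
  refine LinearMap.ext fun x => ?_
  rw [LinearMap.sum_apply, LinearMap.comp_apply, cochainMap_apply, totDGen_single, map_sum]
  refine sum_congr rfl fun p _ => ?_
  rw [xhatCoEquiv_apply, cochainMap_apply, evaluate_map]

theorem dHatCo_dHatCo (n : ℕ) : D.dHatCo M (n + 1) ∘ₗ D.dHatCo M n = 0 := by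
  refine LinearMap.ext fun x => ?_
  obtain ⟨φ, rfl⟩ := (xhatCoEquiv k A H M n).surjective x
  have h : extend (D.totDGen n) ∘ₗ D.totDGen (n + 1) = 0 :=
    LinearMap.ext (D.extend_totDGen_totDGen n)
  have h2 := LinearMap.congr_fun (cochainMap_comp M (D.totDGen n) (D.totDGen (n + 1))) φ
  rw [h, LinearMap.comp_apply] at h2
  rw [LinearMap.comp_apply, dHatCo_xhatCoEquiv, dHatCo_xhatCoEquiv, h2]
  exact (congrArg _ (LinearMap.congr_fun (cochainMapₗ k D.Alg _ _ M).map_zero φ)).trans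
    (map_zero _)

theorem chain_d_apply {i j : ℕ} (h : j + 1 = i) (x : (D.chain M (D.dHat_dHat M)).X i) (q : Idx j) :
    (((D.chain M (D.dHat_dHat M)).d i j).hom x : Xhat k A H M j) q =
      ∑ p : Idx i, chainMap M (D.dGen p.1.1 p.1.2 q.1.1 q.1.2) ((x : Xhat k A H M i) p) := by
  subst h
  have : (D.chain M (D.dHat_dHat M)).d (j + 1) j = ModuleCat.ofHom (D.dHat M j) :=
    ChainComplex.of_d (fun n => ModuleCat.of k (Xhat k A H M n))
    (fun n => ModuleCat.ofHom (D.dHat M n)) j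
  exact (congrArg (fun f => f.hom x q) this).trans (D.dHat_apply M j x q)

theorem cochain_d_apply {i j : ℕ} (h : i + 1 = j) (x : (D.cochain M (D.dHatCo_dHatCo M)).X i)
    (q : Idx j) : (((D.cochain M (D.dHatCo_dHatCo M)).d i j).hom x : XhatCo k A H M j) q =
      ∑ p : Idx i, cochainMap M (D.dGen q.1.1 q.1.2 p.1.1 p.1.2) ((x : XhatCo k A H M i) p) := by
  subst h
  have : (D.cochain M (D.dHatCo_dHatCo M)).d i (i + 1) = ModuleCat.ofHom (D.dHatCo M i) :=
    CochainComplex.of_d (fun n => ModuleCat.of k (XhatCo k A H M n))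
    (fun n => ModuleCat.ofHom (D.dHatCo M n)) i
  exact (congrArg (fun f => f.hom x q) this).trans (D.dHatCo_apply M i x q)

/-- The complex `X̂_*` is the one obtained from the resolution `X_*`. -/
def chainIso : D.resolution.chain M ≅ D.chain M (D.dHat_dHat M) :=
  HomologicalComplex.Hom.isoOfComponents (fun n => (xhatEquiv k A H M n).toModuleIso) (by
    intro i j hij
    obtain rfl : j + 1 = i := hij
    refine ModuleCat.hom_ext (LinearMap.ext fun x => ?_)
    have h1 : ((D.chain M (D.dHat_dHat M)).d (j + 1) j).hom (xhatEquiv k A H M (j + 1) x) =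
        D.dHat M j (xhatEquiv k A H M (j + 1) x) :=
      funext fun q => (D.chain_d_apply M rfl _ q).trans (D.dHat_apply M j _ q).symm
    refine h1.trans ((D.dHat_xhatEquiv M j x).trans ?_)
    exact congrArg (xhatEquiv k A H M j) (D.resolution.chain_d_apply M j x).symm)

/-- The complex `X̂^*` is the one obtained from the resolution `X_*`. -/
def cochainIso : D.resolution.cochain M ≅ D.cochain M (D.dHatCo_dHatCo M) :=
  HomologicalComplex.Hom.isoOfComponents (fun n => (xhatCoEquiv k A H M n).toModuleIso) (by
    intro i j hij
    obtain rfl : i + 1 = j := hij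
    refine ModuleCat.hom_ext (LinearMap.ext fun x => ?_)
    have h1 : ((D.cochain M (D.dHatCo_dHatCo M)).d i (i + 1)).hom (xhatCoEquiv k A H M i x) =
        D.dHatCo M i (xhatCoEquiv k A H M i x) :=
      funext fun q => (D.cochain_d_apply M rfl _ q).trans (D.dHatCo_apply M i _ q).symm
    refine h1.trans ((D.dHatCo_xhatCoEquiv M i x).trans ?_)
    exact congrArg (xhatCoEquiv k A H M (i + 1)) (D.resolution.cochain_d_apply M i x).symm)

/-- The homology of `X̂_*` is the Hochschild homology of `E`. -/
def chainAbutment (n : ℕ) : (D.chain M (D.dHat_dHat M)).homology n ≅ HH k D.Alg M n :=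
  HomologicalComplex.homologyMapIso (D.chainIso M).symm n ≪≫
    D.resolution.chainHomologyIso (barResolution k D.Alg) M n

/-- The cohomology of `X̂^*` is the Hochschild cohomology of `E`. -/
def cochainAbutment (n : ℕ) :
    (D.cochain M (D.dHatCo_dHatCo M)).homology n ≅ HHco k D.Alg M n :=
  HomologicalComplex.homologyMapIso (D.cochainIso M).symm n ≪≫
    D.resolution.cochainHomologyIso (barResolution k D.Alg) M n

theorem mem_chainFil {i : ℤ} {n : ℕ} {x : (D.chain M (D.dHat_dHat M)).X n} :
    x ∈ D.chainFil M (D.dHat_dHat M) i n ↔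
      ∀ p : Idx n, i < p.1.2 → (x : Xhat k A H M n) p = 0 := Iff.rfl

theorem mem_cochainFil {i : ℤ} {n : ℕ} {x : (D.cochain M (D.dHatCo_dHatCo M)).X n} :
    x ∈ D.cochainFil M (D.dHatCo_dHatCo M) i n ↔
      ∀ p : Idx n, (p.1.2 : ℤ) < -i → (x : XhatCo k A H M n) p = 0 := Iff.rfl

theorem chainMap_dGen_eq_zero {r s r' s' : ℕ} (h : s < s') (x : M ⊗[k] Gen k A H r s) :
    chainMap M (D.dGen r s r' s') x = 0 := by
  rw [D.dGen_eq_zero (fun _ => h)]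
  exact LinearMap.congr_fun (chainMapₗ k D.Alg _ _ M).map_zero x

theorem cochainMap_dGen_eq_zero {r s r' s' : ℕ} (h : s < s') (x : Gen k A H r' s' →ₗ[k] M) :
    cochainMap M (D.dGen r s r' s') x = 0 := by
  rw [D.dGen_eq_zero (fun _ => h)]
  exact LinearMap.congr_fun (cochainMapₗ k D.Alg _ _ M).map_zero x

theorem Idx.le {n : ℕ} (p : Idx n) : p.1.2 ≤ n := by
  have := HasAntidiagonal.mem_antidiagonal.1 p.2
  omega

/-- The components of `d` never raise the number of factors `H̄`, and in degree `n` this number lies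
between `0` and `n`. The shape `(p - 1, -p)` encodes total degree `-1` and filtration degree `-p`.
-/
theorem isFiltration_chain : IsFiltration (D.chain M (D.dHat_dHat M))
    (D.chainFil M (D.dHat_dHat M)) (fun p => ComplexShape.spectralSequenceNat (p - 1, -p))
    (fun q => q.1 + q.2) (fun q => (q.2 : ℤ)) where
  mono n s s' hs x hx p hp := hx p (lt_of_le_of_lt hs hp)
  d_mem s i j x hx := by
    by_cases hij : j + 1 = i
    · refine (D.mem_chainFil M).2 fun q hq => ?_
      rw [chain_d_apply D M hij]
      refine sum_eq_zero fun p _ => ?_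
      rcases lt_or_ge p.1.2 q.1.2 with hp | hp
      · exact D.chainMap_dGen_eq_zero M hp _
      · rw [hx p (by omega), map_zero]
    · rw [HomologicalComplex.shape _ _ _ hij]
      exact zero_mem _
  bot n := ⟨-1, (Submodule.eq_bot_iff _).2 fun x hx => funext fun p => hx p (by omega)⟩
  top n := ⟨n, Submodule.eq_top_iff'.2 fun x p hp => by
    have := p.le
    omega⟩
  rel_iff p q q' := by
    simp only [ComplexShape.spectralSequenceNat_rel_iff, ComplexShape.down_Rel]
    omega
  jump n s h := by
    refine le_antisymm (fun x hx p hp => ?_) (fun x hx p hp => hx p (by omega))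
    refine hx p (lt_of_le_of_ne (by omega) fun he => ?_)
    exact h p.1 ⟨HasAntidiagonal.mem_antidiagonal.1 p.2, he.symm⟩

/-- The decreasing filtration is indexed by `-s`, so that the theory of increasing filtrations
applies. The index `0` gives everything and `-(n + 1)` gives zero in degree `n`. -/
theorem isFiltration_cochain : IsFiltration (D.cochain M (D.dHatCo_dHatCo M))
    (D.cochainFil M (D.dHatCo_dHatCo M)) (fun p => ComplexShape.spectralSequenceNat (1 - p, p))
    (fun q => q.1 + q.2) (fun q => -(q.2 : ℤ)) where
  mono n s s' hs x hx p hp := hx p (lt_of_lt_of_le hp (neg_le_neg hs))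
  d_mem s i j x hx := by
    by_cases hij : i + 1 = j
    · refine (D.mem_cochainFil M).2 fun q hq => ?_
      rw [cochain_d_apply D M hij]
      refine sum_eq_zero fun p _ => ?_
      rcases lt_or_ge q.1.2 p.1.2 with hp | hp
      · exact D.cochainMap_dGen_eq_zero M hp _
      · rw [hx p (by omega), map_zero]
    · rw [HomologicalComplex.shape _ _ _ hij]
      exact zero_mem _
  bot n := ⟨-(n + 1), (Submodule.eq_bot_iff _).2 fun x hx => funext fun p => hx p (by
    have := p.le
    omega)⟩
  top n := ⟨0, Submodule.eq_top_iff'.2 fun x p hp => by omega⟩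
  rel_iff p q q' := by
    simp only [ComplexShape.spectralSequenceNat_rel_iff, ComplexShape.up_Rel]
    omega
  jump n s h := by
    refine le_antisymm (fun x hx p hp => ?_) (fun x hx p hp => hx p (by omega))
    refine hx p (lt_of_le_of_ne (by omega) fun he => ?_)
    exact h p.1 ⟨HasAntidiagonal.mem_antidiagonal.1 p.2, by omega⟩

end Complexes
end CrossedProduct
end Crossed

/-! ### The first page -/

section PageOne
variable {k : Type u} [CommRing k] {ι κ κ' : Type} {c : ComplexShape ι} {c' : ComplexShape κ'}
  {C : HomologicalComplex (ModuleCat.{u} k) c} {F : ℤ → ∀ n, Submodule k (C.X n)}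
  {cs : ℤ → ComplexShape κ} {deg : κ → ι} {fil : κ → ℤ}

variable (C F) in
/-- A linear map that identifies `F_s / F_{s-1}`, in degree `n`, with the term of degree `r` of a
complex `K`, in a way that is compatible with the differentials around this degree. -/
structure IsGradedPiece (s : ℤ) (n : ι) (K : HomologicalComplex (ModuleCat.{u} k) c') (r : κ')
    (g : C.X n →ₗ[k] K.X r) : Prop where
  surj : ∀ y, ∃ x ∈ F s n, g x = y
  eq_zero_iff : ∀ x ∈ F s n, g x = 0 ↔ x ∈ F (s - 1) n
  cycle_iff : ∀ x ∈ F s n, (∀ j, (K.d r j).hom (g x) = 0) ↔ ∀ j, (C.d n j).hom x ∈ F (s - 1) j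
  boundary_iff : ∀ x ∈ F s n, (∃ i, ∃ y : K.X i, (K.d i r).hom y = g x) ↔
    ∃ i, ∃ b ∈ F s i, g x = g ((C.d i n).hom b)

theorem d_next_eq_zero_iff (K : HomologicalComplex (ModuleCat.{u} k) c') (r : κ') (x : K.X r) :
    (K.d r (c'.next r)).hom x = 0 ↔ ∀ j, (K.d r j).hom x = 0 := by
  refine ⟨fun hx j => ?_, fun hx => hx _⟩
  by_cases hj : c'.Rel r j
  · obtain rfl := c'.next_eq' hj
    exact hx
  · rw [K.shape _ _ hj]; rfl

theorem exists_d_prev_iff (K : HomologicalComplex (ModuleCat.{u} k) c') (r : κ') (x : K.X r) :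
    (∃ y : K.X (c'.prev r), (K.d (c'.prev r) r).hom y = x) ↔
      ∃ i, ∃ y : K.X i, (K.d i r).hom y = x := by
  refine ⟨fun hx => ⟨_, hx⟩, fun ⟨i, y, hy⟩ => ?_⟩
  by_cases hi : c'.Rel i r
  · obtain rfl := c'.prev_eq' hi
    exact ⟨y, hy⟩
  · rw [K.shape _ _ hi] at hy
    exact ⟨0, (map_zero _).trans hy⟩

namespace IsFiltration
variable (h : IsFiltration C F cs deg fil) (q : κ) (K : HomologicalComplex (ModuleCat.{u} k) c')
  (r : κ') (g : C.X (deg q) →ₗ[k] K.X r) (hg : IsGradedPiece C F (fil q) (deg q) K r g)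
include h hg

theorem d_gradedPiece (x : approxCycles C F 1 (fil q) (deg q)) :
    (K.d r (c'.next r)).hom ((g ∘ₗ Submodule.subtype _) x) = 0 :=
  (d_next_eq_zero_iff K r _).2 ((hg.cycle_iff _ (mem_approxCycles.1 x.2).1).2
    (mem_approxCycles.1 x.2).2)

theorem toHomology_gradedPiece_surjective :
    Function.Surjective (toHomology K r (g ∘ₗ Submodule.subtype _) (h.d_gradedPiece q K r g hg)) := by
  refine toHomology_surjective K r _ _ fun y hy => ?_
  obtain ⟨x, hx, rfl⟩ := hg.surj y
  refine ⟨⟨x, mem_approxCycles.2 ⟨hx, (hg.cycle_iff x hx).1 ((d_next_eq_zero_iff K r _).1 hy)⟩⟩,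
    0, ?_⟩
  rw [map_zero, add_zero]
  rfl

/-- For `p = 1` the boundary module is `F_{s-1}` plus `d F_s` (within `Z¹_s`), because `Z⁰` is the
whole filtration step. Modulo `F_{s-1}` these are the boundaries of the graded piece. -/
theorem pageProj_one_eq_zero_iff (x : approxCycles C F 1 (fil q) (deg q)) :
    h.pageProj 1 q x = 0 ↔
      toHomology K r (g ∘ₗ Submodule.subtype _) (h.d_gradedPiece q K r g hg) x = 0 := by
  obtain ⟨x, hx⟩ := x
  have hxF := (mem_approxCycles.1 hx).1
  rw [pageProj_eq_zero_iff, toHomology_eq_zero_iff, exists_d_prev_iff]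
  refine Iff.trans ?_ (hg.boundary_iff x hxF).symm
  constructor
  · intro hb
    obtain ⟨a, ha, b, hb, e⟩ := exists_of_mem_approxBoundaries _ rfl hb
    replace ha := (mem_approxCycles.1 ha).1
    replace hb := (mem_approxCycles.1 hb).1
    rw [show fil q + 1 - 1 = fil q by ring] at hb
    refine ⟨_, b, hb, ?_⟩
    have e' : x = a + (C.d (c.prev (deg q)) (deg q)).hom b := e
    rw [e', map_add, (hg.eq_zero_iff a (h.mono _ (by lia) ha)).2 ha, zero_add]
  · rintro ⟨i, b, hb, e⟩
    have h1 : x - (C.d i (deg q)).hom b ∈ F (fil q - 1) (deg q) :=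
      (hg.eq_zero_iff _ (sub_mem hxF (h.d_mem _ _ _ _ hb))).1 (by rw [map_sub, e, sub_self])
    have h2 := add_d_mem_approxBoundaries (C := C) (F := F) (p := 1) (s := fil q) (n := deg q)
      (i := i) (a := x - (C.d i (deg q)).hom b) (b := b)
      (mem_approxCycles.2 ⟨h1, fun j => by
        rw [show fil q - 1 - (1 - 1) = fil q - 1 by ring]
        exact h.d_mem _ _ _ _ h1⟩)
      (mem_approxCycles.2 ⟨by rwa [show fil q + 1 - 1 = fil q by ring], fun j => by
        rw [show fil q + 1 - 1 - (1 - 1) = fil q by ring]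
        exact h.d_mem _ _ _ _ hb⟩)
    rwa [sub_add_cancel] at h2

/-- The term of the first page at a position is the homology of the complex of graded pieces. -/
def pageOneIso : (h.page 1).X q ≅ K.homology r :=
  (quotientsEquiv (h.pageProj 1 q)
    (toHomology K r (g ∘ₗ Submodule.subtype _) (h.d_gradedPiece q K r g hg))
    (h.pageProj_surjective 1 q) (h.toHomology_gradedPiece_surjective q K r g hg)
    (h.pageProj_one_eq_zero_iff q K r g hg)).toModuleIso

theorem pageOneIso_pageProj (x : approxCycles C F 1 (fil q) (deg q)) (w : K.cycles r)
    (hw : (K.iCycles r).hom w = g x) :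
    (h.pageOneIso q K r g hg).hom.hom (h.pageProj 1 q x) = (K.homologyπ r).hom w :=
  (quotientsEquiv_apply _ _ _ _ (h.pageProj_one_eq_zero_iff q K r g hg) x).trans
    (homologyπ_eq_toHomology K r _ _ x w hw).symm

end IsFiltration
end PageOne

/-! ### The graded pieces as Hochschild complexes of `A` -/

section Hochschild
variable (k : Type u) [CommRing k] (B : Type u) [Ring B] [Algebra k B]
  (N : Type u) [AddCommGroup N] [Module k N] [Module B N] [Module Bᵐᵒᵖ N]
  [IsScalarTower k B N] [IsScalarTower k Bᵐᵒᵖ N] [SMulCommClass B Bᵐᵒᵖ N]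

theorem hochschildChain_d_apply (n : ℕ) (x : N ⊗[k] BarPow k B (n + 1)) :
    ((hochschildChain k B N).d (n + 1) n).hom x = chainMap N (barD k B n) x :=
  (barResolution k B).chain_d_apply N n x

theorem hochschildCochain_d_apply (n : ℕ) (φ : BarPow k B n →ₗ[k] N) :
    ((hochschildCochain k B N).d n (n + 1)).hom φ = cochainMap N (barD k B n) φ :=
  (barResolution k B).cochain_d_apply N n φ

end Hochschild

section Crossed
variable {k A H : Type u} [CommRing k] [Ring A] [Algebra k A] [Ring H] [Bialgebra k H]

namespace CrossedProduct
open WeakActionWithMap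
variable (D : CrossedProduct k A H)

section Complexes
open Finset
variable (M : Type u) [AddCommGroup M] [Module k M] [Module D.Alg M] [Module D.Algᵐᵒᵖ M]
  [IsScalarTower k D.Alg M] [IsScalarTower k D.Algᵐᵒᵖ M] [SMulCommClass D.Alg D.Algᵐᵒᵖ M]

/-- `M ⊗ (H̄ˢ ⊗ Āʳ) = (M ⊗ H̄ˢ) ⊗ Āʳ`. -/
def componentEquiv (r s : ℕ) :
    M ⊗[k] Gen k A H r s ≃ₗ[k] D.TwTensor M s ⊗[k] BarPow k A r :=
  (TensorProduct.assoc k M (BarPow k H s) (BarPow k A r)).symm ≪≫ₗ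
    TensorProduct.congr (D.toTwTensor s) (LinearEquiv.refl k (BarPow k A r))

theorem componentEquiv_tmul (r s : ℕ) (m : M) (x : BarPow k H s) (t : BarPow k A r) :
    D.componentEquiv M r s (m ⊗ₜ (x ⊗ₜ t)) = D.toTwTensor s (m ⊗ₜ x) ⊗ₜ t := rfl

/-- In `M ⊗_{Eᵉ} X_{rs}` the left coefficient of a generator acts on `M` from the right. The twisted
first term of `d⁰` thus becomes the twisted right action of `A` on `M ⊗ H̄ˢ`, and the last term
becomes the ordinary left action. -/
theorem componentEquiv_d0Gen (r s : ℕ) (z : M ⊗[k] Gen k A H (r + 1) s) :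
    D.componentEquiv M r s (chainMap M (D.d0Gen r s) z) =
      chainMap (D.TwTensor M s) (barD k A r) (D.componentEquiv M (r + 1) s z) := by
  induction z using TensorProduct.induction_on with
  | zero => simp only [map_zero]
  | add x y hx hy => simp only [map_add, hx, hy]
  | tmul m z =>
  induction z using TensorProduct.induction_on with
  | zero => simp only [map_zero, TensorProduct.tmul_zero]
  | add x y hx hy => simp only [map_add, TensorProduct.tmul_add, hx, hy]
  | tmul x t =>
  obtain ⟨t, rfl⟩ := (BarPow.cons k A r).surjective t
  induction t using TensorProduct.induction_on with
  | zero => simp only [map_zero, TensorProduct.tmul_zero]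
  | add x y hx hy => simp only [map_add, TensorProduct.tmul_add, hx, hy]
  | tmul a t =>
  obtain ⟨a, rfl⟩ := Bar.mk_surjective a
  rw [chainMap_tmul, d0Gen_tmul, d0Step_apply, componentEquiv_tmul, chainMap_tmul, barD_cons,
    map_sub, map_sub, map_sub]
  congr 1
  · rw [BarMod.inl, LinearMap.flip_apply, TensorProduct.mk_apply, contract_tmul, one_smul,
      TwTensor.op_smul_tmul]
    generalize D.twistPow s a x = w
    induction w using TensorProduct.induction_on with
    | zero => simp only [map_zero, TensorProduct.zero_tmul]
    | add x y hx hy => simp only [map_add, TensorProduct.add_tmul, hx, hy]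
    | tmul b y =>
      simp [componentEquiv_tmul]
  · generalize barMerge k A r a (BarMod.inl r t) = w
    induction w using TensorProduct.induction_on with
    | zero => simp only [map_zero, TensorProduct.tmul_zero]
    | add x y hx hy => simp only [map_add, TensorProduct.tmul_add, hx, hy]
    | tmul t b =>
      simp [componentEquiv_tmul, TwTensor.smul_tmul]

/-- `Hom(H̄ˢ ⊗ Āʳ, M) = Hom(Āʳ, Hom(H̄ˢ, M))`. -/
def componentEquivCo (r s : ℕ) :
    (Gen k A H r s →ₗ[k] M) ≃ₗ[k] (BarPow k A r →ₗ[k] D.TwHom M s) :=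
  (TensorProduct.lift.equiv (RingHom.id k) (BarPow k H s) (BarPow k A r) M).symm ≪≫ₗ
    LinearMap.lflip ≪≫ₗ LinearEquiv.congrRight (D.toTwHom s)

theorem componentEquivCo_apply (r s : ℕ) (φ : Gen k A H r s →ₗ[k] M) (t : BarPow k A r) :
    D.componentEquivCo M r s φ t =
      D.toTwHom s (φ ∘ₗ (TensorProduct.mk k (BarPow k H s) (BarPow k A r)).flip t) := rfl

/-- For cochains the sides are not exchanged: the twisted first term of `d⁰` becomes the left action
on `Hom_k(H̄ˢ, M)`, and the last term the right action. -/
theorem componentEquivCo_d0Gen (r s : ℕ) (φ : Gen k A H r s →ₗ[k] M) :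
    D.componentEquivCo M (r + 1) s (cochainMap M (D.d0Gen r s) φ) =
      cochainMap (D.TwHom M s) (barD k A r) (D.componentEquivCo M r s φ) := by
  refine LinearMap.ext fun t => ?_
  obtain ⟨t, rfl⟩ := (BarPow.cons k A r).surjective t
  induction t using TensorProduct.induction_on with
  | zero => simp only [map_zero]
  | add x y hx hy => simp only [map_add, hx, hy]
  | tmul a t =>
  obtain ⟨a, rfl⟩ := Bar.mk_surjective a
  rw [cochainMap_apply, barD_cons, map_sub, componentEquivCo_apply]
  refine (D.toTwHom s).symm.injective (LinearMap.ext fun x => ?_)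
  rw [LinearEquiv.symm_apply_apply, LinearMap.comp_apply, LinearMap.flip_apply,
    TensorProduct.mk_apply, cochainMap_apply, d0Gen_tmul, d0Step_apply, map_sub, map_sub,
    LinearMap.sub_apply]
  congr 1
  · rw [BarMod.inl, LinearMap.flip_apply, TensorProduct.mk_apply, evaluate_tmul, MulOpposite.op_one,
      one_smul, componentEquivCo_apply, TwHom.smul_apply, LinearEquiv.symm_apply_apply,
      LinearMap.comp_apply]
    generalize D.twistPow s a x = w
    induction w using TensorProduct.induction_on with
    | zero => simp only [map_zero]
    | add x y hx hy => simp only [map_add, hx, hy]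
    | tmul b y => simp
  · generalize barMerge k A r a (BarMod.inl r t) = w
    induction w using TensorProduct.induction_on with
    | zero => simp only [map_zero, TensorProduct.tmul_zero, LinearMap.zero_apply]
    | add x y hx hy => simp only [map_add, TensorProduct.tmul_add, LinearMap.add_apply, hx, hy]
    | tmul t b =>
      rw [TensorProduct.map_tmul, evaluate_tmul, evaluate_tmul, one_smul, one_smul,
        componentEquivCo_apply, TwHom.op_smul_apply, LinearEquiv.symm_apply_apply]
      rfl

/-- The pair `(r, s)`, as an index in total degree `n = r + s`. -/
def Idx.of {n : ℕ} (r s : ℕ) (h : r + s = n) : Idx n := ⟨(r, s), HasAntidiagonal.mem_antidiagonal.2 h⟩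

theorem Idx.eq_of {n : ℕ} (r s : ℕ) (h : r + s = n) (p : Idx n) (hp : p.1.2 = s) :
    p = Idx.of r s h := by
  have := HasAntidiagonal.mem_antidiagonal.1 p.2
  exact Subtype.ext (Prod.ext (by simp only [Idx.of]; omega) hp)

/-- Components of `x` with fewer than `s` factors `H̄` cannot reach the index `(r, s)`, and those
with more vanish because `x ∈ F_s`; what is left is `d⁰`. -/
theorem chain_d_component {r s i j : ℕ} (hi : r + 1 + s = i) (hj : r + s = j)
    {x : (D.chain M (D.dHat_dHat M)).X i} (hx : x ∈ D.chainFil M (D.dHat_dHat M) s i) :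
    (((D.chain M (D.dHat_dHat M)).d i j).hom x : Xhat k A H M j) (Idx.of r s hj) =
      chainMap M (D.d0Gen r s) ((x : Xhat k A H M i) (Idx.of (r + 1) s hi)) := by
  rw [D.chain_d_apply M (by omega), sum_eq_single (Idx.of (r + 1) s hi)]
  · exact congrArg (fun f => chainMap M f _) (D.dGen_d0 r s)
  · intro p _ hp
    rcases lt_trichotomy p.1.2 s with h | h | h
    · exact D.chainMap_dGen_eq_zero M h _
    · exact absurd (Idx.eq_of _ _ hi p h) hp
    · rw [hx p (by exact_mod_cast h), map_zero]
  · exact fun h => absurd (mem_univ _) h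

theorem cochain_d_component {r s i j : ℕ} (hi : r + s = i) (hj : r + 1 + s = j)
    {x : (D.cochain M (D.dHatCo_dHatCo M)).X i}
    (hx : x ∈ D.cochainFil M (D.dHatCo_dHatCo M) (-s) i) :
    (((D.cochain M (D.dHatCo_dHatCo M)).d i j).hom x : XhatCo k A H M j) (Idx.of (r + 1) s hj) =
      cochainMap M (D.d0Gen r s) ((x : XhatCo k A H M i) (Idx.of r s hi)) := by
  rw [D.cochain_d_apply M (by omega), sum_eq_single (Idx.of r s hi)]
  · exact congrArg (fun f => cochainMap M f _) (D.dGen_d0 r s)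
  · intro p _ hp
    rcases lt_trichotomy s p.1.2 with h | h | h
    · exact D.cochainMap_dGen_eq_zero M h _
    · exact absurd (Idx.eq_of _ _ hi p h.symm) hp
    · rw [hx p (by omega), map_zero]
  · exact fun h => absurd (mem_univ _) h

theorem mem_chainFil_pred_iff {r s n : ℕ} (h : r + s = n) {x : (D.chain M (D.dHat_dHat M)).X n}
    (hx : x ∈ D.chainFil M (D.dHat_dHat M) s n) :
    x ∈ D.chainFil M (D.dHat_dHat M) (s - 1) n ↔ (x : Xhat k A H M n) (Idx.of r s h) = 0 := by
  refine ⟨fun hx' => hx' _ (by simp [Idx.of]), fun h0 p hp => ?_⟩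
  rcases eq_or_ne p.1.2 s with hs | hs
  · rw [Idx.eq_of r s h p hs]
    exact h0
  · exact hx p (by omega)

theorem mem_cochainFil_pred_iff {r s n : ℕ} (h : r + s = n)
    {x : (D.cochain M (D.dHatCo_dHatCo M)).X n}
    (hx : x ∈ D.cochainFil M (D.dHatCo_dHatCo M) (-s) n) :
    x ∈ D.cochainFil M (D.dHatCo_dHatCo M) (-s - 1) n ↔
      (x : XhatCo k A H M n) (Idx.of r s h) = 0 := by
  refine ⟨fun hx' => hx' _ (by simp [Idx.of]), fun h0 p hp => ?_⟩
  rcases eq_or_ne p.1.2 s with hs | hs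
  · rw [Idx.eq_of r s h p hs]
    exact h0
  · exact hx p (by omega)

/-- An element of `X̂ₙ` concentrated at the index `(r, s)`. -/
theorem exists_chain_single {r s n : ℕ} (h : r + s = n) (z : M ⊗[k] Gen k A H r s) :
    ∃ x ∈ D.chainFil M (D.dHat_dHat M) s n, (x : Xhat k A H M n) (Idx.of r s h) = z := by
  refine ⟨(Pi.single (Idx.of r s h) z : Xhat k A H M n), fun p hp => ?_, ?_⟩
  · exact Pi.single_eq_of_ne (fun e => by rw [e] at hp; simp [Idx.of] at hp) _
  · exact Pi.single_eq_same (M := fun p : Idx n => M ⊗[k] Gen k A H p.1.1 p.1.2) (Idx.of r s h) z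

theorem exists_cochain_single {r s n : ℕ} (h : r + s = n) (z : Gen k A H r s →ₗ[k] M) :
    ∃ x ∈ D.cochainFil M (D.dHatCo_dHatCo M) (-s) n,
      (x : XhatCo k A H M n) (Idx.of r s h) = z := by
  refine ⟨(Pi.single (Idx.of r s h) z : XhatCo k A H M n), fun p hp => ?_, ?_⟩
  · exact Pi.single_eq_of_ne (fun e => by rw [e] at hp; simp [Idx.of] at hp) _
  · exact Pi.single_eq_same (M := fun p : Idx n => Gen k A H p.1.1 p.1.2 →ₗ[k] M) (Idx.of r s h) z

/-- On `F_s` the component of index `(r, s)` vanishes exactly on `F_{s-1}`, and `chain_d_component`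
with `componentEquiv_d0Gen` turns the differential on it into the Hochschild differential. Both ends
of the row need a separate look, since shapes may provide a differential on one side only. -/
theorem isGradedPiece_chainComponent (r s : ℕ) :
    IsGradedPiece (D.chain M (D.dHat_dHat M)) (D.chainFil M (D.dHat_dHat M)) s (r + s)
      (hochschildChain k A (D.TwTensor M s)) r (D.chainComponent M r s) where
  surj y := by
    obtain ⟨x, hx, e⟩ := D.exists_chain_single M (r := r) (s := s) rfl
      ((D.componentEquiv M r s).symm y)
    exact ⟨x, hx, (congrArg (D.componentEquiv M r s) e).trans (LinearEquiv.apply_symm_apply _ y)⟩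
  eq_zero_iff x hx := by
    rw [D.mem_chainFil_pred_iff M (r := r) (s := s) rfl hx]
    exact (D.componentEquiv M r s).map_eq_zero_iff
  cycle_iff x hx := by
    constructor
    · intro h j
      by_cases hj : j + 1 = r + s
      · have hd := (D.isFiltration_chain M).d_mem s (r + s) j x hx
        cases r with
        | zero =>
          -- In total degree `s - 1` there are at most `s - 1` factors `H̄`, so all chains lie in
          -- `F_{s-1}`.
          refine fun p hp => ?_
          have := p.le
          omega
        | succ r =>
          have hj' : r + s = j := by omega
          rw [D.mem_chainFil_pred_iff M hj' hd, D.chain_d_component M rfl hj' hx]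
          refine (D.componentEquiv M r s).map_eq_zero_iff.1 ?_
          exact (D.componentEquiv_d0Gen M r s _).trans
            ((hochschildChain_d_apply k A (D.TwTensor M s) r _).symm.trans (h r))
      · rw [HomologicalComplex.shape _ _ _ hj]
        exact zero_mem _
    · intro h j
      by_cases hj : j + 1 = r
      · subst hj
        have hd := (D.isFiltration_chain M).d_mem s (j + 1 + s) (j + s) x hx
        have h1 := (D.mem_chainFil_pred_iff M rfl hd).1 (h (j + s))
        rw [D.chain_d_component M rfl rfl hx] at h1
        refine (hochschildChain_d_apply k A (D.TwTensor M s) j _).trans ?_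
        exact (D.componentEquiv_d0Gen M j s _).symm.trans
          ((congrArg (D.componentEquiv M j s) h1).trans (map_zero _))
      · rw [HomologicalComplex.shape _ _ _ hj]
        rfl
  boundary_iff x hx := by
    constructor
    · rintro ⟨i, y, hy⟩
      by_cases hi : r + 1 = i
      · subst hi
        obtain ⟨b, hb, e⟩ := D.exists_chain_single M (r := r + 1) (s := s) rfl
          ((D.componentEquiv M (r + 1) s).symm y)
        refine ⟨_, b, hb, hy.symm.trans ?_⟩
        refine (hochschildChain_d_apply k A (D.TwTensor M s) r _).trans ?_
        refine Eq.trans ?_ (congrArg (D.componentEquiv M r s)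
          (D.chain_d_component M rfl rfl hb)).symm
        refine Eq.trans ?_ (D.componentEquiv_d0Gen M r s _).symm
        exact congrArg (chainMap (D.TwTensor M s) (barD k A r))
          (((D.componentEquiv M (r + 1) s).apply_symm_apply y).symm.trans
            (congrArg (D.componentEquiv M (r + 1) s) e.symm))
      · rw [HomologicalComplex.shape _ _ _ hi] at hy
        -- No differential of the Hochschild complex runs from `i` to `r`, so the boundary is zero,
        -- and zero in any degree is a witness.
        exact ⟨r + s, 0, zero_mem _, hy.symm.trans
          ((D.chainComponent M r s).map_zero.symm.trans (congrArg _ (map_zero _).symm))⟩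
    · rintro ⟨i, b, hb, e⟩
      by_cases hi : r + s + 1 = i
      · have hi' : r + 1 + s = i := by omega
        refine ⟨r + 1, D.componentEquiv M (r + 1) s ((b : Xhat k A H M i) (Idx.of (r + 1) s hi')),
          (hochschildChain_d_apply k A (D.TwTensor M s) r _).trans (Eq.trans ?_ e.symm)⟩
        exact (D.componentEquiv_d0Gen M r s _).symm.trans
          (congrArg (D.componentEquiv M r s) (D.chain_d_component M hi' rfl hb).symm)
      · rw [HomologicalComplex.shape _ _ _ hi] at e
        exact ⟨r, 0, (map_zero _).trans (e.trans (D.chainComponent M r s).map_zero).symm⟩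

theorem isGradedPiece_cochainComponent (r s : ℕ) :
    IsGradedPiece (D.cochain M (D.dHatCo_dHatCo M)) (D.cochainFil M (D.dHatCo_dHatCo M)) (-s) (r + s)
      (hochschildCochain k A (D.TwHom M s)) r (D.cochainComponent M r s) where
  surj y := by
    obtain ⟨x, hx, e⟩ := D.exists_cochain_single M (r := r) (s := s) rfl
      ((D.componentEquivCo M r s).symm y)
    exact ⟨x, hx, (congrArg (D.componentEquivCo M r s) e).trans (LinearEquiv.apply_symm_apply _ y)⟩
  eq_zero_iff x hx := by
    rw [D.mem_cochainFil_pred_iff M (r := r) (s := s) rfl hx]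
    exact (D.componentEquivCo M r s).map_eq_zero_iff
  cycle_iff x hx := by
    constructor
    · intro h j
      by_cases hj : r + s + 1 = j
      · have hd := (D.isFiltration_cochain M).d_mem (-s) (r + s) j x hx
        have hj' : r + 1 + s = j := by omega
        rw [D.mem_cochainFil_pred_iff M hj' hd, D.cochain_d_component M rfl hj' hx]
        refine (D.componentEquivCo M (r + 1) s).map_eq_zero_iff.1 ?_
        exact (D.componentEquivCo_d0Gen M r s _).trans
          ((hochschildCochain_d_apply k A (D.TwHom M s) r _).symm.trans (h (r + 1)))
      · rw [HomologicalComplex.shape _ _ _ hj]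
        exact zero_mem _
    · intro h j
      by_cases hj : r + 1 = j
      · subst hj
        have hd := (D.isFiltration_cochain M).d_mem (-s) (r + s) (r + 1 + s) x hx
        have h1 := (D.mem_cochainFil_pred_iff M rfl hd).1 (h (r + 1 + s))
        rw [D.cochain_d_component M rfl rfl hx] at h1
        refine (hochschildCochain_d_apply k A (D.TwHom M s) r _).trans ?_
        exact (D.componentEquivCo_d0Gen M r s _).symm.trans
          ((congrArg (D.componentEquivCo M (r + 1) s) h1).trans (map_zero _))
      · rw [HomologicalComplex.shape _ _ _ hj]
        rfl
  boundary_iff x hx := by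
    constructor
    · rintro ⟨i, y, hy⟩
      by_cases hi : i + 1 = r
      · subst hi
        obtain ⟨b, hb, e⟩ := D.exists_cochain_single M (r := i) (s := s) rfl
          ((D.componentEquivCo M i s).symm y)
        refine ⟨_, b, hb, hy.symm.trans ?_⟩
        refine (hochschildCochain_d_apply k A (D.TwHom M s) i _).trans ?_
        refine Eq.trans ?_ (congrArg (D.componentEquivCo M (i + 1) s)
          (D.cochain_d_component M rfl rfl hb)).symm
        refine Eq.trans ?_ (D.componentEquivCo_d0Gen M i s _).symm
        exact congrArg (cochainMap (D.TwHom M s) (barD k A i))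
          (((D.componentEquivCo M i s).apply_symm_apply y).symm.trans
            (congrArg (D.componentEquivCo M i s) e.symm))
      · rw [HomologicalComplex.shape _ _ _ hi] at hy
        exact ⟨r + s, 0, zero_mem _, hy.symm.trans
          ((D.cochainComponent M r s).map_zero.symm.trans (congrArg _ (map_zero _).symm))⟩
    · rintro ⟨i, b, hb, e⟩
      by_cases hi : i + 1 = r + s
      · cases r with
        | zero =>
          -- For `r = 0` the source has total degree `s - 1`, where no component has `s` factors
          -- `H̄`; this step of the filtration is zero there.
          have hb0 : b = 0 := funext fun p => hb p (by
            have := p.le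
            omega)
          rw [hb0, map_zero] at e
          exact ⟨0, 0, (map_zero _).trans (e.trans (D.cochainComponent M 0 s).map_zero).symm⟩
        | succ r =>
          have hi' : r + s = i := by omega
          refine ⟨r, D.componentEquivCo M r s ((b : XhatCo k A H M i) (Idx.of r s hi')),
            (hochschildCochain_d_apply k A (D.TwHom M s) r _).trans (Eq.trans ?_ e.symm)⟩
          exact (D.componentEquivCo_d0Gen M r s _).symm.trans
            (congrArg (D.componentEquivCo M (r + 1) s) (D.cochain_d_component M hi' rfl hb).symm)
      · rw [HomologicalComplex.shape _ _ _ hi] at e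
        exact ⟨r, 0, (map_zero _).trans (e.trans (D.cochainComponent M r s).map_zero).symm⟩

end Complexes
end CrossedProduct
end Crossed
end HopfCrossed
end

theorem corollary2p1p2p1 (k A H : Type u) [CommRing k] [Ring A] [Algebra k A] [Ring H]
    [HopfAlgebra k H] (D : CrossedProduct k A H) (M : Type u) [AddCommGroup M] [Module k M]
    [Module D.Alg M] [Module D.Algᵐᵒᵖ M] [IsScalarTower k D.Alg M] [IsScalarTower k D.Algᵐᵒᵖ M]
    [SMulCommClass D.Alg D.Algᵐᵒᵖ M] :
    (∃ (hd : ∀ n, D.dHat M n ∘ₗ D.dHat M (n + 1) = 0)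
      (S : SpectralSequence (ModuleCat.{u} k)
        (fun p => ComplexShape.spectralSequenceNat (p - 1, -p)) 1)
      (P : IsSpectralSequenceOf (D.chain M hd) (D.chainFil M hd) S
        (fun q => q.1 + q.2) (fun q => (q.2 : ℤ)))
      (e : ∀ r s : ℕ, (S.page 1).X (r, s) ≅ HH k A (D.TwTensor M s) r)
      (θ : ∀ n, (D.chain M hd).homology n ≅ HH k D.Alg M n),
      (∀ (r s : ℕ) (x : approxCycles (D.chain M hd) (D.chainFil M hd) 1 s (r + s))
        (w : (hochschildChain k A (D.TwTensor M s)).cycles r),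
        ((hochschildChain k A (D.TwTensor M s)).iCycles r).hom w =
          D.chainComponent M r s (x : (D.chain M hd).X (r + s)) →
        (e r s).hom.hom (P.proj 1 le_rfl (r, s) x) =
          ((hochschildChain k A (D.TwTensor M s)).homologyπ r).hom w) ∧
      Converges S (fun q => q.1 + q.2) (fun q => (q.2 : ℤ)) (fun n => HH k D.Alg M n)
        (fun i n => Submodule.map (θ n).hom.hom
          (homologyFil (D.chain M hd) (D.chainFil M hd) i n))) ∧
    (∃ (hd : ∀ n, D.dHatCo M (n + 1) ∘ₗ D.dHatCo M n = 0)
      (S : SpectralSequence (ModuleCat.{u} k)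
        (fun p => ComplexShape.spectralSequenceNat (1 - p, p)) 1)
      (P : IsSpectralSequenceOf (D.cochain M hd) (D.cochainFil M hd) S
        (fun q => q.1 + q.2) (fun q => -(q.2 : ℤ)))
      (e : ∀ r s : ℕ, (S.page 1).X (r, s) ≅ HHco k A (D.TwHom M s) r)
      (θ : ∀ n, (D.cochain M hd).homology n ≅ HHco k D.Alg M n),
      (∀ (r s : ℕ) (x : approxCycles (D.cochain M hd) (D.cochainFil M hd) 1 (-s) (r + s))
        (w : (hochschildCochain k A (D.TwHom M s)).cycles r),
        ((hochschildCochain k A (D.TwHom M s)).iCycles r).hom w =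
          D.cochainComponent M r s (x : (D.cochain M hd).X (r + s)) →
        (e r s).hom.hom (P.proj 1 le_rfl (r, s) x) =
          ((hochschildCochain k A (D.TwHom M s)).homologyπ r).hom w) ∧
      Converges S (fun q => q.1 + q.2) (fun q => -(q.2 : ℤ)) (fun n => HHco k D.Alg M n)
        (fun i n => Submodule.map (θ n).hom.hom
          (homologyFil (D.cochain M hd) (D.cochainFil M hd) i n)))
 := by
  have h := D.isFiltration_chain M
  have h' := D.isFiltration_cochain M
  have hg (r s : ℕ) := D.isGradedPiece_chainComponent M r s
  have hg' (r s : ℕ) := D.isGradedPiece_cochainComponent M r s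
  constructor
  · refine ⟨D.dHat_dHat M, h.spectralSequence, h.isSpectralSequenceOf,
      fun r s => h.pageOneIso (r, s) (hochschildChain k A (D.TwTensor M s)) r
        (D.chainComponent M r s) (hg r s), D.chainAbutment M, ?_, h.converges (D.chainAbutment M)⟩
    exact fun r s x w hw => h.pageOneIso_pageProj (r, s) (hochschildChain k A (D.TwTensor M s)) r
      (D.chainComponent M r s) (hg r s) x w hw
  · refine ⟨D.dHatCo_dHatCo M, h'.spectralSequence, h'.isSpectralSequenceOf,
      fun r s => h'.pageOneIso (r, s) (hochschildCochain k A (D.TwHom M s)) r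
        (D.cochainComponent M r s) (hg' r s), D.cochainAbutment M, ?_,
      h'.converges (D.cochainAbutment M)⟩
    exact fun r s x w hw => h'.pageOneIso_pageProj (r, s) (hochschildCochain k A (D.TwHom M s)) r
      (D.cochainComponent M r s) (hg' r s) x w hw
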